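/- **Setting.** Let $(V,+)$ be an infinite (not necessarily commutative) group with identity $O$, and let $S\subset V\setminus\{O\}$ be a finite symmetric generating set. The Cayley graph $G$ joins $g$ to $g+h$ for $g\in V$, $h\in S$; $d$ is its graph distance, $|x|=d(O,x)$, $W_n=\{x:|x|\le n\}$ for $0\le n<\infty$, $W_\infty=V$, $w_n=|W_n|$, and $\partial A=\{x\in A: x \text{ has a neighbour outside } A\}$. $G$ is *b-amenable* if $|\partial W_n|/|W_n|\to0$; it has *polynomial growth* if $w_n=O(n^{d_2})$ for some $d_2>0$. **Spin models.** Configurations $\mu\in\{0,1\}^V$ are identified with subsets of $V$; write $y+\mu=\{y+x:x\in\mu\}$. A spin model is a random configuration $\mathcal P$ that is stationary ($y+\mathcal P\overset d=\mathcal P$ for all $y\in V$) and non-degenerate ($0<\mathbb P(O\in\mathcal P)<1$); $\mathcal P_n=\mathcal P\cap W_n$. It is *clustering* with constants $C_k\in\mathbb R$, $c_k>0$ and function $\phi:[0,\infty)\to[0,1]$, where $\phi$ is non-increasing with $s^m\phi(s)\to0$ as $s\to\infty$ for all $m\ge1$, if for all disjoint non-empty finite $A,B\subset V$, with $k=|A|+|B|$,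 $$|\mathbb P(A\cup B\subset\mathcal P)-\mathbb P(A\subset\mathcal P)\,\mathbb P(B\subset\mathcal P)|\le C_k\,\phi(c_k\,d(A,B)).$$ $\phi$ is *summable* if $\sum_{x\in V}\phi(c|x|)^{1/p}<\infty$ for all $c>0$, $p\ge1$. $\mathcal P$ is *exponentially clustering* if it is clustering with $\inf_k c_k>0$, $C_k=O(k^{ak})$ for some $a\in[0,1)$, and $\limsup_{t\to\infty}t^{-b}\log\phi(t)<0$ for some $b>0$. **Score functions.** A score function is a measurable $\xi:V\times\{0,1\}^V\to\mathbb R$ with $\xi(y+x,y+\mu)=\xi(x,\mu)$ and with $\xi(x,\mu)=0$ if $x\notin\mu$. It is *local* if for some integer $r>0$, $\xi(O,\mu)$ depends only on $\mu\cap W_r$. Its *radius of stabilisation* is $R(x,\mu)=R(O,-x+\mu)$, where $R(O,\mu)\in\mathbb N\cup\{\infty\}$ is the least integer $r>0$ such that $\xi(O,\mu')=\xi(O,\mu)$ whenever $\mu'\cap W_r=\mu\cap W_r$. It is *exponentially quasi-local* on $\mathcal P$ if there are $A>0$, $c>0$ and a function $\varphi$ on $(0,\infty)$ decreasing to $0$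 such that $\limsup_{t\to\infty}t^{-c}\log\varphi(t)<0$ and $\mathbb P(R(x,\mathcal P_n)\ge t)\le A\varphi(t)$ for all $t>0$, $1\le n\le\infty$, $x\in W_n$. It satisfies the *exponential growth condition* if for some $\kappa\ge0$ and $c_*\in\mathbb R$, $|\xi(O,\mu\cap W_t)|\le e^{c_*t^\kappa}$ for all integers $t>0$ and all $\mu$; and the *$p$-moment condition* if $\sup_{1\le n\le\infty}\sup_{x\in W_n}\mathbb E[\max\{|\xi(x,\mathcal P_n)|,1\}^p]<\infty$. **Theorem (multivariate CLT).** Let $\mathcal P$ be a spin model on $V$ and $\xi_1,\dots,\xi_k$ score functions such that one of the following holds: 1. $G$ is b-amenable, $\mathcal P$ is clustering with a summable $\phi$, and all $\xi_i$ are local; 2. $G$ has polynomial growth, $\mathcal P$ is exponentially clustering, and every $\xi_i$ is exponentially quasi-local on $\mathcal P$ and satisfies the exponential growth condition and the $p$-moment condition for all $p\ge1$. Put $H_n^{\xi_i}=\sum_{x\in\mathcal P_n}\xi_i(x,\mathcal P_n)$ and $\bar H_n=(H_n^{\xi_1},\dots,H_n^{\xi_k})$. Then $\xi_i(z,\mathcal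 P)$ is square-integrable for all $i$ and $z$, each $H_n^{\xi_i}$ is integrable, the series $$\Sigma(i,j)=\sum_{z\in V}\mathrm{Cov}\big(\xi_i(O,\mathcal P),\xi_j(z,\mathcal P)\big)$$ converge absolutely, $\Sigma=(\Sigma(i,j))_{1\le i,j\le k}$ is symmetric positive semidefinite, and as $n\to\infty$ $$\frac{\bar H_n-\mathbb E\bar H_n}{\sqrt{w_n}}\ \Longrightarrow\ N(0,\Sigma)\quad\text{in distribution.}$$ -/

import Mathlib

open MeasureTheory ProbabilityTheory Filter Topology Asymptotics
open scoped Pointwise ENNReal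

namespace SpinCLT

noncomputable section

/-! ### Cayley graphs

The group is written additively but is not assumed to be commutative. Mathlib's
`SimpleGraph.addCayley S` joins `g` to `g + h` for `h ∈ S`, so left translations are graph
automorphisms. -/

/-- `S` is a finite symmetric generating set that does not contain the identity. -/
structure IsCayleyGenerating {V : Type*} [AddGroup V] (S : Finset V) : Prop where
  neg_mem : ∀ h ∈ S, -h ∈ S
  zero_notMem : (0 : V) ∉ S
  closure_eq_top : AddSubgroup.closure (S : Set V) = ⊤

/-- The ball `W_n` of radius `n` about the identity; the radius may be infinite, `W_∞ = V`. -/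
def window {V : Type*} [AddGroup V] (S : Finset V) (n : ℕ∞) : Set V :=
  {y | (SimpleGraph.addCayley (S : Set V)).edist 0 y ≤ n}

theorem window_finite {V : Type*} [AddGroup V] (S : Finset V) (n : ℕ) :
    (window S (n : ℕ∞)).Finite := by
  have key : ∀ (m : ℕ) (u : V), {v : V | ∃ p : (SimpleGraph.addCayley (S : Set V)).Walk u v,
      p.length = m}.Finite := by
    intro m
    induction m with
    | zero =>
      intro u
      refine (Set.finite_singleton u).subset ?_
      rintro v ⟨p, hp⟩
      exact (SimpleGraph.Walk.eq_of_length_eq_zero hp).symm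
    | succ m ih =>
      intro u
      have hN : {w : V | (SimpleGraph.addCayley (S : Set V)).Adj u w}.Finite := by
        refine ((S.finite_toSet.image (fun g => u + g)).union
          (S.finite_toSet.image (fun g => u - g))).subset ?_
        intro w hw
        obtain ⟨-, g, hg, h | h⟩ := (SimpleGraph.addCayley_adj' _ _ _).1 hw
        · exact Or.inl ⟨g, hg, h⟩
        · exact Or.inr ⟨g, hg, by simp [h]⟩
      refine (hN.biUnion (fun w _ => ih w)).subset ?_
      rintro v ⟨p, hp⟩
      cases p with
      | nil => simp at hp
      | cons h q =>
        simp only [Set.mem_iUnion]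
        exact ⟨_, h, q, by simpa using hp⟩
  refine ((Set.finite_Iic n).biUnion (fun m _ => key m 0)).subset ?_
  intro v hv
  have hv' : (SimpleGraph.addCayley (S : Set V)).edist 0 v ≤ (n : ℕ∞) := hv
  have hr : (SimpleGraph.addCayley (S : Set V)).Reachable 0 v :=
    SimpleGraph.reachable_of_edist_ne_top (ne_top_of_le_ne_top (ENat.natCast_ne_top n) hv')
  obtain ⟨p, hp⟩ := hr.exists_walk_length_eq_edist
  simp only [Set.mem_iUnion]
  refine ⟨p.length, ?_, p, rfl⟩
  rw [← hp] at hv'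
  exact_mod_cast hv'

/-- The ball `W_n` of finite radius as a finite set. -/
def windowFinset {V : Type*} [AddGroup V] (S : Finset V) (n : ℕ) : Finset V :=
  (window_finite S n).toFinset

/-- The inner vertex boundary `∂A = {x ∈ A : x has a neighbour outside A}`. -/
def innerBoundary {V : Type*} [AddGroup V] (S : Finset V) (A : Set V) : Set V :=
  {x ∈ A | ∃ y ∉ A, (SimpleGraph.addCayley (S : Set V)).Adj x y}

/-- Amenability along balls: `|∂W_n| / |W_n| → 0`. -/
def BAmenable {V : Type*} [AddGroup V] (S : Finset V) : Prop :=
  Tendsto (fun n : ℕ => ((innerBoundary S (window S n)).ncard : ℝ) / ((window S n).ncard : ℝ))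
    atTop (𝓝 0)

/-- Polynomial growth: `|W_n| = O(n^d)` for some `d > 0`. -/
def PolynomialGrowth {V : Type*} [AddGroup V] (S : Finset V) : Prop :=
  ∃ d : ℝ, 0 < d ∧ (fun n : ℕ => ((window S n).ncard : ℝ)) =O[atTop] fun n : ℕ => (n : ℝ) ^ d

/-- The graph distance between two (non-empty) finite sets of vertices. -/
def finsetDist {V : Type*} [AddGroup V] (S A B : Finset V) : ℕ :=
  sInf (Set.image2 (SimpleGraph.addCayley (S : Set V)).dist A B)

/-! ### Spin models

A configuration in `{0,1}^V` is identified with its support, an element of `Set V`, which carries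
the product sigma-algebra. The translate of `μ` by `y` is `y +ᵥ μ = {y + x : x ∈ μ}`. -/

/-- A stationary, non-degenerate spin model. -/
structure IsSpinModel {V Ω : Type*} [AddGroup V] [MeasurableSpace Ω] (Pr : Measure Ω)
    (P : Ω → Set V) : Prop where
  measurable : Measurable P
  stationary : ∀ y : V, IdentDistrib (fun ω => y +ᵥ P ω) P Pr Pr
  nondegenerate : Pr.real {ω | (0 : V) ∈ P ω} ∈ Set.Ioo (0 : ℝ) 1

/-- Fast decreasing functions on `[0, ∞)`. -/
structure FastDecreasing (φ : ℝ → ℝ) : Prop where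
  antitone : AntitoneOn φ (Set.Ici 0)
  le_one : ∀ s, 0 ≤ s → φ s ≤ 1
  tendsto : ∀ m : ℕ, 1 ≤ m → Tendsto (fun s : ℝ => s ^ m * φ s) atTop (𝓝 0)

/-- `P` is a clustering spin model with constants `C k`, `c k` and clustering function `φ`.
Here `A = {x_1, …, x_p}` and `B = {x_{p+1}, …, x_{p+q}}`. -/
structure ClustersWith {V Ω : Type*} [AddGroup V] [MeasurableSpace Ω] (S : Finset V)
    (Pr : Measure Ω) (P : Ω → Set V) (C c : ℕ → ℝ) (φ : ℝ → ℝ) : Prop where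
  isSpinModel : IsSpinModel Pr P
  fastDecreasing : FastDecreasing φ
  c_pos : ∀ k, 0 < c k
  bound : ∀ A B : Finset V, A.Nonempty → B.Nonempty → Disjoint A B →
    |Pr.real {ω | (A : Set V) ∪ B ⊆ P ω}
        - Pr.real {ω | (A : Set V) ⊆ P ω} * Pr.real {ω | (B : Set V) ⊆ P ω}|
      ≤ C (A.card + B.card) * φ (c (A.card + B.card) * finsetDist S A B)

/-- `φ` is summable in the Cayley graph: `∑_x φ(c|x|)^{1/p} < ∞` for all `c > 0`, `p ≥ 1`. -/
def SummableInGraph {V : Type*} [AddGroup V] (S : Finset V) (φ : ℝ → ℝ) : Prop :=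
  ∀ c : ℝ, 0 < c → ∀ p : ℝ, 1 ≤ p →
    Summable fun x : V => φ (c * (SimpleGraph.addCayley (S : Set V)).dist 0 x) ^ (1 / p)

/-- `limsup_{t → ∞} log φ(t) / t^b < 0`, with `log 0 = -∞`. -/
def StretchedExpDecay (φ : ℝ → ℝ) (b : ℝ) : Prop :=
  limsup (fun t : ℝ => ENNReal.log (ENNReal.ofReal (φ t)) / ((t ^ b : ℝ) : EReal)) atTop < 0

/-- A clustering spin model with summable clustering function. -/
def SummablyClustering {V Ω : Type*} [AddGroup V] [MeasurableSpace Ω] (S : Finset V)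
    (Pr : Measure Ω) (P : Ω → Set V) : Prop :=
  ∃ (C c : ℕ → ℝ) (φ : ℝ → ℝ), ClustersWith S Pr P C c φ ∧ SummableInGraph S φ

/-- An exponentially clustering spin model. -/
def ExpClustering {V Ω : Type*} [AddGroup V] [MeasurableSpace Ω] (S : Finset V)
    (Pr : Measure Ω) (P : Ω → Set V) : Prop :=
  ∃ (C c : ℕ → ℝ) (φ : ℝ → ℝ), ClustersWith S Pr P C c φ ∧
    (∃ c₀ : ℝ, 0 < c₀ ∧ ∀ k, c₀ ≤ c k) ∧
    (∃ a : ℝ, 0 ≤ a ∧ a < 1 ∧ C =O[atTop] fun k : ℕ => (k : ℝ) ^ (a * k)) ∧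
    (∃ b : ℝ, 0 < b ∧ StretchedExpDecay φ b)

/-! ### Score functions -/

/-- Translation-invariant score functions for spin models; by convention `ξ(x, μ) = 0` if
`x ∉ μ`. As `V` is countable and discrete, joint measurability means measurability of each
`ξ(x, ·)`. -/
structure IsScoreFunction {V : Type*} [AddGroup V] (ξ : V → Set V → ℝ) : Prop where
  measurable : ∀ x, Measurable (ξ x)
  translation : ∀ (y x : V) (μ : Set V), ξ (y + x) (y +ᵥ μ) = ξ x μ
  eq_zero : ∀ (x : V) (μ : Set V), x ∉ μ → ξ x μ = 0

/-- `ξ` is local: `ξ(O, μ)` is a function of the restriction of `μ` to some ball `W_r`. -/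
def IsLocal {V : Type*} [AddGroup V] (S : Finset V) (ξ : V → Set V → ℝ) : Prop :=
  ∃ r : ℕ, 0 < r ∧ ∃ ξ₀ : Set (window S r) → ℝ,
    ∀ μ : Set V, ξ 0 μ = ξ₀ ((Subtype.val : window S r → V) ⁻¹' μ)

/-- The radius of stabilisation `R(x, μ) = R(O, -x + μ)`, where `R(O, μ)` is the least `r > 0` such
that `ξ(O, μ') = ξ(O, μ)` for every configuration `μ'` that agrees with `μ` on `W_r`
(and is infinite if there is no such `r`). -/
def stabRadius {V : Type*} [AddGroup V] (S : Finset V) (ξ : V → Set V → ℝ) (x : V) (μ : Set V) :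
    ℕ∞ :=
  ⨅ (r : ℕ) (_ : 0 < r ∧ ∀ μ' : Set V,
    μ' ∩ window S r = (-x +ᵥ μ) ∩ window S r → ξ 0 (-x +ᵥ μ) = ξ 0 μ'), (r : ℕ∞)

/-- `ξ` is stabilising on `P` with rate `A φ`: for `1 ≤ n ≤ ∞`, `x ∈ W_n` and `t > 0`,
`Pr(R(x, P ∩ W_n) ≥ t) ≤ A φ(t)`, where `φ` decreases to `0`. -/
structure StabilisesWith {V Ω : Type*} [AddGroup V] [MeasurableSpace Ω] (S : Finset V)
    (Pr : Measure Ω) (P : Ω → Set V) (ξ : V → Set V → ℝ) (A : ℝ) (φ : ℝ → ℝ) : Prop where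
  const_pos : 0 < A
  antitone : AntitoneOn φ (Set.Ioi 0)
  tendsto : Tendsto φ atTop (𝓝 0)
  bound : ∀ n : ℕ∞, 1 ≤ n → ∀ x ∈ window S n, ∀ t : ℝ, 0 < t →
    Pr {ω | ENNReal.ofReal t ≤ (stabRadius S ξ x (P ω ∩ window S n) : ℝ≥0∞)}
      ≤ ENNReal.ofReal (A * φ t)

/-- Exponentially quasi-local score functions. -/
def ExpQuasiLocal {V Ω : Type*} [AddGroup V] [MeasurableSpace Ω] (S : Finset V)
    (Pr : Measure Ω) (P : Ω → Set V) (ξ : V → Set V → ℝ) : Prop :=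
  ∃ (A : ℝ) (φ : ℝ → ℝ), StabilisesWith S Pr P ξ A φ ∧ ∃ c : ℝ, 0 < c ∧ StretchedExpDecay φ c

/-- The exponential growth condition `|ξ(O, μ ∩ W_t)| ≤ exp(c_* t^κ)`. -/
def ExpGrowth {V : Type*} [AddGroup V] (S : Finset V) (ξ : V → Set V → ℝ) : Prop :=
  ∃ κ : ℝ, 0 ≤ κ ∧ ∃ cstar : ℝ, ∀ t : ℕ, 0 < t → ∀ μ : Set V,
    |ξ 0 (μ ∩ window S t)| ≤ Real.exp (cstar * (t : ℝ) ^ κ)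

/-- The `p`-moment condition
`sup_{1 ≤ n ≤ ∞} sup_{x ∈ W_n} E[max(|ξ(x, P ∩ W_n)|, 1)^p] < ∞`. -/
def MomentCondition {V Ω : Type*} [AddGroup V] [MeasurableSpace Ω] (S : Finset V)
    (Pr : Measure Ω) (P : Ω → Set V) (ξ : V → Set V → ℝ) (p : ℝ) : Prop :=
  ⨆ (n : ℕ∞) (_ : 1 ≤ n) (x : V) (_ : x ∈ window S n),
    ∫⁻ ω, ENNReal.ofReal (max |ξ x (P ω ∩ window S n)| 1 ^ p) ∂Pr < ∞

open Classical in
/-- The total mass `H_n(μ) = ∑_{x ∈ μ ∩ W_n} ξ(x, μ ∩ W_n)`. -/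
def totalMass {V : Type*} [AddGroup V] (S : Finset V) (ξ : V → Set V → ℝ) (n : ℕ) (μ : Set V) : ℝ :=
  ∑ x ∈ windowFinset S n with x ∈ μ, ξ x (μ ∩ window S n)

/-- The matrix `Σ(i,j) = ∑_{z ∈ V} Cov(ξ_i(O, P), ξ_j(z, P))`. -/
def limitCov {V Ω : Type*} [AddGroup V] [MeasurableSpace Ω] (Pr : Measure Ω) (P : Ω → Set V)
    {k : ℕ} (ξ : Fin k → V → Set V → ℝ) : Matrix (Fin k) (Fin k) ℝ :=
  Matrix.of fun i j => ∑' z : V, covariance (fun ω => ξ i 0 (P ω)) (fun ω => ξ j z (P ω)) Pr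

/-- The vector `(H_n^{ξ_1}, …, H_n^{ξ_k})` evaluated at `P`, centred and divided by `√|W_n|`. -/
def scaledMass {V Ω : Type*} [AddGroup V] [MeasurableSpace Ω] (S : Finset V) (Pr : Measure Ω)
    (P : Ω → Set V) {k : ℕ} (ξ : Fin k → V → Set V → ℝ) (n : ℕ) (ω : Ω) :
    EuclideanSpace ℝ (Fin k) :=
  WithLp.toLp 2 fun i =>
    (totalMass S (ξ i) n (P ω) - ∫ ω', totalMass S (ξ i) n (P ω') ∂Pr)
      / √((window S n).ncard : ℝ)

end

end SpinCLT

open SpinCLT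

/-! By Lévy's continuity theorem it suffices to study the characteristic function at each `t`, that
is, the single score `∑ i, t i • ξ i`. The admissible classes of scores are closed under linear
combinations, so one scalar limit theorem is enough (`multivariate_clt`). The scalar theorem is
proved by the method of moments, with no lower bound on the variance, so degenerate limits are
included.

Let `Y_x` be the centred scores on `W = W_n` and `w = |W|`. Expand a joint moment over the joint
cumulants that contain one distinguished index `o`: `E Y_o ∏_A Y = ∑_{B ⊆ A} κ(o ∪ B) E ∏_{A \ B}
Y`. Averaged over all tuples of points of `W`, repetitions allowed, each summand factorises, because
its two factors involve disjoint sets of indices. This gives an exact recursion for the moments of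
the spatial mean (`tupleAvg_cumulant_recursion`). Clustering bounds the averaged cumulant over `o ∪
B` by a constant times `w^(-|B|)`. After normalisation by `√w` a term with `|B| ≥ 2` is
`O(w^(-1/2))`, the term `B = ∅` vanishes by centring, and the `m` singletons give `m μ₂ μ_{m-1}`.
This is the Gaussian recursion (`ClusteringMoments.abs_moment_recursion_le`), so all moments
converge to Gaussian ones once the variance converges.

The cumulant bound comes from a gap argument. If the farthest of at most `m` points lies at distance
`D` from `z_o`, some annulus about `z_o` of width about `D/(m+1)` contains none of the points, so
the points split into two almost independent groups and the cumulant is small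
(`abs_jointCumulant_le_of_split`).

The variance converges by dominated convergence, because most points of a large ball are far from
its complement (`tendsto_avg_sum_sum`). For b-amenable groups this is almost the definition. Under
polynomial growth it follows from a covering argument at scales where the volume is doubling
(`card_annulus_le`).

Clustering of the scores is inherited from the spins. A bounded function of finitely many spins is a
combination of monomials `1[T ⊆ μ]`, whose correlations are controlled by hypothesis. A quasi-local
score is truncated where its radius of stabilisation exceeds `r`, with `r` a small power of the
separation `s`: then `r` is large enough for the truncation error to be negligible, and small enough
for the stretched exponential decay to beat every constant depending on `r`
(`fieldClusters_of_quasiLocal`). -/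

namespace SpinCLT

/-! ### Geometry of Cayley graphs -/

section Geometry

variable {V : Type*} [AddGroup V] {S : Finset V}

/-- The graph distance of the Cayley graph. -/
noncomputable abbrev cdist (S : Finset V) (x y : V) : ℕ := (SimpleGraph.addCayley (S : Set V)).dist x y

theorem reachable_add_left (a : V) {x y : V}
    (h : (SimpleGraph.addCayley (S : Set V)).Reachable x y) :
    (SimpleGraph.addCayley (S : Set V)).Reachable (a + x) (a + y) := by
  obtain ⟨p⟩ := h
  exact ⟨p.map ⟨(a + ·), fun h => (SimpleGraph.addCayley_adj_add_iff_right).2 h⟩⟩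

theorem reachable_zero (hS : IsCayleyGenerating S) (x : V) :
    (SimpleGraph.addCayley (S : Set V)).Reachable 0 x := by
  have hx : x ∈ AddSubgroup.closure (S : Set V) := by rw [hS.closure_eq_top]; trivial
  induction hx using AddSubgroup.closure_induction with
  | mem x hx =>
    refine SimpleGraph.Adj.reachable ?_
    rw [SimpleGraph.addCayley_adj]
    exact ⟨fun h => hS.zero_notMem (h ▸ hx), Or.inl (by simpa using hx)⟩
  | zero => exact SimpleGraph.Reachable.refl _
  | add x y _ _ hx hy => exact hx.trans (by simpa using reachable_add_left x hy)
  | neg x _ hx => simpa using (reachable_add_left (-x) hx).symm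

theorem cayley_connected (hS : IsCayleyGenerating S) :
    (SimpleGraph.addCayley (S : Set V)).Connected :=
  ⟨fun x y => (reachable_zero hS x).symm.trans (reachable_zero hS y)⟩

theorem cdist_add_left_le (hS : IsCayleyGenerating S) (a x y : V) :
    cdist S (a + x) (a + y) ≤ cdist S x y := by
  obtain ⟨p, hp⟩ := (cayley_connected hS).exists_walk_length_eq_dist x y
  have := SimpleGraph.dist_le
    (p.map ⟨(a + ·), fun h => (SimpleGraph.addCayley_adj_add_iff_right).2 h⟩ :
      (SimpleGraph.addCayley (S : Set V)).Walk (a + x) (a + y))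
  rw [SimpleGraph.Walk.length_map, hp] at this
  exact this

theorem cdist_add_left (hS : IsCayleyGenerating S) (a x y : V) :
    cdist S (a + x) (a + y) = cdist S x y := by
  refine le_antisymm (cdist_add_left_le hS a x y) ?_
  simpa using cdist_add_left_le hS (-a) (a + x) (a + y)

theorem cdist_eq_neg_add (hS : IsCayleyGenerating S) (x y : V) :
    cdist S x y = cdist S 0 (-x + y) := by
  simpa using (cdist_add_left hS (-x) x y).symm

theorem cdist_comm (x y : V) : cdist S x y = cdist S y x := SimpleGraph.dist_comm

theorem cdist_triangle (hS : IsCayleyGenerating S) (x y z : V) :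
    cdist S x z ≤ cdist S x y + cdist S y z := (cayley_connected hS).dist_triangle

theorem cdist_eq_zero_iff (hS : IsCayleyGenerating S) {x y : V} : cdist S x y = 0 ↔ x = y :=
  (cayley_connected hS).dist_eq_zero_iff

theorem mem_window_natCast (hS : IsCayleyGenerating S) {n : ℕ} {x : V} :
    x ∈ window S n ↔ cdist S 0 x ≤ n := by
  change (SimpleGraph.addCayley (S : Set V)).edist 0 x ≤ n ↔ _
  rw [← (reachable_zero hS x).coe_dist_eq_edist]
  exact Nat.cast_le

theorem window_top : window S ⊤ = Set.univ := by
  ext x; simp [window]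

theorem mem_windowFinset (hS : IsCayleyGenerating S) {n : ℕ} {x : V} :
    x ∈ windowFinset S n ↔ cdist S 0 x ≤ n := by
  simp [windowFinset, mem_window_natCast hS]

theorem coe_windowFinset (n : ℕ) : (windowFinset S n : Set V) = window S n := by
  simp [windowFinset]

theorem ncard_window (n : ℕ) : (window S n).ncard = (windowFinset S n).card := by
  rw [← coe_windowFinset, Set.ncard_coe_finset]

theorem zero_mem_windowFinset (hS : IsCayleyGenerating S) (n : ℕ) : (0 : V) ∈ windowFinset S n := by
  simp [mem_windowFinset hS]

theorem card_windowFinset_pos (hS : IsCayleyGenerating S) (n : ℕ) :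
    0 < (windowFinset S n).card := Finset.card_pos.2 ⟨0, zero_mem_windowFinset hS n⟩

theorem windowFinset_mono (hS : IsCayleyGenerating S) {m n : ℕ} (h : m ≤ n) :
    windowFinset S m ⊆ windowFinset S n := by
  intro x; rw [mem_windowFinset hS, mem_windowFinset hS]; omega

theorem card_windowFinset_mono (hS : IsCayleyGenerating S) {m n : ℕ} (h : m ≤ n) :
    (windowFinset S m).card ≤ (windowFinset S n).card :=
  Finset.card_le_card (windowFinset_mono hS h)

/-- The closed ball of radius `r` about `x`. -/
noncomputable def cball (S : Finset V) (x : V) (r : ℕ) : Finset V :=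
  (windowFinset S r).map (addLeftEmbedding x)

theorem mem_cball (hS : IsCayleyGenerating S) {x y : V} {r : ℕ} :
    y ∈ cball S x r ↔ cdist S x y ≤ r := by
  rw [cball, Finset.mem_map]
  constructor
  · rintro ⟨z, hz, rfl⟩
    rw [mem_windowFinset hS] at hz
    rw [cdist_eq_neg_add hS]
    simpa using hz
  · intro h
    refine ⟨-x + y, ?_, by simp⟩
    rwa [mem_windowFinset hS, ← cdist_eq_neg_add hS]

theorem card_cball (x : V) (r : ℕ) : (cball S x r).card = (windowFinset S r).card :=
  Finset.card_map _

/-- Every path may be followed to its end: points at prescribed distance along a geodesic. -/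
theorem exists_between (hS : IsCayleyGenerating S) (x y : V) {j : ℕ} (hj : j ≤ cdist S x y) :
    ∃ z, cdist S x z = j ∧ cdist S z y = cdist S x y - j := by
  obtain ⟨p, hp⟩ := (cayley_connected hS).exists_walk_length_eq_dist x y
  have h1 := SimpleGraph.dist_le (p.take j)
  have h2 := SimpleGraph.dist_le (p.drop j)
  have h3 := cdist_triangle hS x (p.getVert j) y
  simp only [SimpleGraph.Walk.take_length, SimpleGraph.Walk.drop_length] at h1 h2
  refine ⟨p.getVert j, ?_, ?_⟩ <;> simp only [cdist] at * <;> omega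

/-- A point of `A` near the complement of `A` is near the inner boundary of `A`. -/
theorem exists_innerBoundary_of_cdist (hS : IsCayleyGenerating S) {A : Set V} {x y : V}
    (hx : x ∈ A) (hy : y ∉ A) : ∃ b ∈ innerBoundary S A, cdist S b x ≤ cdist S x y := by
  obtain ⟨p, hp⟩ := (cayley_connected hS).exists_walk_length_eq_dist x y
  have key : ∀ {x y : V} (p : (SimpleGraph.addCayley (S : Set V)).Walk x y), x ∈ A → y ∉ A →
      ∃ b ∈ innerBoundary S A, cdist S b x ≤ p.length := by
    intro x y p
    induction p with
    | nil => intro h h'; exact absurd h h'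
    | @cons u v w h q ih =>
      intro hu hw
      by_cases hv : v ∈ A
      · obtain ⟨b, hb, hd⟩ := ih hv hw
        refine ⟨b, hb, (cdist_triangle hS b v u).trans ?_⟩
        have : cdist S v u = 1 := SimpleGraph.dist_eq_one_iff_adj.2 h.symm
        rw [SimpleGraph.Walk.length_cons]; omega
      · exact ⟨u, ⟨hu, v, hv, h⟩, by simp⟩
  obtain ⟨b, hb, hd⟩ := key p hx hy
  exact ⟨b, hb, hd.trans hp.le⟩

theorem exists_cdist_eq [Infinite V] (hS : IsCayleyGenerating S) (n : ℕ) :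
    ∃ x, cdist S 0 x = n := by
  obtain ⟨y, hy⟩ := Infinite.exists_notMem_finset (windowFinset S n)
  rw [mem_windowFinset hS, not_le] at hy
  obtain ⟨z, hz, -⟩ := exists_between hS 0 y hy.le
  exact ⟨z, hz⟩

theorem card_windowFinset_gt [Infinite V] (hS : IsCayleyGenerating S) (n : ℕ) :
    n < (windowFinset S n).card := by
  induction n with
  | zero => exact card_windowFinset_pos hS 0
  | succ n ih =>
    refine lt_of_le_of_lt (Nat.succ_le_of_lt ih) (Finset.card_lt_card ?_)
    refine (Finset.ssubset_iff_of_subset (windowFinset_mono hS n.le_succ)).2 ?_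
    obtain ⟨x, hx⟩ := exists_cdist_eq hS (n + 1)
    exact ⟨x, by rw [mem_windowFinset hS]; omega, by rw [mem_windowFinset hS]; omega⟩

theorem tendsto_card_windowFinset [Infinite V] (hS : IsCayleyGenerating S) :
    Tendsto (fun n => ((windowFinset S n).card : ℝ)) atTop atTop :=
  tendsto_atTop_mono (fun n => by exact_mod_cast (card_windowFinset_gt hS n).le)
    tendsto_natCast_atTop_atTop

open Classical in
/-- The points of `W_n` whose `r`-ball leaves `W_n`. -/
noncomputable def shallow (S : Finset V) (n r : ℕ) : Finset V :=
  (windowFinset S n).filter fun x => ¬ cball S x r ⊆ windowFinset S n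

/-- The windows form a Følner sequence, in the form used below. -/
def VanishingBoundary (S : Finset V) : Prop :=
  ∀ r, Tendsto (fun n => ((shallow S n r).card : ℝ) / (windowFinset S n).card) atTop (𝓝 0)

/-- A path of length at most `r` from a shallow point to the complement crosses the inner boundary
within distance `r` of its start. So the `r`-balls about `∂W_n` cover the shallow points, at the
price of the fixed factor `w_r`. -/
theorem BAmenable.vanishingBoundary (hS : IsCayleyGenerating S) (h : BAmenable S) :
    VanishingBoundary S := by
  classical
  intro r
  have key : ∀ n, (shallow S n r).card ≤
      (innerBoundary S (window S n)).ncard * (windowFinset S r).card := by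
    intro n
    have hfin : (innerBoundary S (window S n)).Finite :=
      (window_finite S n).subset fun x hx => hx.1
    have hsub : shallow S n r ⊆ hfin.toFinset.biUnion fun b => cball S b r := by
      intro x hx
      obtain ⟨hx1, hx2⟩ := Finset.mem_filter.1 hx
      obtain ⟨y, hy1, hy2⟩ := Finset.not_subset.1 hx2
      rw [mem_cball hS] at hy1
      rw [← Finset.mem_coe, coe_windowFinset] at hx1 hy2
      obtain ⟨b, hb, hd⟩ := exists_innerBoundary_of_cdist hS hx1 hy2
      simp only [Finset.mem_biUnion, Set.Finite.mem_toFinset]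
      exact ⟨b, hb, (mem_cball hS).2 (hd.trans hy1)⟩
    refine (Finset.card_le_card hsub).trans (Finset.card_biUnion_le.trans ?_)
    simp only [card_cball, Finset.sum_const, smul_eq_mul, Set.ncard_eq_toFinset_card _ hfin]
    rfl
  have h2 := h.mul_const ((windowFinset S r).card : ℝ)
  rw [zero_mul] at h2
  refine squeeze_zero (fun n => by positivity) (fun n => ?_) h2
  rw [ncard_window, div_mul_eq_mul_div]
  gcongr
  exact_mod_cast key n

end Geometry

/-! ### Polynomial growth -/

section Growth

variable {V : Type*} [AddGroup V] {S : Finset V}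

theorem PolynomialGrowth.exists_nat (h : PolynomialGrowth S) :
    ∃ D : ℕ, ∃ C : ℝ, 0 < C ∧ ∀ n : ℕ, ((windowFinset S n).card : ℝ) ≤ C * ((n : ℝ) + 1) ^ D := by
  obtain ⟨d, hd, hO⟩ := h
  obtain ⟨c, hc, hb⟩ := hO.exists_pos
  obtain ⟨N, hN⟩ := eventually_atTop.1 hb.bound
  set D := ⌈d⌉₊
  refine ⟨D, c + ∑ n ∈ Finset.range N, ((windowFinset S n).card : ℝ), by positivity, fun n => ?_⟩
  have h1 : (1 : ℝ) ≤ ((n : ℝ) + 1) ^ D := one_le_pow₀ (by linarith [n.cast_nonneg (α := ℝ)])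
  rcases lt_or_ge n N with hn | hn
  · have h2 : ((windowFinset S n).card : ℝ) ≤
        ∑ n ∈ Finset.range N, ((windowFinset S n).card : ℝ) :=
      Finset.single_le_sum (f := fun n => ((windowFinset S n).card : ℝ))
        (fun i _ => by positivity) (Finset.mem_range.2 hn)
    nlinarith
  · have h2 := hN n hn
    rw [ncard_window, Real.norm_of_nonneg (by positivity), Real.norm_of_nonneg (by positivity)] at h2
    have h3 : (n : ℝ) ^ d ≤ ((n : ℝ) + 1) ^ D := by
      calc (n : ℝ) ^ d ≤ ((n : ℝ) + 1) ^ d := by gcongr; linarith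
        _ ≤ ((n : ℝ) + 1) ^ (D : ℝ) :=
          Real.rpow_le_rpow_of_exponent_le (by linarith [n.cast_nonneg (α := ℝ)]) (Nat.le_ceil d)
        _ = _ := Real.rpow_natCast _ _
    have h4 : 0 ≤ ∑ n ∈ Finset.range N, ((windowFinset S n).card : ℝ) := by positivity
    nlinarith

/-- Sum over spheres. Each sphere is bounded by its ball, so two powers more than the growth
exponent leave a multiple of `∑ (n+1)^(-2)`. -/
theorem PolynomialGrowth.summable (hS : IsCayleyGenerating S) (h : PolynomialGrowth S) :
    ∃ D : ℕ, Summable fun x : V => (((cdist S 0 x : ℕ) : ℝ) + 1) ^ (-(D : ℝ)) := by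
  classical
  obtain ⟨D, C, hC, hw⟩ := h.exists_nat
  have hsum : Summable fun n : ℕ => C * ((n : ℝ) + 1) ^ D * ((n : ℝ) + 1) ^ (-((D + 2 : ℕ) : ℝ)) := by
    have h2 : Summable fun n : ℕ => C * (1 / (((n + 1 : ℕ) : ℝ)) ^ 2) :=
      ((summable_nat_add_iff 1).2 (Real.summable_one_div_nat_pow.2 one_lt_two)).mul_left C
    refine h2.congr fun n => ?_
    have hn : (0 : ℝ) < (n : ℝ) + 1 := by positivity
    rw [Real.rpow_neg hn.le, Real.rpow_natCast, pow_add]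
    push_cast
    field_simp
  refine ⟨D + 2, summable_of_sum_le (fun x => by positivity) (c := ∑' n : ℕ,
    C * ((n : ℝ) + 1) ^ D * ((n : ℝ) + 1) ^ (-((D + 2 : ℕ) : ℝ))) fun u => ?_⟩
  set N := u.sup (fun x => cdist S 0 x) + 1
  rw [← Finset.sum_fiberwise_of_maps_to (s := u) (t := Finset.range N)
    (g := fun x => cdist S 0 x) (fun x hx => Finset.mem_range.2
      (Nat.lt_succ_of_le (Finset.le_sup (f := fun x => cdist S 0 x) hx)))]
  refine le_trans (Finset.sum_le_sum fun n _ => ?_)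
    (hsum.sum_le_tsum (Finset.range N) fun n _ => by positivity)
  rw [Finset.sum_congr rfl (g := fun _ => ((n : ℝ) + 1) ^ (-((D + 2 : ℕ) : ℝ)))
    (fun x hx => by rw [(Finset.mem_filter.1 hx).2]), Finset.sum_const, nsmul_eq_mul]
  gcongr
  refine le_trans ?_ (hw n)
  exact_mod_cast Finset.card_le_card fun x hx => by
    rw [mem_windowFinset hS]; exact (Finset.mem_filter.1 hx).2.le

/-- Under polynomial growth there are arbitrarily large scales at which the volume is doubling. -/
theorem PolynomialGrowth.exists_doubling (hS : IsCayleyGenerating S) (h : PolynomialGrowth S) :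
    ∃ K : ℕ, ∀ k₀ : ℕ, ∃ k ≥ k₀, 0 < k ∧
      (windowFinset S (8 * k)).card ≤ K * (windowFinset S k).card := by
  obtain ⟨D, C, hC, hw⟩ := h.exists_nat
  refine ⟨8 ^ (D + 1), fun k₀ => ?_⟩
  -- If doubling failed at all scales `8^j * m`, the volume would gain a factor `8^(D+1)` per step,
  -- whereas the growth bound permits only about `8^D`.
  by_contra! hcon
  set m := k₀ + 1
  have key : ∀ j : ℕ, (8 ^ (D + 1)) ^ j ≤ (windowFinset S (8 ^ j * m)).card := by
    intro j
    induction j with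
    | zero => simpa using card_windowFinset_pos hS m
    | succ j ih =>
      have hpos : 1 ≤ 8 ^ j := Nat.one_le_pow _ _ (by norm_num)
      have h1 := hcon (8 ^ j * m) ((Nat.le_succ k₀).trans (Nat.le_mul_of_pos_left m hpos)) (by positivity)
      have h2 : 8 * (8 ^ j * m) = 8 ^ (j + 1) * m := by ring
      rw [h2] at h1
      calc (8 ^ (D + 1)) ^ (j + 1) = 8 ^ (D + 1) * (8 ^ (D + 1)) ^ j := by ring
        _ ≤ 8 ^ (D + 1) * (windowFinset S (8 ^ j * m)).card := by gcongr
        _ ≤ _ := h1.le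
  obtain ⟨j, hj⟩ := pow_unbounded_of_one_lt (C * ((m : ℝ) + 1) ^ D) (by norm_num : (1 : ℝ) < 8)
  have h1 : ((8 : ℝ) ^ (D + 1)) ^ j ≤ C * (((8 ^ j * m : ℕ) : ℝ) + 1) ^ D := by
    refine le_trans ?_ (hw _)
    exact_mod_cast key j
  have h8 : (1 : ℝ) ≤ 8 ^ j := one_le_pow₀ (by norm_num)
  have h2 : (((8 ^ j * m : ℕ) : ℝ) + 1) ^ D ≤ (8 ^ j) ^ D * ((m : ℝ) + 1) ^ D := by
    rw [← mul_pow]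
    gcongr
    push_cast
    nlinarith
  have h3 : ((8 : ℝ) ^ (D + 1)) ^ j = (8 ^ j) ^ D * 8 ^ j := by
    rw [← pow_mul, ← pow_mul, ← pow_add]; ring_nf
  have h4 : (0 : ℝ) < (8 ^ j) ^ D := by positivity
  rw [h3] at h1
  have h5 : (8 ^ j) ^ D * (8 : ℝ) ^ j ≤ (8 ^ j) ^ D * (C * ((m : ℝ) + 1) ^ D) := by
    refine h1.trans ?_
    calc _ ≤ C * ((8 ^ j) ^ D * ((m : ℝ) + 1) ^ D) := by gcongr
      _ = _ := by ring
  exact absurd (le_of_mul_le_mul_left h5 h4) (not_le.2 hj)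

/-- At a doubling scale `k`, the outer annulus of a large ball has volume comparable to that of the
next annulus. -/
theorem card_annulus_le (hS : IsCayleyGenerating S) {K k n : ℕ}
    (hK : (windowFinset S (8 * k)).card ≤ K * (windowFinset S k).card) (hn : 6 * k ≤ n) :
    (windowFinset S n).card - (windowFinset S (n - 2 * k)).card ≤
      K ^ 2 * ((windowFinset S (n - 2 * k)).card - (windowFinset S (n - 6 * k)).card) := by
  classical
  rw [← Finset.card_sdiff_of_subset (windowFinset_mono hS (Nat.sub_le _ _)),
    ← Finset.card_sdiff_of_subset (windowFinset_mono hS (by omega))]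
  set A := windowFinset S n \ windowFinset S (n - 2 * k) with hA
  set A' := windowFinset S (n - 2 * k) \ windowFinset S (n - 6 * k) with hA'
  have memA : ∀ x, x ∈ A ↔ cdist S 0 x ≤ n ∧ n - 2 * k < cdist S 0 x := by
    intro x; simp only [hA, Finset.mem_sdiff, mem_windowFinset hS]; omega
  have memA' : ∀ x, x ∈ A' ↔ cdist S 0 x ≤ n - 2 * k ∧ n - 6 * k < cdist S 0 x := by
    intro x; simp only [hA', Finset.mem_sdiff, mem_windowFinset hS]; omega
  -- `T` is a `2k`-separated subset of the outer annulus of largest cardinality.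
  obtain ⟨T, hT, hmax⟩ := (A.powerset.filter fun T =>
    ∀ x ∈ T, ∀ y ∈ T, x ≠ y → 2 * k < cdist S x y).exists_max_image Finset.card
    ⟨∅, by simp⟩
  simp only [Finset.mem_filter, Finset.mem_powerset] at hT hmax
  obtain ⟨hTA, hsep⟩ := hT
  -- the balls of radius `2k` about the points of `T` cover `A`
  have hcover : A ⊆ T.biUnion fun t => cball S t (2 * k) := by
    intro x hx
    by_contra hcon
    simp only [Finset.mem_biUnion, mem_cball hS, not_exists, not_and, not_le] at hcon
    have hxT : x ∉ T := fun h => by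
      have := hcon x h; simp at this
    have := hmax (insert x T) ⟨Finset.insert_subset hx hTA, ?_⟩
    · rw [Finset.card_insert_of_notMem hxT] at this; omega
    · intro a ha b hb hab
      rcases Finset.mem_insert.1 ha with ha' | ha' <;> rcases Finset.mem_insert.1 hb with hb' | hb'
      · exact absurd (ha'.trans hb'.symm) hab
      · rw [ha', cdist_comm]; exact hcon b hb'
      · rw [hb']; exact hcon a ha'
      · exact hsep a ha' b hb' hab
  have hcard1 : A.card ≤ T.card * (windowFinset S (8 * k)).card := by
    refine (Finset.card_le_card hcover).trans (Finset.card_biUnion_le.trans ?_)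
    simp only [card_cball, Finset.sum_const, smul_eq_mul]
    exact Nat.mul_le_mul_left _ (card_windowFinset_mono hS (by omega))
  -- push the points of `T` inwards
  have hpush : ∀ t ∈ T, ∃ y, cdist S t y = 3 * k ∧ cdist S 0 y = cdist S 0 t - 3 * k := by
    intro t ht
    have h1 := (memA t).1 (hTA ht)
    obtain ⟨z, hz1, hz2⟩ := exists_between hS 0 t (j := cdist S 0 t - 3 * k) (by omega)
    exact ⟨z, by rw [cdist_comm, hz2]; omega, hz1⟩
  choose! y hy1 hy2 using hpush
  -- The shift by `3k` puts `y t` at a distance in `(n-5k, n-3k]` from the identity, so its `k`-ball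
  -- stays in the inner annulus `(n-6k, n-2k]`.
  have hin : ∀ t ∈ T, cball S (y t) k ⊆ A' := by
    intro t ht p hp
    rw [mem_cball hS] at hp
    have h1 := (memA t).1 (hTA ht)
    have h2 := hy2 t ht
    have h3 := cdist_triangle hS 0 (y t) p
    have h4 := cdist_triangle hS 0 p (y t)
    rw [cdist_comm p] at h4
    rw [memA']
    omega
  -- Bounded overlap: the `k`-balls about the points of `T` are disjoint, and those whose shifted
  -- ball contains `p` lie within `k + 3k + k ≤ 8k` of `p`. Doubling then allows at most `K` of
  -- them.
  have hmult : ∀ p, (T.filter fun t => p ∈ cball S (y t) k).card ≤ K := by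
    intro p
    have hdisj : ((T.filter fun t => p ∈ cball S (y t) k : Finset V) : Set V).PairwiseDisjoint
        fun t => cball S t k := by
      intro a ha b hb hab
      have ha' := (Finset.mem_filter.1 ha).1
      have hb' := (Finset.mem_filter.1 hb).1
      rw [Function.onFun, Finset.disjoint_left]
      intro q hqa hqb
      rw [mem_cball hS] at hqa hqb
      have h1 := hsep a ha' b hb' hab
      have h2 := cdist_triangle hS a q b
      rw [cdist_comm q] at h2
      omega
    have h1 : ((T.filter fun t => p ∈ cball S (y t) k).biUnion fun t => cball S t k) ⊆
        cball S p (8 * k) := by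
      intro q hq
      obtain ⟨t, ht, hqt⟩ := Finset.mem_biUnion.1 hq
      obtain ⟨htT, htp⟩ := Finset.mem_filter.1 ht
      rw [mem_cball hS] at htp hqt ⊢
      have h1 := hy1 t htT
      have h2 := cdist_triangle hS p (y t) t
      have h3 := cdist_triangle hS p t q
      rw [cdist_comm p (y t), cdist_comm (y t) t] at h2
      omega
    have h2 := (Finset.card_le_card h1).trans_eq (card_cball p (8 * k))
    rw [Finset.card_biUnion hdisj] at h2
    simp only [card_cball, Finset.sum_const, smul_eq_mul] at h2
    exact Nat.le_of_mul_le_mul_right (h2.trans hK) (card_windowFinset_pos hS k)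
  have hcard2 : T.card * (windowFinset S k).card ≤ K * A'.card := by
    calc T.card * (windowFinset S k).card = ∑ t ∈ T, (cball S (y t) k).card := by
          simp [card_cball]
      _ = ∑ t ∈ T, ∑ p ∈ A', if p ∈ cball S (y t) k then 1 else 0 := by
          refine Finset.sum_congr rfl fun t ht => ?_
          rw [← Finset.sum_filter, Finset.sum_const, smul_eq_mul, mul_one,
            Finset.filter_mem_eq_inter, Finset.inter_eq_right.2 (hin t ht)]
      _ = ∑ p ∈ A', ∑ t ∈ T, if p ∈ cball S (y t) k then 1 else 0 := Finset.sum_comm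
      _ ≤ ∑ p ∈ A', K := by
          refine Finset.sum_le_sum fun p _ => ?_
          rw [← Finset.sum_filter, Finset.sum_const, smul_eq_mul, mul_one]
          exact hmult p
      _ = K * A'.card := by simp [mul_comm]
  calc A.card ≤ T.card * (windowFinset S (8 * k)).card := hcard1
    _ ≤ T.card * (K * (windowFinset S k).card) := by gcongr
    _ = K * (T.card * (windowFinset S k).card) := by ring
    _ ≤ K * (K * A'.card) := by gcongr
    _ = _ := by ring

/-- The annulus comparison rearranges to: the outer shell of width `2k` has at most the fraction `θ
= K²/(1+K²) < 1` of the outer shell of width `6k`. Since `K` is the same for all doubling scales,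
this can be iterated through `J` increasing scales, and a shell of fixed width occupies at most the
fraction `θ^J` of a large ball. -/
theorem PolynomialGrowth.vanishingBoundary (hS : IsCayleyGenerating S) (h : PolynomialGrowth S) :
    VanishingBoundary S := by
  classical
  obtain ⟨K, hK⟩ := h.exists_doubling hS
  set w : ℕ → ℝ := fun n => (windowFinset S n).card with hw
  set θ : ℝ := K ^ 2 / (1 + K ^ 2)
  have hθ0 : 0 ≤ θ := by positivity
  have hθ1 : θ < 1 := by rw [div_lt_one (by positivity)]; linarith
  have hmono : ∀ {m n : ℕ}, m ≤ n → w m ≤ w n := fun hmn =>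
    Nat.cast_le.2 (card_windowFinset_mono hS hmn)
  have hstep : ∀ {k n : ℕ}, (windowFinset S (8 * k)).card ≤ K * (windowFinset S k).card →
      6 * k ≤ n → w n - w (n - 2 * k) ≤ θ * (w n - w (n - 6 * k)) := by
    intro k n hk hn
    have h1 := card_annulus_le hS hk hn
    have h2 : w n - w (n - 2 * k) ≤ K ^ 2 * (w (n - 2 * k) - w (n - 6 * k)) := by
      have h3 := card_windowFinset_mono hS (Nat.sub_le n (2 * k))
      have h4 := card_windowFinset_mono (V := V) hS (show n - 6 * k ≤ n - 2 * k by omega)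
      zify [h3, h4] at h1
      simp only [hw]
      exact_mod_cast h1
    rw [div_mul_eq_mul_div, le_div_iff₀ (by positivity)]
    nlinarith
  -- The width `r` is quantified inside the induction: a doubling scale `k ≥ r` reduces width `r` to
  -- width `6k`, where the hypothesis for `J` applies.
  have hiter : ∀ J r : ℕ, ∃ N, ∀ n ≥ N, w n - w (n - r) ≤ θ ^ J * w n := by
    intro J
    induction J with
    | zero => intro r; exact ⟨0, fun n _ => by simp [w]⟩
    | succ J ih =>
      intro r
      obtain ⟨k, hkr, -, hk⟩ := hK r
      obtain ⟨N, hN⟩ := ih (6 * k)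
      refine ⟨max N (6 * k), fun n hn => ?_⟩
      have h1 := hstep hk ((le_max_right _ _).trans hn)
      have h2 := hN n ((le_max_left _ _).trans hn)
      have h3 : w (n - 2 * k) ≤ w (n - r) := hmono (by omega)
      calc w n - w (n - r) ≤ θ * (w n - w (n - 6 * k)) := by linarith
        _ ≤ θ * (θ ^ J * w n) := by gcongr
        _ = _ := by ring
  intro r
  rw [Metric.tendsto_atTop]
  intro ε hε
  obtain ⟨J, hJ⟩ := exists_pow_lt_of_lt_one hε hθ1
  obtain ⟨N, hN⟩ := hiter J r
  refine ⟨max N r, fun n hn => ?_⟩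
  have hwpos : 0 < w n := Nat.cast_pos.2 (card_windowFinset_pos hS n)
  have hsub : shallow S n r ⊆ windowFinset S n \ windowFinset S (n - r) := by
    intro x hx
    obtain ⟨hx1, hx2⟩ := Finset.mem_filter.1 hx
    refine Finset.mem_sdiff.2 ⟨hx1, fun hx3 => hx2 fun y hy => ?_⟩
    rw [mem_windowFinset hS] at hx3 ⊢
    rw [mem_cball hS] at hy
    have := cdist_triangle hS 0 x y
    have := (le_max_right N r).trans hn
    omega
  have hcard : ((shallow S n r).card : ℝ) ≤ w n - w (n - r) := by
    have h1 := Finset.card_le_card hsub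
    rw [Finset.card_sdiff_of_subset (windowFinset_mono hS (Nat.sub_le _ _))] at h1
    have h3 := card_windowFinset_mono hS (Nat.sub_le n r)
    zify [h3] at h1
    simp only [hw]
    exact_mod_cast h1
  rw [Real.dist_eq, sub_zero, abs_of_nonneg (by positivity), div_lt_iff₀ hwpos]
  calc _ ≤ w n - w (n - r) := hcard
    _ ≤ θ ^ J * w n := hN n ((le_max_left _ _).trans hn)
    _ < ε * w n := by gcongr

end Growth

/-! ### Joint cumulants with a distinguished index -/

section Cumulant

variable {ι : Type*} [DecidableEq ι]

/-- Joint cumulants, obtained from the joint moments `M` by the recursion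
`M (insert o A) = ∑_{B ⊆ A} κ(B) M (A \ B)`; here `κ(B)` is the joint cumulant of `insert o B`. -/
noncomputable def jointCumulant (M : Finset ι → ℝ) (o : ι) (A : Finset ι) : ℝ :=
  M (insert o A) - ∑ B ∈ A.ssubsets.attach, jointCumulant M o B.1 * M (A \ B.1)
termination_by A.card
decreasing_by exact Finset.card_lt_card (Finset.mem_ssubsets.1 B.2)

theorem jointCumulant_eq (M : Finset ι → ℝ) (o : ι) (A : Finset ι) :
    jointCumulant M o A = M (insert o A) - ∑ B ∈ A.ssubsets, jointCumulant M o B * M (A \ B) := by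
  rw [jointCumulant, Finset.sum_attach A.ssubsets fun B => jointCumulant M o B * M (A \ B)]

theorem sum_jointCumulant_mul {M : Finset ι → ℝ} (hM : M ∅ = 1) (o : ι) (A : Finset ι) :
    ∑ B ∈ A.powerset, jointCumulant M o B * M (A \ B) = M (insert o A) := by
  rw [← Finset.insert_erase (Finset.mem_powerset_self A),
    Finset.sum_insert (Finset.notMem_erase _ _), Finset.sdiff_self, hM, mul_one,
    jointCumulant_eq, Finset.ssubsets, sub_add_cancel]

/-- Locality of cumulants. It shows that the cumulant over `o ∪ B` depends only on the points
indexed by `o ∪ B`, as the factorisation of tuple averages requires. -/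
theorem jointCumulant_congr {M M' : Finset ι → ℝ} {o : ι} {A : Finset ι}
    (h : ∀ B ⊆ insert o A, M B = M' B) : jointCumulant M o A = jointCumulant M' o A := by
  induction A using Finset.strongInduction with
  | H A ih =>
    rw [jointCumulant_eq, jointCumulant_eq, h _ le_rfl]
    congr 1
    refine Finset.sum_congr rfl fun B hB => ?_
    rw [Finset.mem_ssubsets] at hB
    rw [ih B hB fun C hC => h C (hC.trans (Finset.insert_subset_insert o hB.1)),
      h (A \ B) (Finset.sdiff_subset.trans (Finset.subset_insert _ _))]

/-- A bound on cumulants of moments that are at most `K`. -/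
noncomputable def cumulantBound (K : ℝ) : ℕ → ℝ
  | 0 => K
  | n + 1 => K + 2 ^ (n + 1) * cumulantBound K n * K

theorem cumulantBound_nonneg {K : ℝ} (hK : 0 ≤ K) : ∀ n, 0 ≤ cumulantBound K n
  | 0 => hK
  | n + 1 => by have := cumulantBound_nonneg hK n; rw [cumulantBound]; positivity

theorem cumulantBound_mono {K : ℝ} (hK : 1 ≤ K) : Monotone (cumulantBound K) := by
  refine monotone_nat_of_le_succ fun n => ?_
  have h0 := cumulantBound_nonneg (zero_le_one.trans hK) n
  have h1 : (1 : ℝ) ≤ 2 ^ (n + 1) := one_le_pow₀ one_le_two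
  rw [cumulantBound]
  have h2 : cumulantBound K n ≤ 2 ^ (n + 1) * cumulantBound K n := le_mul_of_one_le_left h0 h1
  have h3 : 2 ^ (n + 1) * cumulantBound K n ≤ 2 ^ (n + 1) * cumulantBound K n * K :=
    le_mul_of_one_le_right (by positivity) hK
  linarith

theorem abs_jointCumulant_le {K : ℝ} (hK : 1 ≤ K) {M : Finset ι → ℝ} {o : ι} {A : Finset ι}
    (hM : ∀ B ⊆ insert o A, |M B| ≤ K) : |jointCumulant M o A| ≤ cumulantBound K A.card := by
  induction A using Finset.strongInduction with
  | H A ih =>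
    rw [jointCumulant_eq]
    have hK0 : 0 ≤ K := zero_le_one.trans hK
    rcases A.eq_empty_or_nonempty with rfl | hA
    · simpa [cumulantBound, Finset.ssubsets] using hM {o} (by simp)
    obtain ⟨n, hn⟩ : ∃ n, A.card = n + 1 := ⟨A.card - 1, by have := hA.card_pos; omega⟩
    rw [hn, cumulantBound]
    refine (abs_sub _ _).trans (add_le_add (hM _ le_rfl) ?_)
    calc |∑ B ∈ A.ssubsets, jointCumulant M o B * M (A \ B)|
        ≤ ∑ B ∈ A.ssubsets, |jointCumulant M o B * M (A \ B)| := Finset.abs_sum_le_sum_abs _ _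
      _ ≤ ∑ B ∈ A.ssubsets, cumulantBound K n * K := by
        refine Finset.sum_le_sum fun B hB => ?_
        rw [Finset.mem_ssubsets] at hB
        rw [abs_mul]
        refine mul_le_mul ((ih B hB fun C hC =>
          hM C (hC.trans (Finset.insert_subset_insert o hB.1))).trans (cumulantBound_mono hK ?_))
          (hM _ (Finset.sdiff_subset.trans (Finset.subset_insert _ _))) (abs_nonneg _)
          (cumulantBound_nonneg hK0 _)
        have := Finset.card_lt_card hB
        omega
      _ ≤ ∑ B ∈ A.powerset, cumulantBound K n * K := by
        refine Finset.sum_le_sum_of_subset_of_nonneg (Finset.erase_subset _ _) fun _ _ _ => ?_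
        have := cumulantBound_nonneg hK0 n
        positivity
      _ = _ := by rw [Finset.sum_const, Finset.card_powerset, nsmul_eq_mul, hn]; push_cast; ring

/-- The factor by which cumulants of clustering moments are small. -/
noncomputable def cumulantSplitBound (K : ℝ) : ℕ → ℝ
  | 0 => 0
  | n + 1 => 1 + 2 ^ (n + 1) * cumulantBound K (n + 1) + 2 ^ (n + 1) * cumulantSplitBound K n * K

theorem cumulantSplitBound_nonneg {K : ℝ} (hK : 0 ≤ K) : ∀ n, 0 ≤ cumulantSplitBound K n
  | 0 => le_rfl
  | n + 1 => by
    have := cumulantSplitBound_nonneg hK n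
    have := cumulantBound_nonneg hK (n + 1)
    rw [cumulantSplitBound]; positivity

theorem cumulantSplitBound_mono {K : ℝ} (hK : 1 ≤ K) : Monotone (cumulantSplitBound K) := by
  refine monotone_nat_of_le_succ fun n => ?_
  have hK0 : 0 ≤ K := zero_le_one.trans hK
  have h0 := cumulantSplitBound_nonneg hK0 n
  have h4 := cumulantBound_nonneg hK0 (n + 1)
  have h1 : (1 : ℝ) ≤ 2 ^ (n + 1) := one_le_pow₀ one_le_two
  rw [cumulantSplitBound]
  have h2 : cumulantSplitBound K n ≤ 2 ^ (n + 1) * cumulantSplitBound K n :=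
    le_mul_of_one_le_left h0 h1
  have h3 : 2 ^ (n + 1) * cumulantSplitBound K n ≤ 2 ^ (n + 1) * cumulantSplitBound K n * K :=
    le_mul_of_one_le_right (by positivity) hK
  have h5 : 0 ≤ 2 ^ (n + 1) * cumulantBound K (n + 1) := by positivity
  linarith

/-- A joint cumulant is small if its indices split into two almost independent groups. -/
theorem abs_jointCumulant_le_of_split {K ε : ℝ} (hK : 1 ≤ K) (hε : 0 ≤ ε) {M : Finset ι → ℝ}
    (hM1 : M ∅ = 1) {o : ι} {A₁ A₂ : Finset ι} (hdisj : Disjoint A₁ A₂) (ho : o ∉ A₂)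
    (hne : A₂.Nonempty) (hM : ∀ B ⊆ insert o (A₁ ∪ A₂), |M B| ≤ K)
    (hsplit : ∀ B₁ ⊆ insert o A₁, ∀ B₂ ⊆ A₂, |M (B₁ ∪ B₂) - M B₁ * M B₂| ≤ ε) :
    |jointCumulant M o (A₁ ∪ A₂)| ≤ cumulantSplitBound K (A₁ ∪ A₂).card * ε := by
  obtain ⟨N, hN⟩ : ∃ N, (A₁ ∪ A₂).card = N := ⟨_, rfl⟩
  induction N using Nat.strong_induction_on generalizing A₁ A₂ with
  | _ N ih =>
  have hK0 : 0 ≤ K := zero_le_one.trans hK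
  set A := A₁ ∪ A₂ with hA
  obtain ⟨n, rfl⟩ : ∃ n, N = n + 1 :=
    ⟨N - 1, by have := (hne.mono Finset.subset_union_right : A.Nonempty).card_pos; omega⟩
  have hsub1 : A₁ ⊆ A := Finset.subset_union_left
  -- As `A₂` is non-empty, every subset of `A₁` occurs among the proper subsets of `A`. The
  -- recursion for `A` can therefore be compared term by term with the recursion for `A₁` multiplied
  -- by `M A₂`.
  have hpow : A₁.powerset ⊆ A.ssubsets := by
    intro B hB
    rw [Finset.mem_powerset] at hB
    rw [Finset.mem_ssubsets]
    refine Finset.ssubset_iff_subset_ne.2 ⟨hB.trans hsub1, ?_⟩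
    rintro rfl
    obtain ⟨x, hx⟩ := hne
    exact Finset.disjoint_left.1 hdisj (hB (Finset.mem_union_right _ hx)) hx
  have hcb := cumulantBound_nonneg hK0 (n + 1)
  have hcs := cumulantSplitBound_nonneg hK0 n
  -- the cumulant as a sum of three error terms
  have hdecomp : jointCumulant M o A = (M (insert o A) - M (insert o A₁) * M A₂)
      - ∑ B ∈ A₁.powerset, jointCumulant M o B * (M (A \ B) - M (A₁ \ B) * M A₂)
      - ∑ B ∈ A.ssubsets \ A₁.powerset, jointCumulant M o B * M (A \ B) := by
    rw [jointCumulant_eq, ← Finset.sum_sdiff hpow, ← sum_jointCumulant_mul hM1 o A₁,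
      Finset.sum_mul]
    simp only [mul_sub, Finset.sum_sub_distrib]
    have : ∀ B, jointCumulant M o B * (M (A₁ \ B) * M A₂) = jointCumulant M o B * M (A₁ \ B) * M A₂ :=
      fun B => by ring
    simp only [this]
    ring
  have e1 : |M (insert o A) - M (insert o A₁) * M A₂| ≤ ε := by
    have := hsplit (insert o A₁) le_rfl A₂ le_rfl
    rwa [Finset.insert_union] at this
  have e2 : |∑ B ∈ A₁.powerset, jointCumulant M o B * (M (A \ B) - M (A₁ \ B) * M A₂)| ≤
      2 ^ (n + 1) * cumulantBound K (n + 1) * ε := by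
    calc _ ≤ ∑ B ∈ A₁.powerset, |jointCumulant M o B * (M (A \ B) - M (A₁ \ B) * M A₂)| :=
          Finset.abs_sum_le_sum_abs _ _
      _ ≤ ∑ B ∈ A₁.powerset, cumulantBound K (n + 1) * ε := by
        refine Finset.sum_le_sum fun B hB => ?_
        rw [Finset.mem_powerset] at hB
        rw [abs_mul]
        refine mul_le_mul ?_ ?_ (abs_nonneg _) hcb
        · refine (abs_jointCumulant_le hK fun C hC => hM C (hC.trans
            (Finset.insert_subset_insert o (hB.trans hsub1)))).trans (cumulantBound_mono hK ?_)
          rw [← hN]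
          exact Finset.card_le_card (hB.trans hsub1)
        · have h1 : A \ B = (A₁ \ B) ∪ A₂ := by
            rw [hA, Finset.union_sdiff_distrib, Finset.sdiff_eq_self_of_disjoint
              (hdisj.symm.mono_right hB)]
          rw [h1]
          exact hsplit _ (Finset.sdiff_subset.trans (Finset.subset_insert _ _)) _ le_rfl
      _ ≤ ∑ B ∈ A.powerset, cumulantBound K (n + 1) * ε :=
        Finset.sum_le_sum_of_subset_of_nonneg (Finset.powerset_mono.2 hsub1)
          fun _ _ _ => by positivity
      _ = _ := by rw [Finset.sum_const, Finset.card_powerset, nsmul_eq_mul, hN]; push_cast; ring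
  -- A proper subset not contained in `A₁` meets `A₂`, so it is itself split by `A₁` and `A₂` and
  -- the induction hypothesis makes its cumulant small.
  have e3 : |∑ B ∈ A.ssubsets \ A₁.powerset, jointCumulant M o B * M (A \ B)| ≤
      2 ^ (n + 1) * cumulantSplitBound K n * K * ε := by
    calc _ ≤ ∑ B ∈ A.ssubsets \ A₁.powerset, |jointCumulant M o B * M (A \ B)| :=
          Finset.abs_sum_le_sum_abs _ _
      _ ≤ ∑ B ∈ A.ssubsets \ A₁.powerset, cumulantSplitBound K n * ε * K := by
        refine Finset.sum_le_sum fun B hB => ?_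
        rw [Finset.mem_sdiff, Finset.mem_ssubsets, Finset.mem_powerset] at hB
        obtain ⟨hB1, hB2⟩ := hB
        rw [abs_mul]
        refine mul_le_mul ?_ (hM _ (Finset.sdiff_subset.trans (Finset.subset_insert _ _)))
          (abs_nonneg _) (by positivity)
        have hBeq : (B ∩ A₁) ∪ (B ∩ A₂) = B := by
          rw [← Finset.inter_union_distrib_left, Finset.inter_eq_left]
          exact hB1.1
        have hcard : B.card < n + 1 := hN ▸ Finset.card_lt_card hB1
        have := ih B.card hcard (A₁ := B ∩ A₁) (A₂ := B ∩ A₂)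
          (hdisj.mono Finset.inter_subset_right Finset.inter_subset_right)
          (fun h => ho (Finset.mem_inter.1 h).2) ?_
          (fun C hC => hM C (hC.trans (Finset.insert_subset_insert o (hBeq.le.trans hB1.1))))
          (fun B₁ h₁ B₂ h₂ => hsplit B₁
            (h₁.trans (Finset.insert_subset_insert o Finset.inter_subset_right)) B₂
            (h₂.trans Finset.inter_subset_right)) (by rw [hBeq])
        · rw [hBeq] at this
          refine this.trans (mul_le_mul_of_nonneg_right (cumulantSplitBound_mono hK ?_) hε)
          omega
        · rw [Finset.nonempty_iff_ne_empty]
          intro h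
          rw [h, Finset.union_empty, Finset.inter_eq_left] at hBeq
          exact hB2 hBeq
      _ ≤ ∑ B ∈ A.powerset, cumulantSplitBound K n * ε * K :=
        Finset.sum_le_sum_of_subset_of_nonneg
          (Finset.sdiff_subset.trans (Finset.erase_subset _ _)) fun _ _ _ => by positivity
      _ = _ := by rw [Finset.sum_const, Finset.card_powerset, nsmul_eq_mul, hN]; push_cast; ring
  rw [hN, hdecomp, cumulantSplitBound]
  refine (abs_sub _ _).trans ((add_le_add ((abs_sub _ _).trans (add_le_add e1 e2)) e3).trans ?_)
  apply le_of_eq; ring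

end Cumulant

/-! ### Averages over tuples -/

section Average

variable {ι V : Type*} [Fintype ι] [DecidableEq ι]

/-- The average of `F` over all tuples of points of `W`. -/
noncomputable def tupleAvg (W : Finset V) (F : (ι → V) → ℝ) : ℝ :=
  (∑ z ∈ Fintype.piFinset fun _ : ι => W, F z) / (W.card : ℝ) ^ Fintype.card ι

theorem tupleAvg_prod (W : Finset V) (h : ι → V → ℝ) :
    tupleAvg W (fun z => ∏ i, h i (z i)) = ∏ i, (∑ y ∈ W, h i y) / W.card := by
  rw [tupleAvg, Finset.prod_div_distrib, Finset.prod_univ_sum]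
  simp

theorem tupleAvg_sum {α : Type*} (W : Finset V) (s : Finset α) (F : α → (ι → V) → ℝ) :
    tupleAvg W (fun z => ∑ a ∈ s, F a z) = ∑ a ∈ s, tupleAvg W (F a) := by
  simp only [tupleAvg]
  rw [Finset.sum_comm, Finset.sum_div]

theorem abs_tupleAvg_le {W : Finset V} {F G : (ι → V) → ℝ}
    (h : ∀ z, (∀ i, z i ∈ W) → |F z| ≤ G z) : |tupleAvg W F| ≤ tupleAvg W G := by
  rw [tupleAvg, tupleAvg, abs_div, abs_of_nonneg (by positivity : (0 : ℝ) ≤ (W.card : ℝ) ^ _)]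
  gcongr
  exact (Finset.abs_sum_le_sum_abs _ _).trans
    (Finset.sum_le_sum fun z hz => h z (Fintype.mem_piFinset.1 hz))

/-- Coordinates of a uniform tuple are independent. The proof is by an involution: exchanging the
`B`-coordinates within a pair of tuples leaves `F` unchanged and moves the argument of `G` from one
tuple to the other. -/
theorem tupleAvg_mul_of_disjoint {W : Finset V} (hW : W.Nonempty) {A B : Finset ι}
    (hAB : Disjoint A B) {F G : (ι → V) → ℝ}
    (hF : ∀ z z', (∀ i ∈ A, z i = z' i) → F z = F z')
    (hG : ∀ z z', (∀ i ∈ B, z i = z' i) → G z = G z') :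
    tupleAvg W (fun z => F z * G z) = tupleAvg W F * tupleAvg W G := by
  set X := Fintype.piFinset fun _ : ι => W with hX
  have hcard : (X.card : ℝ) = (W.card : ℝ) ^ Fintype.card ι := by simp [hX]
  have hpos : (0 : ℝ) < (W.card : ℝ) ^ Fintype.card ι := by
    have := hW.card_pos; positivity
  have hswap : ∑ p ∈ X ×ˢ X, F p.1 * G p.1 = ∑ p ∈ X ×ˢ X, F p.1 * G p.2 := by
    have hmem : ∀ p ∈ X ×ˢ X, (B.piecewise p.2 p.1, B.piecewise p.1 p.2) ∈ X ×ˢ X := by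
      intro p hp
      simp only [hX, Finset.mem_product, Fintype.mem_piFinset] at hp ⊢
      refine ⟨fun i => ?_, fun i => ?_⟩ <;> by_cases hi : i ∈ B <;> simp [hi, hp.1 i, hp.2 i]
    refine Finset.sum_nbij' (fun p => (B.piecewise p.2 p.1, B.piecewise p.1 p.2))
      (fun p => (B.piecewise p.2 p.1, B.piecewise p.1 p.2)) hmem hmem ?_ ?_ ?_
    · intro p _
      ext i <;> by_cases hi : i ∈ B <;> simp [hi]
    · intro p _
      ext i <;> by_cases hi : i ∈ B <;> simp [hi]
    · intro p _
      congr 1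
      · refine hF _ _ fun i hi => ?_
        simp [Finset.disjoint_left.1 hAB hi]
      · refine hG _ _ fun i hi => ?_
        simp [hi]
  rw [Finset.sum_product, Finset.sum_product] at hswap
  simp only [Finset.sum_const, nsmul_eq_mul, ← Finset.mul_sum, ← Finset.sum_mul] at hswap
  rw [hcard] at hswap
  simp only [tupleAvg, ← hX]
  rw [div_mul_div_comm, ← hswap, mul_div_mul_left _ _ hpos.ne']

end Average

/-! ### Random variables with all moments -/

section Moments

variable {Ω : Type*} [MeasurableSpace Ω] {Pr : Measure Ω}

/-- A measurable function with finite moments of all orders. -/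
structure HasMoments (Pr : Measure Ω) (f : Ω → ℝ) : Prop where
  measurable : Measurable f
  integrable_pow : ∀ p : ℕ, Integrable (fun ω => |f ω| ^ p) Pr

theorem HasMoments.integrable {f : Ω → ℝ} (hf : HasMoments Pr f) : Integrable f Pr := by
  have := hf.integrable_pow 1
  simp only [pow_one] at this
  exact (integrable_norm_iff hf.measurable.aestronglyMeasurable).1 this

theorem HasMoments.mul {f g : Ω → ℝ} (hf : HasMoments Pr f) (hg : HasMoments Pr g) :
    HasMoments Pr (fun ω => f ω * g ω) where
  measurable := hf.measurable.mul hg.measurable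
  integrable_pow p := by
    refine Integrable.mono' ((hf.integrable_pow (2 * p)).add (hg.integrable_pow (2 * p)))
      (((hf.measurable.mul hg.measurable).norm).pow_const p).aestronglyMeasurable
      (ae_of_all _ fun ω => ?_)
    rw [Real.norm_of_nonneg (by positivity), abs_mul, mul_pow, Pi.add_apply, pow_mul', pow_mul']
    nlinarith [sq_nonneg (|f ω| ^ p - |g ω| ^ p), sq_nonneg (|f ω| ^ p), sq_nonneg (|g ω| ^ p)]

theorem abs_add_pow_le (a b : ℝ) (p : ℕ) : |a + b| ^ p ≤ 2 ^ p * (|a| ^ p + |b| ^ p) := by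
  rcases le_total |a| |b| with h | h
  · calc |a + b| ^ p ≤ (2 * |b|) ^ p := by gcongr; linarith [abs_add_le a b]
      _ = 2 ^ p * |b| ^ p := mul_pow _ _ _
      _ ≤ _ := by gcongr; linarith [pow_nonneg (abs_nonneg a) p]
  · calc |a + b| ^ p ≤ (2 * |a|) ^ p := by gcongr; linarith [abs_add_le a b]
      _ = 2 ^ p * |a| ^ p := mul_pow _ _ _
      _ ≤ _ := by gcongr; linarith [pow_nonneg (abs_nonneg b) p]

theorem HasMoments.add {f g : Ω → ℝ} (hf : HasMoments Pr f) (hg : HasMoments Pr g) :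
    HasMoments Pr (fun ω => f ω + g ω) where
  measurable := hf.measurable.add hg.measurable
  integrable_pow p := by
    refine Integrable.mono' (((hf.integrable_pow p).add (hg.integrable_pow p)).const_mul (2 ^ p))
      (((hf.measurable.add hg.measurable).norm).pow_const p).aestronglyMeasurable
      (ae_of_all _ fun ω => ?_)
    rw [Real.norm_of_nonneg (by positivity), Pi.add_apply]
    exact abs_add_pow_le _ _ p

theorem HasMoments.const [IsFiniteMeasure Pr] (c : ℝ) : HasMoments Pr (fun _ : Ω => c) where
  measurable := measurable_const
  integrable_pow _ := integrable_const _

theorem HasMoments.of_bounded [IsFiniteMeasure Pr] {f : Ω → ℝ} (hf : Measurable f) {b : ℝ}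
    (hb : ∀ ω, |f ω| ≤ b) : HasMoments Pr f where
  measurable := hf
  integrable_pow p := by
    refine Integrable.of_bound (hf.norm.pow_const p).aestronglyMeasurable (b ^ p)
      (ae_of_all _ fun ω => ?_)
    rw [Real.norm_of_nonneg (by positivity)]
    exact pow_le_pow_left₀ (abs_nonneg _) (hb ω) p

theorem HasMoments.abs {f : Ω → ℝ} (hf : HasMoments Pr f) : HasMoments Pr (fun ω => |f ω|) where
  measurable := hf.measurable.abs
  integrable_pow p := by simpa using hf.integrable_pow p

theorem HasMoments.const_mul [IsFiniteMeasure Pr] {f : Ω → ℝ} (hf : HasMoments Pr f) (c : ℝ) :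
    HasMoments Pr (fun ω => c * f ω) := (HasMoments.const c).mul hf

theorem HasMoments.sub_const [IsFiniteMeasure Pr] {f : Ω → ℝ} (hf : HasMoments Pr f) (c : ℝ) :
    HasMoments Pr (fun ω => f ω - c) := by
  simpa only [sub_eq_add_neg] using hf.add (HasMoments.const (-c))

theorem HasMoments.finset_prod [IsFiniteMeasure Pr] {α : Type*} {A : Finset α} {f : α → Ω → ℝ}
    (hf : ∀ i ∈ A, HasMoments Pr (f i)) : HasMoments Pr (fun ω => ∏ i ∈ A, f i ω) := by
  classical
  induction A using Finset.induction_on with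
  | empty => simpa using HasMoments.const (Pr := Pr) 1
  | insert a A ha ih =>
    simp only [Finset.prod_insert ha]
    exact (hf a (Finset.mem_insert_self a A)).mul
      (ih fun i hi => hf i (Finset.mem_insert_of_mem hi))

theorem HasMoments.finset_sum [IsFiniteMeasure Pr] {α : Type*} {A : Finset α} {f : α → Ω → ℝ}
    (hf : ∀ i ∈ A, HasMoments Pr (f i)) : HasMoments Pr (fun ω => ∑ i ∈ A, f i ω) := by
  classical
  induction A using Finset.induction_on with
  | empty => simpa using HasMoments.const (Pr := Pr) 0
  | insert a A ha ih =>
    simp only [Finset.sum_insert ha]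
    exact (hf a (Finset.mem_insert_self a A)).add
      (ih fun i hi => hf i (Finset.mem_insert_of_mem hi))

theorem HasMoments.pow [IsFiniteMeasure Pr] {f : Ω → ℝ} (hf : HasMoments Pr f) (p : ℕ) :
    HasMoments Pr (fun ω => f ω ^ p) := by
  simpa using HasMoments.finset_prod (A := Finset.range p) (f := fun _ => f) fun _ _ => hf

theorem HasMoments.memLp_two {f : Ω → ℝ} (hf : HasMoments Pr f) : MemLp f 2 Pr := by
  rw [memLp_two_iff_integrable_sq hf.measurable.aestronglyMeasurable]
  simpa using hf.integrable_pow 2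

end Moments

/-! ### The moment recursion -/

section Recursion

variable {V Ω : Type*} [AddGroup V] [MeasurableSpace Ω] {S : Finset V} {Pr : Measure Ω}

/-- The joint moment `E ∏_{i ∈ A} Y(z_i)`. -/
noncomputable def jointMoment {ι : Type*} (Pr : Measure Ω) (Y : V → Ω → ℝ) (z : ι → V)
    (A : Finset ι) : ℝ := ∫ ω, ∏ i ∈ A, Y (z i) ω ∂Pr

omit [AddGroup V] in
theorem jointMoment_congr {ι : Type*} {Y : V → Ω → ℝ} {z z' : ι → V} {A : Finset ι}
    (h : ∀ i ∈ A, z i = z' i) : jointMoment Pr Y z A = jointMoment Pr Y z' A := by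
  simp only [jointMoment]
  congr 1; ext ω
  exact Finset.prod_congr rfl fun i hi => by rw [h i hi]

/-- The field `Y` on `W` has joint moments of `m + 1` factors that are bounded by `K` and cluster
at rate `Q ψ`. -/
structure ClusteringMoments (S : Finset V) (Pr : Measure Ω) (Y : V → Ω → ℝ) (W : Finset V) (m : ℕ)
    (K Q : ℝ) (ψ : ℕ → ℝ) : Prop where
  bound : ∀ z : Fin (m + 1) → V, (∀ i, z i ∈ W) → ∀ A : Finset (Fin (m + 1)),
    |jointMoment Pr Y z A| ≤ K
  cluster : ∀ z : Fin (m + 1) → V, (∀ i, z i ∈ W) → ∀ A B : Finset (Fin (m + 1)), Disjoint A B →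
    ∀ s : ℕ, (∀ i ∈ A, ∀ j ∈ B, s ≤ cdist S (z i) (z j)) →
      |jointMoment Pr Y z (A ∪ B) - jointMoment Pr Y z A * jointMoment Pr Y z B| ≤ Q * ψ s

/-- Pigeonhole: at most `m` numbers cannot meet all of the `m + 1` disjoint open intervals `(jq,
(j+1)q)`. -/
theorem exists_gap {ι : Type*} (B : Finset ι) (r : ι → ℕ) {m q : ℕ} (hB : B.card ≤ m) :
    ∃ j ≤ m, ∀ i ∈ B, j * q < r i → (j + 1) * q ≤ r i := by
  classical
  rcases B.eq_empty_or_nonempty with rfl | ⟨b, _⟩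
  · exact ⟨0, Nat.zero_le m, by simp⟩
  have : Nonempty ι := ⟨b⟩
  by_contra! h
  choose! f hf1 hf2 hf3 using h
  have hmaps : ∀ j ∈ Finset.range (m + 1), f j ∈ B := fun j hj =>
    hf1 j (Nat.lt_succ_iff.1 (Finset.mem_range.1 hj))
  obtain ⟨a, ha, b, hb, hab, hfab⟩ := Finset.exists_ne_map_eq_of_card_lt_of_maps_to
    (s := Finset.range (m + 1)) (t := B) (by simp; omega) hmaps
  have ha' := Nat.lt_succ_iff.1 (Finset.mem_range.1 ha)
  have hb' := Nat.lt_succ_iff.1 (Finset.mem_range.1 hb)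
  have h1 := hf2 a ha'
  have h2 := hf3 a ha'
  have h3 := hf2 b hb'
  have h4 := hf3 b hb'
  rw [hfab] at h1 h2
  rcases lt_or_gt_of_ne hab with h | h
  · have := Nat.mul_le_mul_right q (show a + 1 ≤ b from h)
    omega
  · have := Nat.mul_le_mul_right q (show b + 1 ≤ a from h)
    omega

variable {Y : V → Ω → ℝ} {W : Finset V} {m : ℕ} {K Q : ℝ} {ψ : ℕ → ℝ}

/-- A gap of width `q = D/(m+1)` in the distances from `z o`, with `D` the largest, separates the
points near `z o` from the far ones, and the cumulant is of order `ψ q`. This is then spread over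
the indices in `B` as a product, the form that can be summed over each point separately. -/
theorem ClusteringMoments.abs_jointCumulant_le [IsProbabilityMeasure Pr] (hS : IsCayleyGenerating S)
    (h : ClusteringMoments S Pr Y W m K Q ψ) (hK : 1 ≤ K) (hQ : 0 ≤ Q) (hψ : Antitone ψ)
    (hψ0 : ∀ s, 0 ≤ ψ s) (hψ1 : ∀ s, ψ s ≤ 1) {z : Fin (m + 1) → V} (hz : ∀ i, z i ∈ W)
    {o : Fin (m + 1)} {B : Finset (Fin (m + 1))} (ho : o ∉ B) (hB : B.Nonempty) :
    |jointCumulant (jointMoment Pr Y z) o B| ≤ cumulantSplitBound K m * Q *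
      ∏ i ∈ B, ψ (cdist S (z o) (z i) / (m + 1)) ^ (1 / (m : ℝ)) := by
  have hBm : B.card ≤ m := by
    have := Finset.card_lt_univ_of_notMem ho
    simp at this; omega
  have hm : 0 < m := hB.card_pos.trans_le hBm
  obtain ⟨i₀, hi₀, hmax⟩ := B.exists_max_image (fun i => cdist S (z o) (z i)) hB
  set q := cdist S (z o) (z i₀) / (m + 1) with hq
  have hM1 : jointMoment Pr Y z ∅ = 1 := by simp [jointMoment]
  have hbound : |jointCumulant (jointMoment Pr Y z) o B| ≤ cumulantSplitBound K m * (Q * ψ q) := by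
    have hmono : cumulantSplitBound K B.card * (Q * ψ q) ≤ cumulantSplitBound K m * (Q * ψ q) :=
      mul_le_mul_of_nonneg_right (cumulantSplitBound_mono hK hBm) (mul_nonneg hQ (hψ0 q))
    refine le_trans ?_ hmono
    obtain ⟨j, hjm, hj⟩ := exists_gap B (fun i => cdist S (z o) (z i)) (q := q) hBm
    have hqD : q * (m + 1) ≤ cdist S (z o) (z i₀) := Nat.div_mul_le_self _ _
    -- If `q = 0` the sets defined by a gap may leave the far group empty. No separation is needed
    -- then, and `{o}` is split from `B`.
    rcases Nat.eq_zero_or_pos q with hq0 | hq0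
    · have := abs_jointCumulant_le_of_split (A₁ := ∅) (A₂ := B) hK (mul_nonneg hQ (hψ0 q)) hM1
        (Finset.disjoint_empty_left _) ho hB (fun C _ => h.bound z hz C) fun B₁ h₁ B₂ h₂ =>
          h.cluster z hz B₁ B₂ ?_ q (by simp [hq0])
      · simpa using this
      · refine Finset.disjoint_of_subset_left h₁ (Finset.disjoint_of_subset_right h₂ ?_)
        simpa using ho
    · set B₁ := B.filter fun i => cdist S (z o) (z i) ≤ j * q with hB₁
      set B₂ := B.filter fun i => ¬ cdist S (z o) (z i) ≤ j * q with hB₂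
      have hBB : B₁ ∪ B₂ = B := Finset.filter_union_filter_not_eq _ _
      have hdisj : Disjoint B₁ B₂ := Finset.disjoint_filter_filter_not _ _ _
      have hoB₂ : o ∉ B₂ := fun h => ho (Finset.mem_filter.1 h).1
      have := abs_jointCumulant_le_of_split (A₁ := B₁) (A₂ := B₂) hK (mul_nonneg hQ (hψ0 q)) hM1
        hdisj hoB₂ ⟨i₀, ?_⟩ (fun C _ => h.bound z hz C)
        fun C₁ h₁ C₂ h₂ => h.cluster z hz C₁ C₂ ?_ q ?_
      · rwa [hBB] at this
      · refine Finset.mem_filter.2 ⟨hi₀, ?_⟩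
        have : (j + 1) * q ≤ (m + 1) * q := Nat.mul_le_mul_right q (by omega)
        have e : (j + 1) * q = j * q + q := by ring
        have e' : q * (m + 1) = (m + 1) * q := mul_comm _ _
        omega
      · refine Finset.disjoint_of_subset_left h₁ (Finset.disjoint_of_subset_right h₂ ?_)
        exact Finset.disjoint_insert_left.2 ⟨hoB₂, hdisj⟩
      · intro i hi k hk
        have hk' := Finset.mem_filter.1 (h₂ hk)
        have h3 : (j + 1) * q ≤ cdist S (z o) (z k) := hj k hk'.1 (not_le.1 hk'.2)
        have h4 : cdist S (z o) (z i) ≤ j * q := by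
          rcases Finset.mem_insert.1 (h₁ hi) with rfl | hi'
          · simp
          · exact (Finset.mem_filter.1 hi').2
        have h5 := cdist_triangle hS (z o) (z i) (z k)
        have e : (j + 1) * q = j * q + q := by ring
        omega
  have hx0 := hψ0 q
  have hx1 := hψ1 q
  -- There are at most `m` factors, each at least `ψ q ^ (1/m)` because no distance exceeds the
  -- maximal one and `ψ` is decreasing.
  have hprod : ψ q ≤ ∏ i ∈ B, ψ (cdist S (z o) (z i) / (m + 1)) ^ (1 / (m : ℝ)) := by
    calc ψ q = (ψ q ^ (1 / (m : ℝ))) ^ m := by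
          rw [← Real.rpow_natCast, ← Real.rpow_mul hx0, one_div, inv_mul_cancel₀ (by positivity),
            Real.rpow_one]
      _ ≤ (ψ q ^ (1 / (m : ℝ))) ^ B.card :=
          pow_le_pow_of_le_one (Real.rpow_nonneg hx0 _) (Real.rpow_le_one hx0 hx1 (by positivity)) hBm
      _ = ∏ i ∈ B, ψ q ^ (1 / (m : ℝ)) := by rw [Finset.prod_const]
      _ ≤ _ := Finset.prod_le_prod (fun i _ => Real.rpow_nonneg hx0 _) fun i hi =>
          Real.rpow_le_rpow hx0 (hψ (Nat.div_le_div_right (hmax i hi))) (by positivity)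
  have := cumulantSplitBound_nonneg (zero_le_one.trans hK) m
  calc _ ≤ cumulantSplitBound K m * (Q * ψ q) := hbound
    _ = cumulantSplitBound K m * Q * ψ q := by ring
    _ ≤ _ := by gcongr

/-- With `z o` fixed, each further index in `B` contributes an independent average of a summable
kernel, at most `R / w`. -/
theorem ClusteringMoments.abs_tupleAvg_jointCumulant_le [IsProbabilityMeasure Pr]
    (hS : IsCayleyGenerating S)
    (h : ClusteringMoments S Pr Y W m K Q ψ) (hK : 1 ≤ K) (hQ : 0 ≤ Q) (hψ : Antitone ψ)
    (hψ0 : ∀ s, 0 ≤ ψ s) (hψ1 : ∀ s, ψ s ≤ 1) (hW : W.Nonempty) {R : ℝ}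
    (hR : ∀ v, ∑ y ∈ W, ψ (cdist S v y / (m + 1)) ^ (1 / (m : ℝ)) ≤ R)
    {o : Fin (m + 1)} {B : Finset (Fin (m + 1))} (ho : o ∉ B) (hB : B.Nonempty) :
    |tupleAvg W fun z => jointCumulant (jointMoment Pr Y z) o B| ≤
      cumulantSplitBound K m * Q * (R / W.card) ^ B.card := by
  classical
  set c := cumulantSplitBound K m * Q
  have hc : 0 ≤ c := mul_nonneg (cumulantSplitBound_nonneg (zero_le_one.trans hK) m) hQ
  set ρ : V → V → ℝ := fun v y => ψ (cdist S v y / (m + 1)) ^ (1 / (m : ℝ)) with hρ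
  have hρ0 : ∀ v y, 0 ≤ ρ v y := fun v y => Real.rpow_nonneg (hψ0 _) _
  have hw : (0 : ℝ) < W.card := by exact_mod_cast hW.card_pos
  -- The bound is not a product over coordinates, as all its factors involve `z o`. Summing over `v`
  -- the products that carry the indicator of `z o = v` makes it a sum of products. The `w` values
  -- of `v` cancel the factor `1/w` from the indicator.
  set H : V → Fin (m + 1) → V → ℝ := fun v i y =>
    if i = o then (if y = v then 1 else 0) else if i ∈ B then ρ v y else 1 with hH
  have hHprod : ∀ v (z : Fin (m + 1) → V),
      ∏ i, H v i (z i) = if z o = v then ∏ i ∈ B, ρ v (z i) else 0 := by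
    intro v z
    rw [Fintype.prod_eq_mul_prod_compl o]
    have h1 : ∏ i ∈ {o}ᶜ, H v i (z i) = ∏ i ∈ B, ρ v (z i) := by
      rw [← Finset.prod_subset (s₁ := B)]
      · refine Finset.prod_congr rfl fun i hi => ?_
        have : i ≠ o := fun h => ho (h ▸ hi)
        simp [hH, this, hi]
      · intro i hi
        simpa using fun h : i = o => ho (h ▸ hi)
      · intro i hi hiB
        have : i ≠ o := by simpa using hi
        simp [hH, this, hiB]
    rw [h1]
    simp [hH]
  refine (abs_tupleAvg_le (G := fun z => ∑ v ∈ W, c * ∏ i, H v i (z i)) fun z hz => ?_).trans ?_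
  · refine (h.abs_jointCumulant_le hS hK hQ hψ hψ0 hψ1 hz ho hB).trans (le_of_eq ?_)
    simp only [hHprod]
    rw [← Finset.mul_sum, Finset.sum_ite_eq, if_pos (hz o)]
  · have hfac : ∀ v ∈ W, tupleAvg W (fun z : Fin (m + 1) → V => c * ∏ i, H v i (z i)) ≤
        c * ((R / W.card) ^ B.card / W.card) := by
      intro v hv
      have h1 : tupleAvg W (fun z : Fin (m + 1) → V => c * ∏ i, H v i (z i)) =
          c * tupleAvg W (fun z : Fin (m + 1) → V => ∏ i, H v i (z i)) := by
        simp only [tupleAvg, ← Finset.mul_sum, mul_div_assoc]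
      rw [h1, tupleAvg_prod, Fintype.prod_eq_mul_prod_compl o]
      have h2 : ∏ i ∈ {o}ᶜ, (∑ y ∈ W, H v i y) / (W.card : ℝ) =
          ∏ i ∈ B, (∑ y ∈ W, ρ v y) / (W.card : ℝ) := by
        rw [← Finset.prod_subset (s₁ := B)]
        · refine Finset.prod_congr rfl fun i hi => ?_
          have : i ≠ o := fun h => ho (h ▸ hi)
          simp [hH, this, hi]
        · intro i hi
          simpa using fun h : i = o => ho (h ▸ hi)
        · intro i hi hiB
          have : i ≠ o := by simpa using hi
          simp [hH, this, hiB, hw.ne']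
      have h3 : (∑ y ∈ W, H v o y) / (W.card : ℝ) = 1 / W.card := by
        simp [hH, hv]
      rw [h2, h3, Finset.prod_const, one_div, div_eq_inv_mul ((R / (W.card : ℝ)) ^ B.card)]
      have h4 : 0 ≤ ∑ y ∈ W, ρ v y := Finset.sum_nonneg fun y _ => hρ0 v y
      gcongr
      exact hR v
    rw [tupleAvg_sum]
    refine (Finset.sum_le_sum hfac).trans (le_of_eq ?_)
    rw [Finset.sum_const, nsmul_eq_mul]
    field_simp

omit [AddGroup V] in
-- Since tuples may repeat points, the power of the spatial mean is exactly the average of the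
-- products, without diagonal corrections. Unused coordinates average to one.
theorem tupleAvg_jointMoment [IsProbabilityMeasure Pr] (hW : W.Nonempty) (hY : ∀ x ∈ W, HasMoments Pr (Y x))
    (A : Finset (Fin (m + 1))) :
    tupleAvg W (fun z : Fin (m + 1) → V => jointMoment Pr Y z A) =
      ∫ ω, ((∑ x ∈ W, Y x ω) / W.card) ^ A.card ∂Pr := by
  have hw : (0 : ℝ) < W.card := by exact_mod_cast hW.card_pos
  have h1 : ∀ ω, ((∑ x ∈ W, Y x ω) / W.card) ^ A.card =
      tupleAvg W fun z : Fin (m + 1) → V => ∏ i ∈ A, Y (z i) ω := by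
    intro ω
    have h2 : (fun z : Fin (m + 1) → V => ∏ i ∈ A, Y (z i) ω) =
        fun z : Fin (m + 1) → V => ∏ i, (if i ∈ A then Y (z i) ω else 1) := by
      ext z; rw [Finset.prod_ite_mem, Finset.univ_inter]
    rw [h2, tupleAvg_prod W fun i y => if i ∈ A then Y y ω else 1, ← Finset.prod_const,
      ← Finset.prod_subset (Finset.subset_univ A)]
    · exact Finset.prod_congr rfl fun i hi => by simp [hi]
    · intro i _ hi; simp [hi, hw.ne']
  simp only [h1, tupleAvg, jointMoment]
  rw [integral_div, integral_finsetSum]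
  intro z hz
  exact (HasMoments.finset_prod fun i _ => hY _ (Fintype.mem_piFinset.1 hz i)).integrable

omit [AddGroup V] in
-- The cumulant sees only the coordinates in `insert o B` and the remaining moment only those in `A
-- \ B`, so the average of their product is the product of the averages.
theorem tupleAvg_cumulant_recursion [IsProbabilityMeasure Pr] (hW : W.Nonempty)
    (hY : ∀ x ∈ W, HasMoments Pr (Y x)) {o : Fin (m + 1)} {A : Finset (Fin (m + 1))} (ho : o ∉ A) :
    ∫ ω, ((∑ x ∈ W, Y x ω) / W.card) ^ (A.card + 1) ∂Pr =
      ∑ B ∈ A.powerset, (tupleAvg W fun z => jointCumulant (jointMoment Pr Y z) o B) *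
        ∫ ω, ((∑ x ∈ W, Y x ω) / W.card) ^ (A.card - B.card) ∂Pr := by
  rw [← Finset.card_insert_of_notMem ho, ← tupleAvg_jointMoment hW hY]
  have h1 : ∀ z : Fin (m + 1) → V, jointMoment Pr Y z (insert o A) =
      ∑ B ∈ A.powerset, jointCumulant (jointMoment Pr Y z) o B * jointMoment Pr Y z (A \ B) :=
    fun z => (sum_jointCumulant_mul (by simp [jointMoment]) o A).symm
  simp only [h1]
  rw [tupleAvg_sum]
  refine Finset.sum_congr rfl fun B hB => ?_
  rw [Finset.mem_powerset] at hB
  rw [tupleAvg_mul_of_disjoint hW (A := insert o B) (B := A \ B), tupleAvg_jointMoment hW hY,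
    Finset.card_sdiff_of_subset hB]
  · rw [Finset.disjoint_insert_left]
    exact ⟨fun h => ho (Finset.mem_sdiff.1 h).1, Finset.disjoint_sdiff⟩
  · intro z z' hzz
    exact jointCumulant_congr fun C hC => jointMoment_congr fun i hi => hzz i (hC hi)
  · intro z z' hzz
    exact jointMoment_congr hzz

/-- The normalised moments of a clustering field almost satisfy the Gaussian recursion. -/
theorem ClusteringMoments.abs_moment_recursion_le [IsProbabilityMeasure Pr]
    (hS : IsCayleyGenerating S)
    (h : ClusteringMoments S Pr Y W m K Q ψ) (hK : 1 ≤ K) (hQ : 0 ≤ Q) (hψ : Antitone ψ)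
    (hψ0 : ∀ s, 0 ≤ ψ s) (hψ1 : ∀ s, ψ s ≤ 1) (hW : W.Nonempty) {R : ℝ}
    (hR : ∀ v, ∑ y ∈ W, ψ (cdist S v y / (m + 1)) ^ (1 / (m : ℝ)) ≤ R)
    (hY : ∀ x ∈ W, HasMoments Pr (Y x)) (hY0 : ∀ x ∈ W, ∫ ω, Y x ω ∂Pr = 0)
    {μ : ℕ → ℝ} (hμ : ∀ j, μ j = ∫ ω, ((∑ x ∈ W, Y x ω) / √(W.card)) ^ j ∂Pr) :
    |μ (m + 1) - m * μ 2 * μ (m - 1)| ≤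
      2 ^ m * (cumulantSplitBound K m * Q * (1 + R) ^ m) / √(W.card) *
        ∑ j ∈ Finset.range m, |μ j| := by
  set u : ℝ := √(W.card) with hu
  have hw1 : (1 : ℝ) ≤ W.card := by exact_mod_cast hW.card_pos
  have hu1 : 1 ≤ u := Real.one_le_sqrt.2 hw1
  have hu0 : 0 < u := by linarith
  have huu : u ^ 2 = W.card := Real.sq_sqrt (by linarith)
  have hR0 : 0 ≤ R := (Finset.sum_nonneg fun y _ => Real.rpow_nonneg (hψ0 _) _).trans (hR 0)
  set c := cumulantSplitBound K m * Q with hc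
  have hc0 : 0 ≤ c := mul_nonneg (cumulantSplitBound_nonneg (zero_le_one.trans hK) m) hQ
  have hμ' : ∀ j, ∫ ω, ((∑ x ∈ W, Y x ω) / W.card) ^ j ∂Pr = μ j / u ^ j := by
    intro j
    rw [hμ, ← integral_div]
    congr 1; ext ω
    rw [← div_pow, div_div, ← pow_two, huu]
  set κ : Finset (Fin (m + 1)) → ℝ := fun B =>
    tupleAvg W fun z => jointCumulant (jointMoment Pr Y z) 0 B with hκ
  have hrec : ∀ A : Finset (Fin (m + 1)), 0 ∉ A → μ (A.card + 1) / u ^ (A.card + 1) =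
      ∑ B ∈ A.powerset, κ B * (μ (A.card - B.card) / u ^ (A.card - B.card)) := by
    intro A hA
    have := tupleAvg_cumulant_recursion hW hY hA
    simpa only [hμ'] using this
  have hμ0 : μ 0 = 1 := by simp [hμ]
  have hμ1 : μ 1 = 0 := by
    simp only [hμ, pow_one]
    rw [integral_div, integral_finsetSum _ fun x hx => (hY x hx).integrable,
      Finset.sum_eq_zero hY0, zero_div]
  -- The averaged cumulants of orders one and two are read off from the recursion itself, with `A`
  -- empty and `A` a singleton.
  have hκ0 : κ ∅ = 0 := by
    have := hrec ∅ (by simp)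
    simpa [hμ1, hμ0] using this.symm
  have hκ1 : ∀ i, i ≠ 0 → κ {i} = μ 2 / u ^ 2 := by
    intro i hi
    have := hrec {i} (by simpa using hi.symm)
    rw [← insert_empty_eq i, Finset.powerset_insert] at this
    simpa [hκ0, hμ0] using this.symm
  set A : Finset (Fin (m + 1)) := Finset.univ.erase 0 with hA
  have hAc : A.card = m := by simp [hA]
  have h0A : (0 : Fin (m + 1)) ∉ A := by simp [hA]
  have hmain := hrec A h0A
  rw [hAc] at hmain
  have hmain' : μ (m + 1) = ∑ B ∈ A.powerset, κ B * u ^ (B.card + 1) * μ (m - B.card) := by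
    rw [div_eq_iff (by positivity), Finset.sum_mul] at hmain
    rw [hmain]
    refine Finset.sum_congr rfl fun B hB => ?_
    have hBc : B.card ≤ m := (Finset.card_le_card (Finset.mem_powerset.1 hB)).trans_eq hAc
    have : u ^ (m + 1) = u ^ (B.card + 1) * u ^ (m - B.card) := by
      rw [← pow_add]; congr 1; omega
    rw [this]
    field_simp
  -- The Gaussian part: the empty set contributes nothing and each of the `m` singletons contributes
  -- `μ 2 * μ (m - 1)`.
  have hsing : ∑ B ∈ A.powerset.filter (fun B => B.card ≤ 1),
      κ B * u ^ (B.card + 1) * μ (m - B.card) = m * μ 2 * μ (m - 1) := by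
    have hset : A.powerset.filter (fun B => B.card ≤ 1) = insert ∅ (A.map ⟨singleton,
        Finset.singleton_injective⟩) := by
      ext B
      simp only [Finset.mem_filter, Finset.mem_powerset, Finset.mem_insert, Finset.mem_map,
        Function.Embedding.coeFn_mk]
      constructor
      · rintro ⟨h1, h2⟩
        rcases Finset.card_le_one_iff_subset_singleton.1 h2 with ⟨x, hx⟩
        rcases Finset.subset_singleton_iff.1 hx with rfl | rfl
        · exact Or.inl rfl
        · exact Or.inr ⟨x, by simpa using h1, rfl⟩
      · rintro (rfl | ⟨x, hx, rfl⟩)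
        · simp
        · simpa using hx
    rw [hset, Finset.sum_insert (by simp), hκ0, Finset.sum_map]
    have : ∀ i ∈ A, κ {i} * u ^ (({i} : Finset (Fin (m + 1))).card + 1) *
        μ (m - ({i} : Finset (Fin (m + 1))).card) = μ 2 * μ (m - 1) := by
      intro i hi
      rw [hκ1 i (by simpa [hA] using hi), Finset.card_singleton]
      field_simp
    simp only [Function.Embedding.coeFn_mk]
    rw [Finset.sum_congr rfl this, Finset.sum_const, hAc, nsmul_eq_mul]
    ring
  rw [hmain', ← Finset.sum_filter_add_sum_filter_not A.powerset (fun B => B.card ≤ 1), hsing,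
    add_sub_cancel_left]
  have hterm : ∀ B ∈ A.powerset.filter (fun B => ¬ B.card ≤ 1),
      |κ B * u ^ (B.card + 1) * μ (m - B.card)| ≤
        c * (1 + R) ^ m / u * ∑ j ∈ Finset.range m, |μ j| := by
    intro B hB
    obtain ⟨hB1, hB2⟩ := Finset.mem_filter.1 hB
    have hBA := Finset.mem_powerset.1 hB1
    have hBc : B.card ≤ m := (Finset.card_le_card hBA).trans_eq hAc
    have hκB : |κ B| ≤ c * (R / W.card) ^ B.card :=
      h.abs_tupleAvg_jointCumulant_le hS hK hQ hψ hψ0 hψ1 hW hR (fun h => h0A (hBA h))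
        (Finset.card_pos.1 (by omega))
    rw [abs_mul, abs_mul, abs_of_pos (by positivity : 0 < u ^ (B.card + 1))]
    -- The left side is at most `c R^|B| u^(1-|B|)`, and `|B| ≥ 2` leaves at least one factor `1/u`.
    have h1 : |κ B| * u ^ (B.card + 1) ≤ c * (1 + R) ^ m / u := by
      obtain ⟨b, hb⟩ : ∃ b, B.card = b + 2 := ⟨B.card - 2, by omega⟩
      calc |κ B| * u ^ (B.card + 1) ≤ c * (R / W.card) ^ B.card * u ^ (B.card + 1) := by gcongr
        _ = c * R ^ B.card / (u * u ^ b) := by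
          rw [← huu, hb, div_pow]
          field_simp
          ring
        _ ≤ c * (1 + R) ^ m / (u * 1) := by
          gcongr
          · calc R ^ B.card ≤ (1 + R) ^ B.card := by gcongr; linarith
              _ ≤ (1 + R) ^ m := pow_le_pow_right₀ (by linarith) hBc
          · exact one_le_pow₀ hu1
        _ = _ := by rw [mul_one]
    have h2 : |μ (m - B.card)| ≤ ∑ j ∈ Finset.range m, |μ j| :=
      Finset.single_le_sum (f := fun j => |μ j|) (fun _ _ => abs_nonneg _)
        (Finset.mem_range.2 (by omega))
    gcongr
  refine (Finset.abs_sum_le_sum_abs _ _).trans ((Finset.sum_le_sum hterm).trans ?_)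
  have hS0 : 0 ≤ ∑ j ∈ Finset.range m, |μ j| := Finset.sum_nonneg fun _ _ => abs_nonneg _
  rw [Finset.sum_const, nsmul_eq_mul]
  have hcard : ((A.powerset.filter (fun B => ¬ B.card ≤ 1)).card : ℝ) ≤ 2 ^ m := by
    have := Finset.card_filter_le A.powerset (fun B => ¬ B.card ≤ 1)
    rw [Finset.card_powerset, hAc] at this
    exact_mod_cast this
  calc _ ≤ 2 ^ m * (c * (1 + R) ^ m / u * ∑ j ∈ Finset.range m, |μ j|) := by gcongr
    _ = _ := by ring

end Recursion

/-! ### From moments to characteristic functions -/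

section MomentMethod

/-- The moments of the centred Gaussian law with variance `v`. -/
noncomputable def gaussianMoment (v : ℝ) : ℕ → ℝ
  | 0 => 1
  | 1 => 0
  | j + 2 => (j + 1) * v * gaussianMoment v j

theorem gaussianMoment_even (v : ℝ) (k : ℕ) :
    gaussianMoment v (2 * k) / (2 * k).factorial = (v / 2) ^ k / k.factorial := by
  induction k with
  | zero => simp [gaussianMoment]
  | succ k ih =>
    have h1 : 2 * (k + 1) = 2 * k + 2 := by ring
    rw [div_eq_div_iff (by positivity) (by positivity)] at ih ⊢
    rw [h1, gaussianMoment, Nat.factorial_succ, Nat.factorial_succ, Nat.factorial_succ]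
    push_cast
    have : (2 * (k : ℝ) + 1) * v * gaussianMoment v (2 * k) * ((k + 1) * k.factorial) =
      (2 * (k : ℝ) + 1) * v * (k + 1) * (gaussianMoment v (2 * k) * k.factorial) := by ring
    rw [this, ih]
    ring

theorem gaussianMoment_odd (v : ℝ) (k : ℕ) : gaussianMoment v (2 * k + 1) = 0 := by
  induction k with
  | zero => simp [gaussianMoment]
  | succ k ih =>
    have h1 : 2 * (k + 1) + 1 = 2 * k + 1 + 2 := by ring
    rw [h1, gaussianMoment, ih, mul_zero]

/-- Moments that satisfy the Gaussian recursion up to vanishing errors converge to the Gaussian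
moments. -/
theorem tendsto_gaussianMoment {μ : ℕ → ℕ → ℝ} {v : ℝ} {u : ℕ → ℝ} (hu : Tendsto u atTop atTop)
    (h0 : ∀ᶠ n in atTop, μ n 0 = 1) (h1 : ∀ᶠ n in atTop, μ n 1 = 0)
    (h2 : Tendsto (fun n => μ n 2) atTop (𝓝 v))
    (hrec : ∀ m : ℕ, 0 < m → ∃ C : ℝ, ∀ᶠ n in atTop,
      |μ n (m + 1) - m * μ n 2 * μ n (m - 1)| ≤ C / u n * ∑ j ∈ Finset.range m, |μ n j|) (j : ℕ) :
    Tendsto (fun n => μ n j) atTop (𝓝 (gaussianMoment v j)) := by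
  induction j using Nat.strong_induction_on with
  | _ j ih =>
  match j, ih with
  | 0, _ => exact tendsto_const_nhds.congr' (h0.mono fun n hn => hn.symm)
  | 1, _ => exact tendsto_const_nhds.congr' (h1.mono fun n hn => hn.symm)
  | j + 2, ih =>
    obtain ⟨C, hC⟩ := hrec (j + 1) j.succ_pos
    have e1 : Tendsto (fun n => C / u n * ∑ i ∈ Finset.range (j + 1), |μ n i|) atTop (𝓝 0) := by
      have := (hu.const_div_atTop C).mul (tendsto_finsetSum (Finset.range (j + 1))
        fun i hi => (ih i (by have := Finset.mem_range.1 hi; omega)).abs)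
      simpa using this
    have e2 : Tendsto (fun n => ((j + 1 : ℕ) : ℝ) * μ n 2 * μ n (j + 1 - 1)) atTop
        (𝓝 (((j + 1 : ℕ) : ℝ) * v * gaussianMoment v j)) := by
      have := (h2.const_mul ((j + 1 : ℕ) : ℝ)).mul (ih j (by omega))
      simpa using this
    have e3 : Tendsto (fun n => μ n (j + 1 + 1) - ((j + 1 : ℕ) : ℝ) * μ n 2 * μ n (j + 1 - 1))
        atTop (𝓝 0) := squeeze_zero_norm' (by simpa only [Real.norm_eq_abs] using hC) e1
    have e4 := e3.add e2
    simp only [sub_add_cancel, zero_add] at e4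
    rw [gaussianMoment]
    exact_mod_cast e4

/-- Induction on the order: the derivative of a Taylor remainder is the previous remainder times a
number of modulus one, so its bound integrates. The sign `c = ±1` reduces the claim to `x ≥ 0`. -/
theorem norm_cexp_sub_sum_le (M : ℕ) (x : ℝ) :
    ‖Complex.exp (x * Complex.I) - ∑ j ∈ Finset.range M, (x * Complex.I) ^ j / j.factorial‖ ≤
      |x| ^ M / M.factorial := by
  have key : ∀ (M : ℕ) (c : ℝ), |c| = 1 → ∀ x : ℝ, 0 ≤ x → ‖Complex.exp (x * (c * Complex.I)) -
      ∑ j ∈ Finset.range M, (x * (c * Complex.I)) ^ j / j.factorial‖ ≤ x ^ M / M.factorial := by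
    intro M c hc
    set a : ℂ := c * Complex.I with ha
    have hna : ‖a‖ = 1 := by simp [ha, hc]
    induction M with
    | zero =>
      intro x _
      have : (x : ℂ) * a = ((x * c : ℝ) : ℂ) * Complex.I := by rw [ha]; push_cast; ring
      rw [this]; simp [-Complex.ofReal_mul, Complex.norm_exp_ofReal_mul_I]
    | succ M ih =>
      intro x hx
      have hd : ∀ y : ℝ, HasDerivAt (fun y : ℝ => Complex.exp (y * a) -
          ∑ j ∈ Finset.range (M + 1), (y * a) ^ j / j.factorial)
          (a * (Complex.exp (y * a) - ∑ j ∈ Finset.range M, (y * a) ^ j / j.factorial)) y := by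
        intro y
        have h1 : HasDerivAt (fun y : ℝ => (y : ℂ) * a) a y := by
          simpa using (Complex.ofRealCLM.hasDerivAt (x := y)).mul_const a
        have h2 : HasDerivAt (fun y : ℝ => ∑ j ∈ Finset.range (M + 1),
            ((y : ℂ) * a) ^ j / (j.factorial : ℂ)) (∑ j ∈ Finset.range (M + 1),
              (j * ((y : ℂ) * a) ^ (j - 1) * a) / (j.factorial : ℂ)) y :=
          HasDerivAt.fun_sum fun j _ => (h1.pow j).div_const _
        convert! h1.cexp.sub h2 using 1
        rw [Finset.sum_range_succ', mul_sub, Finset.mul_sum, mul_comm a]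
        simp only [Nat.cast_zero, zero_mul, zero_div, add_zero, Nat.add_sub_cancel]
        congr 1
        refine Finset.sum_congr rfl fun j _ => ?_
        rw [Nat.factorial_succ]
        have : ((j : ℂ) + 1) ≠ 0 := by exact_mod_cast j.succ_ne_zero
        push_cast
        field_simp
      have hB : ∀ y : ℝ, HasDerivAt (fun y : ℝ => y ^ (M + 1) / ((M + 1).factorial : ℝ))
          (y ^ M / M.factorial) y := by
        intro y
        convert! (hasDerivAt_pow (M + 1) y).div_const ((M + 1).factorial : ℝ) using 1
        rw [Nat.factorial_succ, Nat.add_sub_cancel]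
        push_cast
        field_simp
      refine image_norm_le_of_norm_deriv_right_le_deriv_boundary (a := 0) (b := x)
        (fun y _ => (hd y).continuousAt.continuousWithinAt)
        (fun y _ => (hd y).hasDerivWithinAt) ?_ (fun y => hB y) ?_ ⟨hx, le_rfl⟩
      · rw [Finset.sum_range_succ']
        simp
      · intro y hy
        rw [norm_mul, hna, one_mul]
        exact ih y hy.1
  rcases le_total 0 x with hx | hx
  · simpa [abs_of_nonneg hx] using key M 1 (by simp) x hx
  · have := key M (-1) (by simp) (-x) (by linarith)
    simpa [abs_of_nonpos hx] using this

variable {Ω : Type*} [MeasurableSpace Ω] {Pr : Measure Ω} [IsProbabilityMeasure Pr]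

/-- The method of moments for a Gaussian limit. -/
theorem tendsto_integral_cexp_of_moments {T : ℕ → Ω → ℝ} {v : ℝ}
    (hT : ∀ n, HasMoments Pr (T n))
    (hmom : ∀ j, Tendsto (fun n => ∫ ω, T n ω ^ j ∂Pr) atTop (𝓝 (gaussianMoment v j))) :
    Tendsto (fun n => ∫ ω, Complex.exp (T n ω * Complex.I) ∂Pr) atTop
      (𝓝 (Complex.exp (-v / 2))) := by
  have hpart : ∀ N : ℕ, ∑ j ∈ Finset.range (2 * N),
      Complex.I ^ j * (gaussianMoment v j : ℂ) / j.factorial =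
        ∑ k ∈ Finset.range N, (-v / 2 : ℂ) ^ k / k.factorial := by
    intro N
    induction N with
    | zero => simp
    | succ N ih =>
      rw [show 2 * (N + 1) = 2 * N + 1 + 1 by ring, Finset.sum_range_succ, Finset.sum_range_succ,
        ih, Finset.sum_range_succ, gaussianMoment_odd]
      have h1 : (gaussianMoment v (2 * N) : ℂ) / (2 * N).factorial =
          (v / 2 : ℂ) ^ N / N.factorial := by exact_mod_cast gaussianMoment_even v N
      rw [mul_div_assoc, h1, pow_mul, Complex.I_sq, ← mul_div_assoc, ← mul_pow]
      simp [neg_div]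
  have hexp : Tendsto (fun N : ℕ => ∑ k ∈ Finset.range N, (-v / 2 : ℂ) ^ k / k.factorial) atTop
      (𝓝 (Complex.exp (-v / 2))) := by
    rw [Complex.exp_eq_exp_ℂ]
    exact (NormedSpace.expSeries_div_hasSum_exp (-v / 2 : ℂ)).tendsto_sum_nat
  have htail : Tendsto (fun N : ℕ => gaussianMoment v (2 * N) / (2 * N).factorial) atTop (𝓝 0) := by
    simp only [gaussianMoment_even]
    exact FloorSemiring.tendsto_pow_div_factorial_atTop (v / 2)
  rw [Metric.tendsto_atTop]
  intro ε hε
  -- The order `2 * N` is even, so that the Taylor remainder is controlled by a genuine moment. It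
  -- is fixed, before `n` grows, so that both the tail of the exponential series and the limiting
  -- remainder are below `ε/3`.
  obtain ⟨N, hN1, hN2⟩ := ((Metric.tendsto_nhds.1 hexp (ε / 3) (by positivity)).and
    (htail.eventually (gt_mem_nhds (show (0 : ℝ) < ε / 3 by positivity)))).exists
  have hterm : Tendsto (fun n => (∫ ω, T n ω ^ (2 * N) ∂Pr) / (2 * N).factorial) atTop
      (𝓝 (gaussianMoment v (2 * N) / (2 * N).factorial)) := (hmom _).div_const _
  have hsum : Tendsto (fun n => ∑ j ∈ Finset.range (2 * N),
      Complex.I ^ j * ((∫ ω, T n ω ^ j ∂Pr : ℝ) : ℂ) / j.factorial) atTop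
      (𝓝 (∑ j ∈ Finset.range (2 * N), Complex.I ^ j * (gaussianMoment v j : ℂ) / j.factorial)) :=
    tendsto_finsetSum _ fun j _ =>
      (((Complex.continuous_ofReal.tendsto _).comp (hmom j)).const_mul _).div_const _
  obtain ⟨n₁, hn₁⟩ := eventually_atTop.1 (hterm.eventually (gt_mem_nhds hN2))
  obtain ⟨n₂, hn₂⟩ := Metric.tendsto_atTop.1 hsum (ε / 3) (by positivity)
  refine ⟨max n₁ n₂, fun n hn => ?_⟩
  have a1 := hn₁ n ((le_max_left _ _).trans hn)
  have a2 := hn₂ n ((le_max_right _ _).trans hn)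
  rw [hpart] at a2
  have hint : ∀ j, Integrable (fun ω => ((T n ω : ℂ) * Complex.I) ^ j / (j.factorial : ℂ)) Pr := by
    intro j
    have h1 : Integrable (fun ω => ((T n ω ^ j : ℝ) : ℂ)) Pr := ((hT n).pow j).integrable.ofReal
    refine ((h1.mul_const (Complex.I ^ j)).div_const (j.factorial : ℂ)).congr
      (ae_of_all _ fun ω => ?_)
    simp only [mul_pow]; push_cast; rfl
  have hint0 : Integrable (fun ω => Complex.exp ((T n ω : ℂ) * Complex.I)) Pr := by
    refine Integrable.of_bound (Measurable.aestronglyMeasurable ?_) 1 (ae_of_all _ fun ω => ?_)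
    · have := (hT n).measurable
      fun_prop
    · rw [Complex.norm_exp_ofReal_mul_I]
  have hsumeq : ∑ j ∈ Finset.range (2 * N), Complex.I ^ j * ((∫ ω, T n ω ^ j ∂Pr : ℝ) : ℂ) /
      j.factorial = ∫ ω, ∑ j ∈ Finset.range (2 * N), ((T n ω : ℂ) * Complex.I) ^ j /
        (j.factorial : ℂ) ∂Pr := by
    rw [integral_finsetSum _ fun j _ => hint j]
    refine Finset.sum_congr rfl fun j _ => ?_
    rw [← integral_complex_ofReal, integral_div, mul_comm, ← integral_mul_const]
    push_cast
    simp only [mul_pow]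
  have a3 : dist (∫ ω, Complex.exp (T n ω * Complex.I) ∂Pr) (∑ j ∈ Finset.range (2 * N),
      Complex.I ^ j * ((∫ ω, T n ω ^ j ∂Pr : ℝ) : ℂ) / j.factorial) < ε / 3 := by
    rw [hsumeq, dist_eq_norm, ← integral_sub hint0 (integrable_finsetSum _ fun j _ => hint j)]
    refine lt_of_le_of_lt (norm_integral_le_integral_norm _) (lt_of_le_of_lt ?_ a1)
    rw [← integral_div]
    refine integral_mono_of_nonneg (ae_of_all _ fun ω => norm_nonneg _)
      (((hT n).pow _).integrable.div_const _) (ae_of_all _ fun ω => ?_)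
    refine (norm_cexp_sub_sum_le _ _).trans (le_of_eq ?_)
    simp only [pow_mul, sq_abs]
  calc _ ≤ _ := dist_triangle4 _ _ _ _
    _ < ε / 3 + ε / 3 + ε / 3 := add_lt_add (add_lt_add a3 a2) hN1
    _ = ε := by ring

end MomentMethod

/-! ### Clustering of functions of finitely many spins -/

section Cylinder

variable {V : Type*}

/-- `f(μ)` is a function of `μ ∩ A`. -/
def DependsOnly {β : Type*} (f : Set V → β) (A : Finset V) : Prop :=
  ∀ μ μ' : Set V, μ ∩ A = μ' ∩ A → f μ = f μ'

theorem DependsOnly.mono {β : Type*} {f : Set V → β} {A B : Finset V} (hf : DependsOnly f A)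
    (h : A ⊆ B) : DependsOnly f B := by
  intro μ μ' hμ
  refine hf μ μ' ?_
  have h' : (A : Set V) ⊆ B := by exact_mod_cast h
  rw [← Set.inter_eq_self_of_subset_right h', ← Set.inter_assoc, ← Set.inter_assoc, hμ]

open Classical in
/-- Expansion of a cylinder function in the monomials `1[T ⊆ μ]`. -/
theorem DependsOnly.exists_coeff {f : Set V → ℝ} {A : Finset V} {F : ℝ} (hf : DependsOnly f A)
    (hF : ∀ μ, |f μ| ≤ F) : ∃ a : Finset V → ℝ, (∀ T, |a T| ≤ 2 ^ A.card * F) ∧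
      ∀ μ, f μ = ∑ T ∈ A.powerset, a T * if (T : Set V) ⊆ μ then 1 else 0 := by
  have hF0 : 0 ≤ F := (abs_nonneg _).trans (hF ∅)
  induction A using Finset.induction_on generalizing f F with
  | empty =>
    refine ⟨fun _ => f ∅, fun _ => by simpa using hF ∅, fun μ => ?_⟩
    simpa using hf μ ∅ (by simp)
  | insert x A hx ih =>
    -- Condition on the spin at `x`: `f μ = f (μ \ {x}) + 1[x ∈ μ] (f (insert x μ) - f (μ \ {x}))`.
    -- The difference is bounded by `2F`, hence the factor `2` per point of `A`.
    have h0 : DependsOnly (fun μ => f (μ \ {x})) A := by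
      intro μ μ' h
      refine hf _ _ ?_
      ext y
      have := Set.ext_iff.1 h y
      simp only [Set.mem_inter_iff, Set.mem_sdiff, Set.mem_singleton_iff, Finset.coe_insert,
        Set.mem_insert_iff] at this ⊢
      tauto
    have h1 : DependsOnly (fun μ => f (insert x μ) - f (μ \ {x})) A := by
      intro μ μ' h
      have e := h0 μ μ' h
      simp only at e
      simp only [e]
      congr 1
      refine hf _ _ ?_
      ext y
      have := Set.ext_iff.1 h y
      simp only [Set.mem_inter_iff, Finset.coe_insert, Set.mem_insert_iff] at this ⊢
      tauto
    obtain ⟨a, ha, ha'⟩ := ih h0 (fun μ => hF _) hF0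
    obtain ⟨b, hb, hb'⟩ := ih (F := 2 * F) h1 (fun μ => (abs_sub _ _).trans (by
      linarith [hF (insert x μ), hF (μ \ {x})])) (by positivity)
    refine ⟨fun T => if x ∈ T then b (T.erase x) else a T, fun T => ?_, fun μ => ?_⟩
    · rw [Finset.card_insert_of_notMem hx, pow_succ]
      dsimp only
      split_ifs
      · exact (hb _).trans_eq (by ring)
      · refine (ha _).trans ?_
        have : 0 ≤ 2 ^ A.card * F := by positivity
        linarith
    · rw [Finset.sum_powerset_insert hx]
      have e1 : ∀ T ∈ A.powerset, ((if x ∈ T then b (T.erase x) else a T) *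
          if (T : Set V) ⊆ μ then 1 else 0) = a T * if (T : Set V) ⊆ μ then 1 else 0 := by
        intro T hT
        rw [if_neg fun h => hx (Finset.mem_powerset.1 hT h)]
      have e2 : ∀ T ∈ A.powerset, ((if x ∈ insert x T then b ((insert x T).erase x) else
          a (insert x T)) * if ((insert x T : Finset V) : Set V) ⊆ μ then 1 else 0) =
            (if x ∈ μ then 1 else 0) * (b T * if (T : Set V) ⊆ μ then 1 else 0) := by
        intro T hT
        have hxT : x ∉ T := fun h => hx (Finset.mem_powerset.1 hT h)
        rw [if_pos (Finset.mem_insert_self x T), Finset.erase_insert hxT, Finset.coe_insert,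
          Set.insert_subset_iff]
        by_cases h : x ∈ μ <;> simp [h]
      rw [Finset.sum_congr rfl e1, Finset.sum_congr rfl e2, ← Finset.mul_sum, ← ha' μ, ← hb' μ]
      by_cases h : x ∈ μ
      · simp [h, Set.insert_eq_of_mem h]
      · simp [h, Set.sdiff_singleton_eq_self h]

theorem measurable_setOf_subset {Ω : Type*} [MeasurableSpace Ω] {P : Ω → Set V}
    (hP : Measurable P) (T : Finset V) : MeasurableSet {ω | (T : Set V) ⊆ P ω} := by
  have : {ω | (T : Set V) ⊆ P ω} = ⋂ x ∈ T, {ω | x ∈ P ω} := by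
    ext ω; simp [Set.subset_def]
  rw [this]
  exact Finset.measurableSet_biInter _ fun x _ => measurableSet_setOfPred.2 (measurable_set_iff.1 hP x)

/-- The function factors through the random finite set `A ∩ P`, which takes finitely many values,
each on a measurable event. -/
theorem DependsOnly.measurable {Ω : Type*} [MeasurableSpace Ω] {P : Ω → Set V}
    (hP : Measurable P) {β : Type*} [MeasurableSpace β] {f : Set V → β} {A : Finset V}
    (hf : DependsOnly f A) : Measurable fun ω => f (P ω) := by
  classical
  have h1 : (fun ω => f (P ω)) = (fun T : Finset V => f T) ∘
      fun ω => A.filter fun x => x ∈ P ω := by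
    ext ω
    refine hf _ _ ?_
    ext x; simp; tauto
  have h2 : Set.range (fun ω => A.filter fun x => x ∈ P ω) ⊆ A.powerset := by
    rintro _ ⟨ω, rfl⟩
    exact Finset.mem_coe.2 (Finset.mem_powerset.2 (Finset.filter_subset _ _))
  intro s _
  have h3 : (fun ω => f (P ω)) ⁻¹' s = ⋃ T ∈ A.powerset.filter fun T : Finset V => f T ∈ s,
      {ω | (A.filter fun x => x ∈ P ω) = T} := by
    ext ω
    rw [h1]
    simp
  rw [h3]
  refine Finset.measurableSet_biUnion _ fun T _ => ?_
  have h4 : {ω | (A.filter fun x => x ∈ P ω) = T} = ⋂ x, {ω | x ∈ A ∧ x ∈ P ω ↔ x ∈ T} := by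
    ext ω; simp [Finset.ext_iff]
  have h5 : {ω | (A.filter fun x => x ∈ P ω) = T} = ⋂ x ∈ A ∪ T, {ω | x ∈ A ∧ x ∈ P ω ↔ x ∈ T} := by
    rw [h4]
    ext ω
    simp only [Set.mem_iInter, Set.mem_ofPred_eq, Finset.mem_union]
    refine ⟨fun h x _ => h x, fun h x => ?_⟩
    by_cases hx : x ∈ A ∨ x ∈ T
    · exact h x hx
    · tauto
  rw [h5]
  refine Finset.measurableSet_biInter _ fun x _ => ?_
  have h6 := measurable_set_iff.1 hP x
  by_cases h7 : x ∈ A <;> by_cases h8 : x ∈ T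
  · simpa [h7, h8] using measurableSet_setOfPred.2 h6
  · simpa [h7, h8] using h6.not
  · simp [h7, h8]
  · simp [h7, h8]

end Cylinder

/-! ### Correlations of cylinder functions at a distance. -/

section LocalClustering

variable {V Ω : Type*} [AddGroup V] [MeasurableSpace Ω] {S : Finset V} {Pr : Measure Ω}
  [IsProbabilityMeasure Pr] {P : Ω → Set V}

/-- The decay condition with `m = 1` forces the limit zero, and a non-increasing function lies above
its limit. -/
theorem FastDecreasing.nonneg {φ : ℝ → ℝ} (h : FastDecreasing φ) {s : ℝ} (hs : 0 ≤ s) : 0 ≤ φ s := by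
  have h1 : Tendsto (fun t : ℝ => t⁻¹ * (t ^ 1 * φ t)) atTop (𝓝 (0 * 0)) :=
    tendsto_inv_atTop_zero.mul (h.tendsto 1 le_rfl)
  have h2 : Tendsto φ atTop (𝓝 0) := by
    rw [mul_zero] at h1
    refine h1.congr' ?_
    filter_upwards [eventually_gt_atTop 0] with t ht
    rw [pow_one, inv_mul_cancel_left₀ ht.ne']
  refine le_of_tendsto h2 ?_
  filter_upwards [eventually_ge_atTop s] with t ht
  exact h.antitone hs (hs.trans ht) ht

/-- Functions of the spins in two distant finite sets are almost uncorrelated. -/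
theorem ClustersWith.abs_cov_le {C c : ℕ → ℝ} {φ : ℝ → ℝ} (h : ClustersWith S Pr P C c φ)
    {A B : Finset V} (hAB : Disjoint A B) {f g : Set V → ℝ} {F G : ℝ} (hf : DependsOnly f A)
    (hg : DependsOnly g B) (hF : ∀ μ, |f μ| ≤ F) (hG : ∀ μ, |g μ| ≤ G) {N : ℕ}
    (hN : A.card + B.card ≤ N) {c₀ : ℝ} (hc₀ : 0 < c₀) (hc : ∀ k ≤ N, c₀ ≤ c k)
    {s : ℕ} (hs : ∀ x ∈ A, ∀ y ∈ B, s ≤ cdist S x y) :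
    |∫ ω, f (P ω) * g (P ω) ∂Pr - (∫ ω, f (P ω) ∂Pr) * ∫ ω, g (P ω) ∂Pr| ≤
      4 ^ N * F * G * (∑ k ∈ Finset.range (N + 1), |C k|) * φ (c₀ * s) := by
  classical
  have hF0 : 0 ≤ F := (abs_nonneg _).trans (hF ∅)
  have hG0 : 0 ≤ G := (abs_nonneg _).trans (hG ∅)
  obtain ⟨a, ha, ha'⟩ := hf.exists_coeff hF
  obtain ⟨b, hb, hb'⟩ := hg.exists_coeff hG
  have hPm := h.isSpinModel.measurable
  have hφ0 : 0 ≤ φ (c₀ * s) := h.fastDecreasing.nonneg (by positivity)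
  set D : ℝ := (∑ k ∈ Finset.range (N + 1), |C k|) * φ (c₀ * s) with hD
  have hD0 : 0 ≤ D := mul_nonneg (Finset.sum_nonneg fun _ _ => abs_nonneg _) hφ0
  set p : Finset V → ℝ := fun T => Pr.real {ω | (T : Set V) ⊆ P ω} with hp
  have hone : ∀ T : Finset V, (fun ω => if (T : Set V) ⊆ P ω then (1 : ℝ) else 0) =
      Set.indicator {ω | (T : Set V) ⊆ P ω} 1 := fun T => by
    ext ω; simp [Set.indicator_apply]
  have hint : ∀ T : Finset V, Integrable (fun ω => if (T : Set V) ⊆ P ω then (1 : ℝ) else 0) Pr := by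
    intro T
    rw [hone]
    exact (integrable_const 1).indicator (measurable_setOf_subset hPm T)
  have hval : ∀ T : Finset V, ∫ ω, (if (T : Set V) ⊆ P ω then (1 : ℝ) else 0) ∂Pr = p T := by
    intro T
    rw [hone, integral_indicator_one (measurable_setOf_subset hPm T)]
  have hIf : ∫ ω, f (P ω) ∂Pr = ∑ T ∈ A.powerset, a T * p T := by
    simp only [ha']
    rw [integral_finsetSum _ fun T _ => (hint T).const_mul _]
    simp only [integral_const_mul, hval]
  have hIg : ∫ ω, g (P ω) ∂Pr = ∑ T ∈ B.powerset, b T * p T := by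
    simp only [hb']
    rw [integral_finsetSum _ fun T _ => (hint T).const_mul _]
    simp only [integral_const_mul, hval]
  have hIfg : ∫ ω, f (P ω) * g (P ω) ∂Pr =
      ∑ T ∈ A.powerset, ∑ U ∈ B.powerset, a T * b U * p (T ∪ U) := by
    have e : ∀ ω, f (P ω) * g (P ω) = ∑ T ∈ A.powerset, ∑ U ∈ B.powerset,
        a T * b U * if ((T ∪ U : Finset V) : Set V) ⊆ P ω then (1 : ℝ) else 0 := by
      intro ω
      rw [ha', hb', Finset.sum_mul_sum]
      refine Finset.sum_congr rfl fun T _ => Finset.sum_congr rfl fun U _ => ?_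
      rw [Finset.coe_union, Set.union_subset_iff]
      by_cases h1 : (T : Set V) ⊆ P ω <;> by_cases h2 : (U : Set V) ⊆ P ω <;> simp [h1, h2]
    simp only [e]
    rw [integral_finsetSum _ fun T _ => integrable_finsetSum _ fun U _ => (hint _).const_mul _]
    refine Finset.sum_congr rfl fun T _ => ?_
    rw [integral_finsetSum _ fun U _ => (hint _).const_mul _]
    simp only [integral_const_mul, hval]
  have hpair : ∀ T ∈ A.powerset, ∀ U ∈ B.powerset, |p (T ∪ U) - p T * p U| ≤ D := by
    intro T hT U hU
    rw [Finset.mem_powerset] at hT hU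
    -- The clustering bound covers non-empty sets only. If one set is empty the correlation
    -- vanishes, as the empty monomial is the constant one.
    rcases T.eq_empty_or_nonempty with rfl | hTn
    · simpa [hp] using hD0
    rcases U.eq_empty_or_nonempty with rfl | hUn
    · simpa [hp] using hD0
    have h1 := h.bound T U hTn hUn (Finset.disjoint_of_subset_left hT
      (Finset.disjoint_of_subset_right hU hAB))
    set k := T.card + U.card
    have hk : k ≤ N := (add_le_add (Finset.card_le_card hT) (Finset.card_le_card hU)).trans hN
    have hdist : s ≤ finsetDist S T U := by
      have hne : (Set.image2 (SimpleGraph.addCayley (S : Set V)).dist (T : Set V) U).Nonempty :=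
        Set.Nonempty.image2 hTn hUn
      obtain ⟨x, hx, y, hy, hxy⟩ := Nat.sInf_mem hne
      rw [finsetDist, ← hxy]
      exact hs x (hT hx) y (hU hy)
    simp only [hp, Finset.coe_union]
    refine h1.trans ?_
    have hφ1 : φ (c k * finsetDist S T U) ≤ φ (c₀ * s) := by
      refine h.fastDecreasing.antitone (Set.mem_Ici.2 (by positivity))
        (Set.mem_Ici.2 (mul_nonneg (h.c_pos k).le (by positivity))) ?_
      exact mul_le_mul (hc k hk) (by exact_mod_cast hdist) (by positivity) (h.c_pos k).le
    have hφ2 : 0 ≤ φ (c k * finsetDist S T U) :=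
      h.fastDecreasing.nonneg (mul_nonneg (h.c_pos k).le (by positivity))
    refine mul_le_mul ((le_abs_self _).trans ?_) hφ1 hφ2
      (Finset.sum_nonneg fun _ _ => abs_nonneg _)
    exact Finset.single_le_sum (f := fun k => |C k|) (fun _ _ => abs_nonneg _)
      (Finset.mem_range.2 (by omega))
  rw [hIf, hIg, hIfg, Finset.sum_mul_sum, ← Finset.sum_sub_distrib]
  calc _ ≤ ∑ T ∈ A.powerset, ∑ U ∈ B.powerset, 2 ^ A.card * F * (2 ^ B.card * G) * D := by
        refine (Finset.abs_sum_le_sum_abs _ _).trans (Finset.sum_le_sum fun T hT => ?_)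
        rw [← Finset.sum_sub_distrib]
        refine (Finset.abs_sum_le_sum_abs _ _).trans (Finset.sum_le_sum fun U hU => ?_)
        have e : a T * b U * p (T ∪ U) - a T * p T * (b U * p U) =
            a T * b U * (p (T ∪ U) - p T * p U) := by ring
        rw [e, abs_mul, abs_mul]
        exact mul_le_mul (mul_le_mul (ha T) (hb U) (abs_nonneg _) (by positivity)) (hpair T hT U hU)
          (abs_nonneg _) (by positivity)
    -- One power of `2 ^ (|A| + |B|)` comes from the size of the coefficients and another from the
    -- number of pairs of subsets.
    _ = 4 ^ (A.card + B.card) * F * G * D := by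
        simp only [Finset.sum_const, Finset.card_powerset, nsmul_eq_mul]
        rw [show (4 : ℝ) = 2 * 2 by norm_num, mul_pow, pow_add]
        push_cast
        ring
    _ ≤ 4 ^ N * F * G * D := by
        gcongr
        norm_num
    _ = _ := by rw [hD]; ring

/-- Products of functions of the spins near two distant groups of points are almost
uncorrelated. -/
theorem ClustersWith.abs_cov_prod_le (hS : IsCayleyGenerating S) {C c : ℕ → ℝ} {φ : ℝ → ℝ}
    (h : ClustersWith S Pr P C c φ) {ι : Type*} [DecidableEq ι] {z : ι → V}
    {f : ι → Set V → ℝ} {r : ℕ} {L : ℝ} (hL : 1 ≤ L) (hf : ∀ i, DependsOnly (f i) (cball S (z i) r))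
    (hfL : ∀ i μ, |f i μ| ≤ L) {A B : Finset ι} (hAB : Disjoint A B) {m : ℕ}
    (hm : A.card + B.card ≤ m) {N : ℕ} (hN : m * (windowFinset S r).card ≤ N) {c₀ : ℝ}
    (hc₀ : 0 < c₀) (hc : ∀ k ≤ N, c₀ ≤ c k)
    {s : ℕ} (hs : ∀ i ∈ A, ∀ j ∈ B, s ≤ cdist S (z i) (z j)) (hrs : 2 * r < s) :
    |∫ ω, ∏ i ∈ A ∪ B, f i (P ω) ∂Pr - (∫ ω, ∏ i ∈ A, f i (P ω) ∂Pr) *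
        ∫ ω, ∏ i ∈ B, f i (P ω) ∂Pr| ≤
      4 ^ N * L ^ m * (∑ k ∈ Finset.range (N + 1), |C k|) * φ (c₀ * (s - 2 * r : ℕ)) := by
  classical
  have hdep : ∀ D : Finset ι, DependsOnly (fun μ => ∏ i ∈ D, f i μ)
      (D.biUnion fun i => cball S (z i) r) := by
    intro D μ μ' hμ
    refine Finset.prod_congr rfl fun i hi => ?_
    exact (hf i).mono (Finset.subset_biUnion_of_mem (fun i => cball S (z i) r) hi) μ μ' hμ
  have hbd : ∀ (D : Finset ι) μ, |∏ i ∈ D, f i μ| ≤ L ^ D.card := by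
    intro D μ
    rw [Finset.abs_prod]
    rw [← Finset.prod_const]
    exact Finset.prod_le_prod (fun i _ => abs_nonneg _) fun i _ => hfL i μ
  have hcard : ∀ D : Finset ι, (D.biUnion fun i => cball S (z i) r).card ≤
      D.card * (windowFinset S r).card := by
    intro D
    refine Finset.card_biUnion_le.trans ?_
    simp [card_cball]
  have hdist : ∀ x ∈ A.biUnion fun i => cball S (z i) r, ∀ y ∈ B.biUnion fun i => cball S (z i) r,
      s - 2 * r ≤ cdist S x y := by
    intro x hx y hy
    obtain ⟨i, hi, hxi⟩ := Finset.mem_biUnion.1 hx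
    obtain ⟨j, hj, hyj⟩ := Finset.mem_biUnion.1 hy
    rw [mem_cball hS] at hxi hyj
    have h1 := hs i hi j hj
    have h2 := cdist_triangle hS (z i) x (z j)
    have h3 := cdist_triangle hS x y (z j)
    rw [cdist_comm y] at h3
    omega
  -- This is where `2 * r < s` is needed: the two unions of `r`-balls must be disjoint for the
  -- clustering bound to apply.
  have hdisj : Disjoint (A.biUnion fun i => cball S (z i) r)
      (B.biUnion fun i => cball S (z i) r) := by
    rw [Finset.disjoint_left]
    intro x hx hy
    have h1 := hdist x hx x hy
    simp only [cdist, SimpleGraph.dist_self] at h1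
    omega
  have hcards : (A.biUnion fun i => cball S (z i) r).card +
      (B.biUnion fun i => cball S (z i) r).card ≤ N := by
    refine (add_le_add (hcard A) (hcard B)).trans (le_trans ?_ hN)
    rw [← add_mul]
    exact Nat.mul_le_mul_right _ hm
  have key := h.abs_cov_le hdisj (hdep A) (hdep B) (hbd A) (hbd B) hcards hc₀ hc hdist
  simp only [Finset.prod_union hAB]
  refine key.trans ?_
  have hφ0 : 0 ≤ φ (c₀ * (s - 2 * r : ℕ)) := h.fastDecreasing.nonneg (by positivity)
  have hS0 : 0 ≤ ∑ k ∈ Finset.range (N + 1), |C k| := Finset.sum_nonneg fun _ _ => abs_nonneg _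
  have hLm : L ^ A.card * L ^ B.card ≤ L ^ m := by
    rw [← pow_add]; exact pow_le_pow_right₀ hL hm
  calc _ = 4 ^ N * (L ^ A.card * L ^ B.card) * (∑ k ∈ Finset.range (N + 1), |C k|) *
        φ (c₀ * (s - 2 * r : ℕ)) := by ring
    _ ≤ _ := by gcongr

end LocalClustering

/-! ### Score functions and their truncations -/

section Score

variable {V : Type*} [AddGroup V] {S : Finset V} {ξ ξ' : V → Set V → ℝ}

theorem IsScoreFunction.eq_zero_vadd (h : IsScoreFunction ξ) (x : V) (μ : Set V) :
    ξ x μ = ξ 0 (-x +ᵥ μ) := by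
  simpa using (h.translation (-x) x μ).symm

theorem IsScoreFunction.add (h : IsScoreFunction ξ) (h' : IsScoreFunction ξ') :
    IsScoreFunction (ξ + ξ') where
  measurable x := (h.measurable x).add (h'.measurable x)
  translation y x μ := by simp [h.translation, h'.translation]
  eq_zero x μ hx := by simp [h.eq_zero x μ hx, h'.eq_zero x μ hx]

theorem IsScoreFunction.smul (h : IsScoreFunction ξ) (c : ℝ) : IsScoreFunction (c • ξ) where
  measurable x := (h.measurable x).const_smul c
  translation y x μ := by simp [h.translation]
  eq_zero x μ hx := by simp [h.eq_zero x μ hx]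

theorem vadd_inter_window_congr (hS : IsCayleyGenerating S) {x : V} {μ μ' : Set V} {r r' : ℕ}
    (hr : r' ≤ r) (h : μ' ∩ cball S x r = μ ∩ cball S x r) :
    (-x +ᵥ μ') ∩ window S r' = (-x +ᵥ μ) ∩ window S r' := by
  ext y
  have h1 := Set.ext_iff.1 h (x + y)
  simp only [Set.mem_inter_iff, Finset.mem_coe, mem_cball hS, mem_window_natCast hS,
    Set.mem_vadd_set_iff_neg_vadd_mem, neg_neg, vadd_eq_add] at h1 ⊢
  have h2 : cdist S x (x + y) = cdist S 0 y := by rw [cdist_eq_neg_add hS]; simp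
  rw [h2] at h1
  constructor
  · rintro ⟨h3, h4⟩
    exact ⟨(h1.1 ⟨h3, h4.trans hr⟩).1, h4⟩
  · rintro ⟨h3, h4⟩
    exact ⟨(h1.2 ⟨h3, h4.trans hr⟩).1, h4⟩

/-- The condition that defines the radius is monotone in `r`, so the infimum is at most `r` exactly
when `r` itself is admissible. -/
theorem stabRadius_le_iff (hS : IsCayleyGenerating S) {x : V} {μ : Set V} {r : ℕ} :
    stabRadius S ξ x μ ≤ r ↔ 0 < r ∧ ∀ μ' : Set V,
      μ' ∩ window S r = (-x +ᵥ μ) ∩ window S r → ξ 0 (-x +ᵥ μ) = ξ 0 μ' := by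
  constructor
  · intro h
    by_contra hcon
    have h1 : ((r + 1 : ℕ) : ℕ∞) ≤ stabRadius S ξ x μ := by
      refine le_iInf₂ fun r' hr' => ?_
      rw [Nat.cast_le]
      by_contra hlt
      have hle : r' ≤ r := by omega
      refine hcon ⟨hr'.1.trans_le hle, fun μ' hμ' => hr'.2 μ' ?_⟩
      have hsub : window S r' ⊆ window S r := fun y hy => by
        rw [mem_window_natCast hS] at hy ⊢; omega
      rw [← Set.inter_eq_self_of_subset_right hsub, ← Set.inter_assoc, ← Set.inter_assoc, hμ']
    have h2 := h1.trans h
    rw [Nat.cast_le] at h2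
    omega
  · intro h
    exact iInf₂_le r h

theorem eq_of_stabRadius_le (hS : IsCayleyGenerating S) (hξ : IsScoreFunction ξ) {x : V}
    {μ μ' : Set V} {r : ℕ} (hr : stabRadius S ξ x μ ≤ r)
    (h : μ' ∩ cball S x r = μ ∩ cball S x r) : ξ x μ' = ξ x μ := by
  rw [hξ.eq_zero_vadd x μ', hξ.eq_zero_vadd x μ]
  exact (((stabRadius_le_iff hS).1 hr).2 _ (vadd_inter_window_congr hS le_rfl h)).symm

/-- The stopping-set property: whether the radius is at most `r` can be decided from the
configuration in the `r`-ball. Hence cutting off at this event keeps a score local. -/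
theorem stabRadius_le_congr (hS : IsCayleyGenerating S) {x : V}
    {μ μ' : Set V} {r : ℕ} (hr : stabRadius S ξ x μ ≤ r)
    (h : μ' ∩ cball S x r = μ ∩ cball S x r) : stabRadius S ξ x μ' ≤ r := by
  rw [stabRadius_le_iff hS] at hr ⊢
  have h1 := vadd_inter_window_congr hS le_rfl h
  refine ⟨hr.1, fun μ'' h2 => ?_⟩
  rw [← hr.2 μ'' (h2.trans h1), hr.2 _ h1]

theorem stabRadius_add_le (hS : IsCayleyGenerating S) {x : V} {μ : Set V} {r : ℕ}
    (h : stabRadius S ξ x μ ≤ r) (h' : stabRadius S ξ' x μ ≤ r) :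
    stabRadius S (ξ + ξ') x μ ≤ r := by
  rw [stabRadius_le_iff hS] at h h' ⊢
  exact ⟨h.1, fun μ' hμ => by simp [← h.2 μ' hμ, ← h'.2 μ' hμ]⟩

theorem stabRadius_smul_le (hS : IsCayleyGenerating S) {x : V} {μ : Set V} {r : ℕ}
    (h : stabRadius S ξ x μ ≤ r) (c : ℝ) : stabRadius S (c • ξ) x μ ≤ r := by
  rw [stabRadius_le_iff hS] at h ⊢
  exact ⟨h.1, fun μ' hμ => by simp [← h.2 μ' hμ]⟩

open Classical in
/-- The score function cut off where its radius of stabilisation exceeds `r`. -/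
noncomputable def truncScore (S : Finset V) (ξ : V → Set V → ℝ) (r : ℕ) (x : V) (μ : Set V) : ℝ :=
  if stabRadius S ξ x μ ≤ r then ξ x μ else 0

theorem inter_inter_congr {α : Type*} {μ μ' A W : Set α} (h : μ ∩ A = μ' ∩ A) :
    (μ ∩ W) ∩ A = (μ' ∩ W) ∩ A := by
  rw [Set.inter_right_comm, h, Set.inter_right_comm]

theorem dependsOnly_stabRadius_le (hS : IsCayleyGenerating S) (r : ℕ) (x : V) (W : Set V) :
    DependsOnly (fun μ => stabRadius S ξ x (μ ∩ W) ≤ r) (cball S x r) := by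
  intro μ μ' h
  have h1 := inter_inter_congr (W := W) h
  exact propext ⟨fun h2 => stabRadius_le_congr hS h2 h1.symm,
    fun h2 => stabRadius_le_congr hS h2 h1⟩

theorem dependsOnly_truncScore (hS : IsCayleyGenerating S) (hξ : IsScoreFunction ξ) (r : ℕ) (x : V)
    (W : Set V) : DependsOnly (fun μ => truncScore S ξ r x (μ ∩ W)) (cball S x r) := by
  intro μ μ' h
  have h0 := dependsOnly_stabRadius_le (ξ := ξ) hS r x W μ μ' h
  have h1 := inter_inter_congr (W := W) h
  simp only [eq_iff_iff] at h0
  simp only [truncScore]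
  by_cases h2 : stabRadius S ξ x (μ ∩ W) ≤ r
  · rw [if_pos h2, if_pos (h0.1 h2)]
    exact (eq_of_stabRadius_le hS hξ h2 h1.symm).symm
  · rw [if_neg h2, if_neg (fun h3 => h2 (h0.2 h3))]

theorem abs_truncScore_le_abs (r : ℕ) (x : V) (μ : Set V) : |truncScore S ξ r x μ| ≤ |ξ x μ| := by
  rw [truncScore]; split_ifs <;> simp

/-- Where the radius is at most `r` the score does not change when the configuration is cut to
`W_r`, so a bound on configurations inside `W_r` bounds the truncated score everywhere. The growth
condition enters here. -/
theorem abs_truncScore_le (hS : IsCayleyGenerating S) (hξ : IsScoreFunction ξ) {r : ℕ} {E : ℝ}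
    (hE : ∀ μ : Set V, |ξ 0 (μ ∩ window S r)| ≤ E) (x : V) (μ : Set V) :
    |truncScore S ξ r x μ| ≤ E := by
  rw [truncScore]
  split_ifs with h
  · have h1 := ((stabRadius_le_iff hS).1 h).2 ((-x +ᵥ μ) ∩ window S r)
      (by rw [Set.inter_assoc, Set.inter_self])
    rw [hξ.eq_zero_vadd, h1]
    exact hE _
  · simpa using (abs_nonneg _).trans (hE ∅)

theorem measurable_score_window {Ω : Type*} [MeasurableSpace Ω] {P : Ω → Set V}
    (hP : Measurable P) (hξ : IsScoreFunction ξ) (x : V) (W : Set V) :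
    Measurable fun ω => ξ x (P ω ∩ W) := by
  refine (hξ.measurable x).comp (measurable_set_iff.2 fun y => ?_)
  have h := measurable_set_iff.1 hP y
  by_cases hy : y ∈ W
  · simpa [hy] using h
  · simp [hy]

/-- A bounded score function of bounded range. -/
structure BoundedLocal (S : Finset V) (ξ : V → Set V → ℝ) : Prop where
  score : IsScoreFunction ξ
  range : ∃ r : ℕ, ∀ x μ, stabRadius S ξ x μ ≤ r
  bound : ∃ L : ℝ, ∀ x μ, |ξ x μ| ≤ L

theorem IsLocal.boundedLocal (hS : IsCayleyGenerating S) (hξ : IsScoreFunction ξ)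
    (h : IsLocal S ξ) : BoundedLocal S ξ where
  score := hξ
  range := by
    obtain ⟨r, hr, ξ₀, h0⟩ := h
    refine ⟨r, fun x μ => (stabRadius_le_iff hS).2 ⟨hr, fun μ' hμ => ?_⟩⟩
    rw [h0, h0]
    congr 1
    ext ⟨y, hy⟩
    have := Set.ext_iff.1 hμ y
    simp only [Set.mem_inter_iff, hy, and_true] at this
    exact this.symm
  bound := by
    obtain ⟨r, hr, ξ₀, h0⟩ := h
    have : Finite (window S r) := window_finite S r
    obtain ⟨L, hL⟩ := (Set.finite_range fun s => |ξ₀ s|).bddAbove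
    refine ⟨L, fun x μ => ?_⟩
    rw [hξ.eq_zero_vadd, h0]
    exact hL ⟨_, rfl⟩

theorem BoundedLocal.add (hS : IsCayleyGenerating S) (h : BoundedLocal S ξ)
    (h' : BoundedLocal S ξ') : BoundedLocal S (ξ + ξ') where
  score := h.score.add h'.score
  range := by
    obtain ⟨r, hr⟩ := h.range
    obtain ⟨r', hr'⟩ := h'.range
    exact ⟨max r r', fun x μ => stabRadius_add_le hS
      ((hr x μ).trans (Nat.cast_le.2 (le_max_left _ _)))
      ((hr' x μ).trans (Nat.cast_le.2 (le_max_right _ _)))⟩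
  bound := by
    obtain ⟨L, hL⟩ := h.bound
    obtain ⟨L', hL'⟩ := h'.bound
    exact ⟨L + L', fun x μ => (abs_add_le _ _).trans (add_le_add (hL x μ) (hL' x μ))⟩

theorem BoundedLocal.smul (hS : IsCayleyGenerating S) (h : BoundedLocal S ξ) (c : ℝ) :
    BoundedLocal S (c • ξ) where
  score := h.score.smul c
  range := by
    obtain ⟨r, hr⟩ := h.range
    exact ⟨r, fun x μ => stabRadius_smul_le hS (hr x μ) c⟩
  bound := by
    obtain ⟨L, hL⟩ := h.bound
    refine ⟨|c| * L, fun x μ => ?_⟩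
    simp only [Pi.smul_apply, smul_eq_mul, abs_mul]
    exact mul_le_mul_of_nonneg_left (hL x μ) (abs_nonneg c)

variable {Ω : Type*} [MeasurableSpace Ω] {Pr : Measure Ω} {P : Ω → Set V}

/-- A score function with rapidly decreasing tails of the radius of stabilisation, at most
exponential growth and bounded moments. -/
structure QuasiLocal (S : Finset V) (Pr : Measure Ω) (P : Ω → Set V) (ξ : V → Set V → ℝ) :
    Prop where
  score : IsScoreFunction ξ
  tail : ∀ M : ℕ, ∃ C : ℝ, ∀ n : ℕ∞, 1 ≤ n → ∀ x ∈ window S n, ∀ r : ℕ,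
    Pr.real {ω | ¬ stabRadius S ξ x (P ω ∩ window S n) ≤ r} ≤ C / ((r : ℝ) + 1) ^ M
  growth : ∃ D c : ℝ, ∃ κ : ℕ, 0 ≤ D ∧ 0 ≤ c ∧ ∀ t : ℕ, 0 < t → ∀ μ : Set V,
    |ξ 0 (μ ∩ window S t)| ≤ D * Real.exp (c * (t : ℝ) ^ κ)
  moments : ∀ p : ℕ, ∃ K : ℝ, ∀ n : ℕ∞, 1 ≤ n → ∀ x ∈ window S n,
    Integrable (fun ω => |ξ x (P ω ∩ window S n)| ^ p) Pr ∧
      ∫ ω, |ξ x (P ω ∩ window S n)| ^ p ∂Pr ≤ K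

theorem QuasiLocal.hasMoments (hP : Measurable P) (h : QuasiLocal S Pr P ξ) {n : ℕ∞} (hn : 1 ≤ n)
    {x : V} (hx : x ∈ window S n) : HasMoments Pr fun ω => ξ x (P ω ∩ window S n) where
  measurable := measurable_score_window hP h.score x _
  integrable_pow p := by
    obtain ⟨K, hK⟩ := h.moments p
    exact (hK n hn x hx).1

theorem QuasiLocal.add [IsProbabilityMeasure Pr] (hS : IsCayleyGenerating S) (hP : Measurable P)
    (h : QuasiLocal S Pr P ξ) (h' : QuasiLocal S Pr P ξ') : QuasiLocal S Pr P (ξ + ξ') where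
  score := h.score.add h'.score
  tail M := by
    obtain ⟨C, hC⟩ := h.tail M
    obtain ⟨C', hC'⟩ := h'.tail M
    refine ⟨C + C', fun n hn x hx r => ?_⟩
    rw [add_div]
    refine le_trans (le_trans (measureReal_mono ?_) (measureReal_union_le _ _))
      (add_le_add (hC n hn x hx r) (hC' n hn x hx r))
    intro ω hω
    by_contra hcon
    simp only [Set.mem_union, Set.mem_ofPred_eq, not_or, not_not] at hcon
    exact hω (stabRadius_add_le hS hcon.1 hcon.2)
  growth := by
    obtain ⟨D, c, κ, hD, hc, hg⟩ := h.growth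
    obtain ⟨D', c', κ', hD', hc', hg'⟩ := h'.growth
    refine ⟨D + D', c + c', κ + κ', by positivity, by positivity, fun t ht μ => ?_⟩
    have ht1 : (1 : ℝ) ≤ t := by exact_mod_cast ht
    refine (abs_add_le _ _).trans ((add_le_add (hg t ht μ) (hg' t ht μ)).trans ?_)
    rw [add_mul]
    have e1 : (t : ℝ) ^ κ ≤ (t : ℝ) ^ (κ + κ') := pow_le_pow_right₀ ht1 (by omega)
    have e2 : (t : ℝ) ^ κ' ≤ (t : ℝ) ^ (κ + κ') := pow_le_pow_right₀ ht1 (by omega)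
    gcongr
    · linarith
    · linarith
  moments p := by
    obtain ⟨K, hK⟩ := h.moments p
    obtain ⟨K', hK'⟩ := h'.moments p
    refine ⟨2 ^ p * (K + K'), fun n hn x hx => ?_⟩
    have hm := (h.hasMoments hP hn hx).add (h'.hasMoments hP hn hx)
    refine ⟨hm.integrable_pow p, ?_⟩
    have h1 := (hK n hn x hx)
    have h2 := (hK' n hn x hx)
    calc _ ≤ ∫ ω, 2 ^ p * (|ξ x (P ω ∩ window S n)| ^ p + |ξ' x (P ω ∩ window S n)| ^ p) ∂Pr := by
          refine integral_mono (hm.integrable_pow p) ((h1.1.add h2.1).const_mul _) fun ω => ?_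
          exact abs_add_pow_le _ _ p
      _ = 2 ^ p * ((∫ ω, |ξ x (P ω ∩ window S n)| ^ p ∂Pr) +
            ∫ ω, |ξ' x (P ω ∩ window S n)| ^ p ∂Pr) := by
          rw [integral_const_mul, integral_add h1.1 h2.1]
      _ ≤ _ := by gcongr; exacts [h1.2, h2.2]

theorem QuasiLocal.smul [IsProbabilityMeasure Pr] (hS : IsCayleyGenerating S)
    (h : QuasiLocal S Pr P ξ) (a : ℝ) : QuasiLocal S Pr P (a • ξ) where
  score := h.score.smul a
  tail M := by
    obtain ⟨C, hC⟩ := h.tail M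
    refine ⟨C, fun n hn x hx r => (measureReal_mono ?_).trans (hC n hn x hx r)⟩
    exact fun ω hω hcon => hω (stabRadius_smul_le hS hcon a)
  growth := by
    obtain ⟨D, c, κ, hD, hc, hg⟩ := h.growth
    refine ⟨|a| * D, c, κ, by positivity, hc, fun t ht μ => ?_⟩
    simp only [Pi.smul_apply, smul_eq_mul, abs_mul]
    rw [mul_assoc]
    exact mul_le_mul_of_nonneg_left (hg t ht μ) (abs_nonneg a)
  moments p := by
    obtain ⟨K, hK⟩ := h.moments p
    refine ⟨|a| ^ p * K, fun n hn x hx => ?_⟩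
    simp only [Pi.smul_apply, smul_eq_mul, abs_mul, mul_pow]
    refine ⟨(hK n hn x hx).1.const_mul _, ?_⟩
    rw [integral_const_mul]
    exact mul_le_mul_of_nonneg_left (hK n hn x hx).2 (by positivity)

/-- Lets the local case share everything but the proof of clustering, for which polynomial growth is
not available there. -/
theorem BoundedLocal.quasiLocal [IsProbabilityMeasure Pr] (hP : Measurable P)
    (h : BoundedLocal S ξ) : QuasiLocal S Pr P ξ where
  score := h.score
  tail M := by
    obtain ⟨r₀, hr₀⟩ := h.range
    refine ⟨((r₀ : ℝ) + 1) ^ M, fun n hn x hx r => ?_⟩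
    rcases le_or_gt r₀ r with hr | hr
    · have : {ω | ¬ stabRadius S ξ x (P ω ∩ window S n) ≤ r} = ∅ := by
        ext ω
        simpa using (hr₀ x (P ω ∩ window S n)).trans (Nat.cast_le.2 hr)
      rw [this]
      simp only [measureReal_empty]
      positivity
    · refine measureReal_le_one.trans ?_
      rw [one_le_div (by positivity)]
      gcongr
  growth := by
    obtain ⟨L, hL⟩ := h.bound
    refine ⟨L, 0, 0, (abs_nonneg _).trans (hL 0 ∅), le_rfl, fun t _ μ => ?_⟩
    simpa using hL 0 _
  moments p := by
    obtain ⟨L, hL⟩ := h.bound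
    refine ⟨L ^ p, fun n hn x hx => ?_⟩
    have hm : HasMoments Pr fun ω => ξ x (P ω ∩ window S n) :=
      HasMoments.of_bounded (measurable_score_window hP h.score x _) fun ω => hL _ _
    refine ⟨hm.integrable_pow p, ?_⟩
    calc _ ≤ ∫ _, L ^ p ∂Pr := by
          refine integral_mono (hm.integrable_pow p) (integrable_const _) fun ω => ?_
          exact pow_le_pow_left₀ (abs_nonneg _) (hL _ _) p
      _ = L ^ p := by simp

end Score

/-! ### Consequences of stretched exponential decay. -/

section StretchedExp

theorem StretchedExpDecay.exists_le {φ : ℝ → ℝ} {b : ℝ} (h : StretchedExpDecay φ b) :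
    ∃ δ : ℝ, 0 < δ ∧ ∀ᶠ t in atTop, φ t ≤ Real.exp (-(δ * t ^ b)) := by
  obtain ⟨e, he1, he2⟩ := EReal.lt_iff_exists_real_btwn.1 h
  have he : e < 0 := by exact_mod_cast he2
  refine ⟨-e, by linarith, ?_⟩
  filter_upwards [eventually_lt_of_limsup_lt he1, eventually_gt_atTop 0] with t ht ht0
  have hpos : (0 : ℝ) < t ^ b := Real.rpow_pos_of_pos ht0 b
  rw [EReal.div_lt_iff (by exact_mod_cast hpos) (EReal.coe_ne_top _)] at ht
  have h1 : ENNReal.log (ENNReal.ofReal (φ t)) < ENNReal.log (ENNReal.ofReal (Real.exp (e * t ^ b))) := by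
    rw [ENNReal.log_ofReal_of_pos (Real.exp_pos _), Real.log_exp]
    exact_mod_cast ht
  have h2 := ENNReal.log_strictMono.lt_iff_lt.1 h1
  rw [ENNReal.ofReal_lt_ofReal_iff (Real.exp_pos _)] at h2
  rw [show -(-e * t ^ b) = e * t ^ b by ring]
  exact h2.le

/-- For large arguments a stretched exponential lies below any inverse power. The finitely many
remaining integers are absorbed in the constant. -/
theorem StretchedExpDecay.exists_le_inv_pow {φ : ℝ → ℝ} {b : ℝ} (hb : 0 < b)
    (h : StretchedExpDecay φ b) (M : ℕ) : ∃ C : ℝ, 0 ≤ C ∧ ∀ r : ℕ,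
      φ ((r : ℝ) + 1) ≤ C / ((r : ℝ) + 1) ^ M := by
  obtain ⟨δ, hδ, hφ⟩ := h.exists_le
  have h1 : Tendsto (fun t : ℝ => t ^ M * Real.exp (-(δ * t ^ b))) atTop (𝓝 0) := by
    refine ((tendsto_rpow_mul_exp_neg_mul_atTop_nhds_zero (M / b) δ hδ).comp
      (tendsto_rpow_atTop hb)).congr' ?_
    filter_upwards [eventually_gt_atTop 0] with t ht
    simp only [Function.comp]
    rw [← Real.rpow_mul ht.le, mul_div_cancel₀ _ hb.ne', Real.rpow_natCast, neg_mul]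
  have h2 : ∀ᶠ t : ℝ in atTop, φ t ≤ 1 / t ^ M := by
    filter_upwards [hφ, h1.eventually (gt_mem_nhds one_pos), eventually_gt_atTop 0] with t a1 a2 a3
    rw [le_div_iff₀ (by positivity), mul_comm]
    exact (mul_le_mul_of_nonneg_left a1 (by positivity)).trans a2.le
  obtain ⟨N, hN⟩ := eventually_atTop.1 ((tendsto_natCast_atTop_atTop (R := ℝ)).eventually h2)
  have hsum : 0 ≤ ∑ r ∈ Finset.range N, |φ ((r : ℝ) + 1)| * ((r : ℝ) + 1) ^ M :=
    Finset.sum_nonneg fun r _ => by positivity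
  refine ⟨1 + ∑ r ∈ Finset.range N, |φ ((r : ℝ) + 1)| * ((r : ℝ) + 1) ^ M, by positivity,
    fun r => ?_⟩
  rcases lt_or_ge r N with hr | hr
  · rw [le_div_iff₀ (by positivity)]
    have h3 : |φ ((r : ℝ) + 1)| * ((r : ℝ) + 1) ^ M ≤
        ∑ r ∈ Finset.range N, |φ ((r : ℝ) + 1)| * ((r : ℝ) + 1) ^ M :=
      Finset.single_le_sum (f := fun r : ℕ => |φ ((r : ℝ) + 1)| * ((r : ℝ) + 1) ^ M)
        (fun r _ => by positivity) (Finset.mem_range.2 hr)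
    have h4 : φ ((r : ℝ) + 1) * ((r : ℝ) + 1) ^ M ≤ |φ ((r : ℝ) + 1)| * ((r : ℝ) + 1) ^ M := by
      gcongr; exact le_abs_self _
    linarith
  · have h3 := hN (r + 1) (by omega)
    push_cast at h3
    refine h3.trans ?_
    gcongr
    linarith

end StretchedExp

/-! ### Exponential hypotheses imply quasi-locality. -/

section QuasiLocalOfExp

variable {V : Type*} [AddGroup V] {S : Finset V} {ξ : V → Set V → ℝ}
variable {Ω : Type*} [MeasurableSpace Ω] {Pr : Measure Ω} {P : Ω → Set V}

/-- The maximum with `1` makes a higher moment dominate a lower one. The shift to `p + 1` lets the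
condition for exponents at least one cover `p = 0` as well. -/
theorem MomentCondition.integrable_pow (hP : Measurable P) (hξ : IsScoreFunction ξ) {p : ℕ}
    (h : MomentCondition S Pr P ξ ((p + 1 : ℕ) : ℝ)) : ∃ K : ℝ, ∀ n : ℕ∞, 1 ≤ n →
      ∀ x ∈ window S n, Integrable (fun ω => |ξ x (P ω ∩ window S n)| ^ p) Pr ∧
        ∫ ω, |ξ x (P ω ∩ window S n)| ^ p ∂Pr ≤ K := by
  unfold MomentCondition at h
  set B := ⨆ (n : ℕ∞) (_ : 1 ≤ n) (x : V) (_ : x ∈ window S n),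
    ∫⁻ ω, ENNReal.ofReal (max |ξ x (P ω ∩ window S n)| 1 ^ ((p + 1 : ℕ) : ℝ)) ∂Pr with hB
  refine ⟨B.toReal, fun n hn x hx => ?_⟩
  have hm := measurable_score_window hP hξ x (window S n)
  have h1 : ∫⁻ ω, ENNReal.ofReal (|ξ x (P ω ∩ window S n)| ^ p) ∂Pr ≤ B := by
    calc _ ≤ ∫⁻ ω, ENNReal.ofReal (max |ξ x (P ω ∩ window S n)| 1 ^ ((p + 1 : ℕ) : ℝ)) ∂Pr := by
          refine lintegral_mono fun ω => ENNReal.ofReal_le_ofReal ?_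
          rw [Real.rpow_natCast]
          calc _ ≤ max |ξ x (P ω ∩ window S n)| 1 ^ p :=
                pow_le_pow_left₀ (abs_nonneg _) (le_max_left _ _) p
            _ ≤ _ := pow_le_pow_right₀ (le_max_right _ _) (Nat.le_succ p)
      _ ≤ B := by
          rw [hB]
          exact le_iSup₂_of_le n hn (le_iSup₂_of_le x hx le_rfl)
  have hmeas : AEStronglyMeasurable (fun ω => |ξ x (P ω ∩ window S n)| ^ p) Pr :=
    (hm.abs.pow_const p).aestronglyMeasurable
  have hnn : 0 ≤ᵐ[Pr] fun ω => |ξ x (P ω ∩ window S n)| ^ p := ae_of_all _ fun ω => by positivity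
  refine ⟨⟨hmeas, (hasFiniteIntegral_iff_ofReal hnn).2 (h1.trans_lt h)⟩, ?_⟩
  rw [integral_eq_lintegral_of_nonneg_ae hnn hmeas]
  exact ENNReal.toReal_mono h.ne h1

theorem quasiLocal_of_exp [IsProbabilityMeasure Pr] (hP : Measurable P)
    (hξ : IsScoreFunction ξ) (h1 : ExpQuasiLocal S Pr P ξ) (h2 : ExpGrowth S ξ)
    (h3 : ∀ p : ℝ, 1 ≤ p → MomentCondition S Pr P ξ p) : QuasiLocal S Pr P ξ where
  score := hξ
  tail M := by
    obtain ⟨A, φ, hst, c, hc, hφ⟩ := h1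
    obtain ⟨C, hC0, hC⟩ := hφ.exists_le_inv_pow hc M
    refine ⟨A * C, fun n hn x hx r => ?_⟩
    have hA := hst.const_pos
    -- The radius is integer-valued, so exceeding `r` means being at least `r + 1`.
    have hb := hst.bound n hn x hx ((r : ℝ) + 1) (by positivity)
    have hsub : {ω | ¬ stabRadius S ξ x (P ω ∩ window S n) ≤ r} ⊆
        {ω | ENNReal.ofReal ((r : ℝ) + 1) ≤ (stabRadius S ξ x (P ω ∩ window S n) : ℝ≥0∞)} := by
      intro ω hω
      have hω' : ((r + 1 : ℕ) : ℕ∞) ≤ stabRadius S ξ x (P ω ∩ window S n) := by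
        rw [Nat.cast_add, Nat.cast_one]
        exact Order.add_one_le_of_lt (not_le.1 hω)
      have e : ENNReal.ofReal ((r : ℝ) + 1) = (((r + 1 : ℕ) : ℕ∞) : ℝ≥0∞) := by
        rw [show ((r : ℝ) + 1) = ((r + 1 : ℕ) : ℝ) by push_cast; ring, ENNReal.ofReal_natCast]
        rfl
      simp only [Set.mem_ofPred_eq]
      rw [e]
      exact ENat.toENNReal_mono hω'
    have hle : Pr {ω | ¬ stabRadius S ξ x (P ω ∩ window S n) ≤ r} ≤
        ENNReal.ofReal (A * C / ((r : ℝ) + 1) ^ M) := by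
      refine (measure_mono hsub).trans (hb.trans (ENNReal.ofReal_le_ofReal ?_))
      rw [mul_div_assoc]
      exact mul_le_mul_of_nonneg_left (hC r) hA.le
    exact ENNReal.toReal_le_of_le_ofReal (by positivity) hle
  growth := by
    obtain ⟨κ, hκ, c, hc⟩ := h2
    refine ⟨1, |c|, ⌈κ⌉₊, zero_le_one, abs_nonneg c, fun t ht μ => ?_⟩
    rw [one_mul]
    refine (hc t ht μ).trans (Real.exp_le_exp.2 ?_)
    have ht1 : (1 : ℝ) ≤ t := by exact_mod_cast ht
    have e : (t : ℝ) ^ κ ≤ (t : ℝ) ^ ⌈κ⌉₊ := by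
      rw [← Real.rpow_natCast]
      exact Real.rpow_le_rpow_of_exponent_le ht1 (Nat.le_ceil κ)
    exact mul_le_mul (le_abs_self c) e (by positivity) (abs_nonneg c)
  moments p := (h3 _ (by push_cast; linarith [p.cast_nonneg (α := ℝ)])).integrable_pow hP hξ

end QuasiLocalOfExp

/-! ### Clustering of the centred scores -/

section FieldClusters

variable {V : Type*} [AddGroup V] {S : Finset V}
variable {Ω : Type*} [MeasurableSpace Ω] {Pr : Measure Ω} {P : Ω → Set V}

/-- The centred score at `x` of the configuration in `W_n`. -/
noncomputable def scoreField (S : Finset V) (Pr : Measure Ω) (P : Ω → Set V) (ξ : V → Set V → ℝ)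
    (n : ℕ∞) (x : V) (ω : Ω) : ℝ :=
  ξ x (P ω ∩ window S n) - ∫ ω', ξ x (P ω' ∩ window S n) ∂Pr

/-- The mixed moments of the centred scores in the family `Ξ` cluster at a rapidly decreasing rate,
uniformly in the window. -/
def FieldClusters (S : Finset V) (Pr : Measure Ω) (P : Ω → Set V) {J : Type*}
    (Ξ : J → V → Set V → ℝ) : Prop :=
  ∀ m : ℕ, 0 < m → ∃ (Q : ℝ) (ψ : ℕ → ℝ), 0 ≤ Q ∧ Antitone ψ ∧ (∀ s, 0 ≤ ψ s) ∧ (∀ s, ψ s ≤ 1) ∧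
    (Summable fun x : V => ψ (cdist S 0 x / (m + 1)) ^ (1 / (m : ℝ))) ∧
    ∀ n : ℕ∞, 1 ≤ n → ∀ z : Fin (m + 1) → V, (∀ i, z i ∈ window S n) → ∀ τ : Fin (m + 1) → J,
      ∀ A B : Finset (Fin (m + 1)), Disjoint A B →
      ∀ s : ℕ, (∀ i ∈ A, ∀ j ∈ B, s ≤ cdist S (z i) (z j)) →
        |∫ ω, ∏ i ∈ A ∪ B, scoreField S Pr P (Ξ (τ i)) n (z i) ω ∂Pr -
          (∫ ω, ∏ i ∈ A, scoreField S Pr P (Ξ (τ i)) n (z i) ω ∂Pr) *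
            ∫ ω, ∏ i ∈ B, scoreField S Pr P (Ξ (τ i)) n (z i) ω ∂Pr| ≤ Q * ψ s

/-- The rate is `1` at short range and `φ` with its argument shifted by `r` beyond. The shift and
the integer division by `m + 1` cost only a smaller constant in front of `|x|`, and only finitely
many points are at short range. -/
theorem SummableInGraph.summable_shift (hS : IsCayleyGenerating S) {φ : ℝ → ℝ}
    (hφ : FastDecreasing φ) (h : SummableInGraph S φ) {c₀ : ℝ} (hc₀ : 0 < c₀) (r : ℕ) {m : ℕ}
    (hm : 0 < m) : Summable fun x : V => (if cdist S 0 x / (m + 1) ≤ r then 1 else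
      φ (c₀ * (cdist S 0 x / (m + 1) - r : ℕ))) ^ (1 / (m : ℝ)) := by
  -- With `q = |x| / (m+1) > r` one has `|x| ≤ 2(m+1) q` and `q ≤ (r+1)(q - r)`, so `c' |x| ≤ c₀ (q
  -- - r)`.
  set c' : ℝ := c₀ / ((r + 1) * (2 * (m + 1))) with hc'
  have hc'0 : 0 < c' := by positivity
  have h1 := h c' hc'0 m (by exact_mod_cast hm)
  have hfin : {x : V | cdist S 0 x / (m + 1) ≤ r}.Finite := by
    refine (window_finite S ((r + 1) * (m + 1))).subset fun x hx => ?_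
    rw [mem_window_natCast hS]
    exact ((Nat.div_lt_iff_lt_mul m.succ_pos).1 (Nat.lt_succ_of_le hx)).le
  have h2 : Summable fun x : V => Set.indicator {x : V | cdist S 0 x / (m + 1) ≤ r}
      (fun _ => (1 : ℝ)) x :=
    summable_of_hasFiniteSupport (hfin.subset fun x hx => by
      by_contra hcon; exact hx (Set.indicator_of_notMem hcon _))
  refine Summable.of_nonneg_of_le (fun x => ?_) (fun x => ?_) (h2.add h1)
  · refine Real.rpow_nonneg ?_ _
    split_ifs
    · exact zero_le_one
    · exact hφ.nonneg (by positivity)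
  · have h3 : 0 ≤ φ (c' * cdist S 0 x) := hφ.nonneg (by positivity)
    by_cases hx : cdist S 0 x / (m + 1) ≤ r
    · rw [if_pos hx, Real.one_rpow, Set.indicator_of_mem (by exact hx)]
      linarith [Real.rpow_nonneg h3 (1 / (m : ℝ))]
    · rw [if_neg hx, Set.indicator_of_notMem (by exact hx), zero_add]
      refine Real.rpow_le_rpow (hφ.nonneg (by positivity)) ?_ (by positivity)
      refine hφ.antitone (Set.mem_Ici.2 (by positivity)) (Set.mem_Ici.2 (by positivity)) ?_
      set l := cdist S 0 x
      set q := l / (m + 1)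
      have hq : r + 1 ≤ q := by omega
      have hl : l < (q + 1) * (m + 1) :=
        (Nat.div_lt_iff_lt_mul m.succ_pos).1 (Nat.lt_succ_self _)
      have hl2 : l ≤ q * (2 * (m + 1)) := by nlinarith
      have hq2 : q ≤ (q - r) * (r + 1) := by
        obtain ⟨e, he⟩ : ∃ e, q = r + 1 + e := ⟨q - (r + 1), by omega⟩
        rw [he, show r + 1 + e - r = e + 1 by omega]
        nlinarith
      have hl3 : l ≤ (q - r) * ((r + 1) * (2 * (m + 1))) := by
        calc l ≤ q * (2 * (m + 1)) := hl2
          _ ≤ (q - r) * (r + 1) * (2 * (m + 1)) := Nat.mul_le_mul_right _ hq2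
          _ = _ := by ring
      have hl4 : (l : ℝ) ≤ ((q - r : ℕ) : ℝ) * ((r + 1) * (2 * (m + 1))) := by exact_mod_cast hl3
      rw [hc', div_mul_eq_mul_div, div_le_iff₀ (by positivity)]
      calc c₀ * l ≤ c₀ * (((q - r : ℕ) : ℝ) * ((r + 1) * (2 * (m + 1)))) := by gcongr
        _ = _ := by ring

theorem abs_integral_le_of_abs_le [IsProbabilityMeasure Pr] {f : Ω → ℝ} {b : ℝ}
    (h : ∀ ω, |f ω| ≤ b) : |∫ ω, f ω ∂Pr| ≤ b := by
  have := norm_integral_le_of_norm_le_const (μ := Pr) (f := f) (C := b) (ae_of_all Pr h)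
  simpa using this

/-- The centred scores are bounded functions of the spins in `r`-balls. Beyond separation `2r` the
clustering of the spins applies; at shorter separation the trivial bound suffices, with rate `1`. -/
theorem fieldClusters_of_boundedLocal [IsProbabilityMeasure Pr] (hS : IsCayleyGenerating S)
    (hP : SummablyClustering S Pr P) {J : Type*} [Fintype J] {Ξ : J → V → Set V → ℝ}
    (h : ∀ j, BoundedLocal S (Ξ j)) : FieldClusters S Pr P Ξ := by
  intro m hm
  obtain ⟨C, c, φ, hcl, hsum⟩ := hP
  have hφ := hcl.fastDecreasing
  choose ρ hρ using fun j => (h j).range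
  choose L hL using fun j => (h j).bound
  set r := Finset.univ.sup ρ
  have hr : ∀ j x μ, stabRadius S (Ξ j) x μ ≤ r := fun j x μ =>
    (hρ j x μ).trans (Nat.cast_le.2 (Finset.le_sup (Finset.mem_univ j)))
  have hL0 : ∀ j, 0 ≤ L j := fun j => (abs_nonneg _).trans (hL j 0 ∅)
  set L₀ : ℝ := 1 + 2 * ∑ j, L j
  have hLj : ∀ j, 2 * L j ≤ L₀ := fun j => by
    have := Finset.single_le_sum (f := L) (fun j _ => hL0 j) (Finset.mem_univ j)
    simp only [L₀]; linarith
  have hL1 : 1 ≤ L₀ := by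
    have := Finset.sum_nonneg (f := L) (s := Finset.univ) fun j _ => hL0 j
    simp only [L₀]; linarith
  set N := (m + 1) * (windowFinset S r).card
  -- With `m` and `r` fixed, at most `N` spins are involved, so the minimum of finitely many `c k`
  -- replaces a uniform lower bound.
  obtain ⟨k₀, -, hk₀⟩ := (Finset.range (N + 1)).exists_min_image c ⟨0, by simp⟩
  have hc₀ := hcl.c_pos k₀
  set T := ∑ k ∈ Finset.range (N + 1), |C k|
  have hT : 0 ≤ T := Finset.sum_nonneg fun _ _ => abs_nonneg _
  refine ⟨4 ^ N * L₀ ^ (m + 1) * T + 2 * L₀ ^ (m + 1),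
    fun s => if s ≤ 2 * r then 1 else φ (c k₀ * (s - 2 * r : ℕ)), by positivity, ?_, ?_, ?_,
    hsum.summable_shift hS hφ hc₀ (2 * r) hm, ?_⟩
  · intro s s' hss
    dsimp only
    split_ifs with h1 h2
    · exact le_rfl
    · omega
    · exact hφ.le_one _ (by positivity)
    · refine hφ.antitone (Set.mem_Ici.2 (by positivity)) (Set.mem_Ici.2 (by positivity)) ?_
      gcongr
  · intro s
    dsimp only
    split_ifs
    · exact zero_le_one
    · exact hφ.nonneg (by positivity)
  · intro s
    dsimp only
    split_ifs
    · exact le_rfl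
    · exact hφ.le_one _ (by positivity)
  · intro n hn z hz τ A B hAB s hs
    set f : Fin (m + 1) → Set V → ℝ := fun i μ =>
      Ξ (τ i) (z i) (μ ∩ window S n) - ∫ ω', Ξ (τ i) (z i) (P ω' ∩ window S n) ∂Pr with hf
    have hfL : ∀ i μ, |f i μ| ≤ L₀ := by
      intro i μ
      have h1 := hL (τ i) (z i) (μ ∩ window S n)
      have h2 : |∫ ω', Ξ (τ i) (z i) (P ω' ∩ window S n) ∂Pr| ≤ L (τ i) :=
        abs_integral_le_of_abs_le fun ω => hL _ _ _
      refine (abs_sub _ _).trans ?_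
      linarith [hLj (τ i)]
    have hdep : ∀ i, DependsOnly (f i) (cball S (z i) r) := by
      intro i μ μ' hμ
      simp only [hf]
      rw [eq_of_stabRadius_le hS (h (τ i)).score (hr (τ i) (z i) (μ' ∩ window S n))
        (inter_inter_congr hμ)]
    have hcardAB : A.card + B.card ≤ m + 1 := by
      rw [← Finset.card_union_of_disjoint hAB]
      exact (Finset.card_le_univ _).trans (by simp)
    change |∫ ω, ∏ i ∈ A ∪ B, f i (P ω) ∂Pr - (∫ ω, ∏ i ∈ A, f i (P ω) ∂Pr) *
      ∫ ω, ∏ i ∈ B, f i (P ω) ∂Pr| ≤ _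
    have hprod : ∀ D : Finset (Fin (m + 1)), |∫ ω, ∏ i ∈ D, f i (P ω) ∂Pr| ≤ L₀ ^ D.card := by
      intro D
      refine abs_integral_le_of_abs_le fun ω => ?_
      rw [Finset.abs_prod, ← Finset.prod_const]
      exact Finset.prod_le_prod (fun i _ => abs_nonneg _) fun i _ => hfL i _
    dsimp only
    split_ifs with h1
    · have e1 : |∫ ω, ∏ i ∈ A ∪ B, f i (P ω) ∂Pr| ≤ L₀ ^ (m + 1) :=
        (hprod _).trans (pow_le_pow_right₀ hL1 (by rwa [Finset.card_union_of_disjoint hAB]))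
      have e2 : |(∫ ω, ∏ i ∈ A, f i (P ω) ∂Pr) * ∫ ω, ∏ i ∈ B, f i (P ω) ∂Pr| ≤ L₀ ^ (m + 1) := by
        rw [abs_mul]
        refine (mul_le_mul (hprod A) (hprod B) (abs_nonneg _) (by positivity)).trans ?_
        rw [← pow_add]
        exact pow_le_pow_right₀ hL1 hcardAB
      have e3 : 0 ≤ 4 ^ N * L₀ ^ (m + 1) * T := by positivity
      refine (abs_sub _ _).trans ?_
      linarith
    · have := hcl.abs_cov_prod_le hS hL1 hdep hfL hAB hcardAB (le_refl N) hc₀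
        (fun k hk => hk₀ k (Finset.mem_range.2 (by omega))) hs (not_le.1 h1)
      refine this.trans ?_
      have hφ0 : 0 ≤ φ (c k₀ * (s - 2 * r : ℕ)) := hφ.nonneg (by positivity)
      gcongr
      have : 0 ≤ 2 * L₀ ^ (m + 1) := by positivity
      linarith

/-! ### The quasi-local case -/

/-- The product is at most the `p`-th power of the maximum of `1` and its largest factor. This
serves in place of Hölder's inequality. -/
theorem prod_le_one_add_sum_pow {ι : Type*} {A : Finset ι} {a : ι → ℝ} (ha : ∀ i, 0 ≤ a i) {p : ℕ}
    (hp : A.card ≤ p) : ∏ i ∈ A, a i ≤ 1 + ∑ i ∈ A, a i ^ p := by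
  rcases A.eq_empty_or_nonempty with rfl | hA
  · simp
  obtain ⟨i₀, hi₀, hmax⟩ := A.exists_max_image a hA
  have h1 : a i₀ ^ p ≤ ∑ i ∈ A, a i ^ p :=
    Finset.single_le_sum (f := fun i => a i ^ p) (fun i _ => pow_nonneg (ha i) p) hi₀
  have h2 : ∏ i ∈ A, a i ≤ max 1 (a i₀) ^ p := by
    calc _ ≤ ∏ _i ∈ A, max 1 (a i₀) :=
          Finset.prod_le_prod (fun i _ => ha i) fun i hi => (hmax i hi).trans (le_max_right _ _)
      _ = max 1 (a i₀) ^ A.card := by rw [Finset.prod_const]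
      _ ≤ _ := pow_le_pow_right₀ (le_max_left _ _) hp
  have h3 : 0 ≤ a i₀ ^ p := pow_nonneg (ha i₀) p
  rcases le_total 1 (a i₀) with h | h
  · rw [max_eq_right h] at h2; linarith
  · rw [max_eq_left h, one_pow] at h2; linarith

theorem integral_prod_le [IsProbabilityMeasure Pr] {ι : Type*} {A : Finset ι} {Z : ι → Ω → ℝ}
    (hZ : ∀ i, HasMoments Pr (Z i)) (hZ0 : ∀ i ω, 0 ≤ Z i ω) {p : ℕ} (hp : A.card ≤ p) {K : ℝ}
    (hK : ∀ i, ∫ ω, Z i ω ^ p ∂Pr ≤ K) (hK0 : 0 ≤ K) : ∫ ω, ∏ i ∈ A, Z i ω ∂Pr ≤ 1 + p * K := by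
  have hint : ∀ i ∈ A, Integrable (fun ω => Z i ω ^ p) Pr := fun i _ => ((hZ i).pow p).integrable
  calc _ ≤ ∫ ω, (1 + ∑ i ∈ A, Z i ω ^ p) ∂Pr :=
        integral_mono (HasMoments.finset_prod fun i _ => hZ i).integrable
          ((integrable_const 1).add (integrable_finsetSum _ hint)) fun ω =>
            prod_le_one_add_sum_pow (fun i => hZ0 i ω) hp
    _ = 1 + ∑ i ∈ A, ∫ ω, Z i ω ^ p ∂Pr := by
        rw [integral_add (integrable_const 1) (integrable_finsetSum _ hint),
          integral_finsetSum _ hint]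
        simp
    _ ≤ 1 + ∑ _i ∈ A, K := by gcongr with i; exact hK i
    _ ≤ 1 + p * K := by
        rw [Finset.sum_const, nsmul_eq_mul]
        gcongr

/-- Products of variables that agree off an event of small probability have close means. -/
theorem abs_integral_prod_sub_le [IsProbabilityMeasure Pr] {ι : Type*} {A : Finset ι}
    {Y f Z : ι → Ω → ℝ} (hY : ∀ i, HasMoments Pr (Y i)) (hf : ∀ i, HasMoments Pr (f i))
    (hZ : ∀ i, HasMoments Pr (Z i)) (hYZ : ∀ i ω, |Y i ω| ≤ Z i ω) (hfZ : ∀ i ω, |f i ω| ≤ Z i ω)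
    {E : Set Ω} (hE : MeasurableSet E) (hYf : ∀ ω, ω ∉ E → ∀ i, Y i ω = f i ω) {K : ℝ}
    (hK : ∫ ω, ∏ i ∈ A, Z i ω ^ 2 ∂Pr ≤ K) {η : ℝ} (hη : 0 < η) :
    |∫ ω, ∏ i ∈ A, Y i ω ∂Pr - ∫ ω, ∏ i ∈ A, f i ω ∂Pr| ≤ 2 * (η * K + Pr.real E / η) := by
  have iY := (HasMoments.finset_prod (A := A) fun i _ => hY i).integrable
  have iF := (HasMoments.finset_prod (A := A) fun i _ => hf i).integrable
  have iZ := (HasMoments.finset_prod (A := A) fun i _ => (hZ i).pow 2).integrable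
  have iE : Integrable (E.indicator fun _ => (1 : ℝ)) Pr := (integrable_const 1).indicator hE
  rw [← integral_sub iY iF]
  calc |∫ ω, (∏ i ∈ A, Y i ω - ∏ i ∈ A, f i ω) ∂Pr|
      ≤ ∫ ω, |∏ i ∈ A, Y i ω - ∏ i ∈ A, f i ω| ∂Pr := abs_integral_le_integral_abs
    _ ≤ ∫ ω, 2 * (η * ∏ i ∈ A, Z i ω ^ 2 + E.indicator (fun _ => (1 : ℝ)) ω / η) ∂Pr := by
        refine integral_mono (iY.sub iF).abs (((iZ.const_mul η).add (iE.div_const η)).const_mul 2)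
          fun ω => ?_
        simp only
        have hZ2 : 0 ≤ ∏ i ∈ A, Z i ω ^ 2 := Finset.prod_nonneg fun i _ => sq_nonneg _
        by_cases hω : ω ∈ E
        · rw [Set.indicator_of_mem hω]
          have hp : ∀ g : ι → ℝ, (∀ i, |g i| ≤ Z i ω) → |∏ i ∈ A, g i| ≤ ∏ i ∈ A, Z i ω :=
            fun g hg => by
              rw [Finset.abs_prod]
              exact Finset.prod_le_prod (fun i _ => abs_nonneg _) fun i _ => hg i
          have h1 := hp (fun i => Y i ω) fun i => hYZ i ω
          have h2 := hp (fun i => f i ω) fun i => hfZ i ω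
          rw [Finset.prod_pow]
          set a := ∏ i ∈ A, Z i ω
          -- A weighted arithmetic-geometric inequality in place of Cauchy–Schwarz: `η` trades the
          -- second moment against the probability of `E`.
          have h3 : a ≤ η * a ^ 2 + 1 / η := by
            rw [← sub_nonneg]
            have : η * a ^ 2 + 1 / η - a = (η * a - 1 / 2) ^ 2 / η + 3 / (4 * η) := by
              field_simp; ring
            rw [this]; positivity
          refine (abs_sub _ _).trans ?_
          linarith
        · rw [Finset.prod_congr rfl fun i _ => hYf ω hω i, sub_self, abs_zero,
            Set.indicator_of_notMem hω]
          positivity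
    _ = 2 * (η * ∫ ω, ∏ i ∈ A, Z i ω ^ 2 ∂Pr + Pr.real E / η) := by
        rw [integral_const_mul, integral_add (iZ.const_mul η) (iE.div_const η),
          integral_const_mul, integral_div, integral_indicator_const _ hE]
        simp
    _ ≤ _ := by gcongr

theorem exists_pow_le_lt {g : ℕ} (hg : 0 < g) (s : ℕ) : ∃ r : ℕ, r ^ g ≤ s ∧ s < (r + 1) ^ g := by
  refine ⟨Nat.findGreatest (fun r => r ^ g ≤ s) s, ?_, ?_⟩
  · exact Nat.findGreatest_spec (P := fun r => r ^ g ≤ s) (Nat.zero_le s) (by simp [hg.ne'])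
  · by_contra hcon
    rw [not_lt] at hcon
    set r := Nat.findGreatest (fun r => r ^ g ≤ s) s
    have h1 : r + 1 ≤ s := (Nat.le_self_pow hg.ne' _).trans hcon
    exact Nat.findGreatest_is_greatest (Nat.lt_succ_self r) h1 hcon

/-- A stretched exponential beats exponentials of powers of a small root of its argument. -/
theorem StretchedExpDecay.exists_root {φ : ℝ → ℝ} (hφ : FastDecreasing φ) {b : ℝ} (hb : 0 < b)
    (h : StretchedExpDecay φ b) {c₀ : ℝ} (hc₀ : 0 < c₀) {Q : ℝ} (hQ : 0 ≤ Q) (q : ℕ) :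
    ∃ g : ℕ, 0 < g ∧ ∀ M : ℕ, ∃ r₀ : ℕ, ∀ r ≥ r₀, ∀ s : ℕ, r ^ g ≤ s → 2 * r < s ∧
      Real.exp (Q * ((r : ℝ) + 1) ^ q) * φ (c₀ * (s - 2 * r : ℕ)) ≤ 1 / ((r : ℝ) + 1) ^ M := by
  obtain ⟨δ, hδ, hle⟩ := h.exists_le
  obtain ⟨t₀, ht₀⟩ := eventually_atTop.1 hle
  -- The ceiling gives `g * b ≥ q + 2`, so `φ` at scale `r^g` is at most `exp (-δ' r^(q+2))`, which
  -- beats `exp (Q (r+1)^q)`. The added `2` gives `r^g ≥ 4r` for `r ≥ 4`, hence `s - 2r ≥ r^g / 2`.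
  -- The choice precedes `M`, which may therefore be a multiple of `g`.
  set g := ⌈((q : ℝ) + 2) / b⌉₊ + 2 with hg
  have hgb : ((q + 2 : ℕ) : ℝ) ≤ g * b := by
    have h1 := Nat.le_ceil (((q : ℝ) + 2) / b)
    rw [div_le_iff₀ hb] at h1
    push_cast [hg]
    nlinarith
  refine ⟨g, by omega, fun M => ?_⟩
  set δ' := δ * (c₀ / 2) ^ b with hδ'
  have hδ'0 : 0 < δ' := by positivity
  have e1 : ∀ᶠ r : ℕ in atTop, t₀ ≤ c₀ / 2 * (r : ℝ) := 
    (tendsto_natCast_atTop_atTop.const_mul_atTop (by positivity)).eventually_ge_atTop t₀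
  have e2 : ∀ᶠ r : ℕ in atTop, Q * 2 ^ q + 1 ≤ δ' * (r : ℝ) :=
    (tendsto_natCast_atTop_atTop.const_mul_atTop hδ'0).eventually_ge_atTop _
  have e3 : ∀ᶠ r : ℕ in atTop, ((r : ℝ) + 1) ^ M * Real.exp (-((r : ℝ) + 1)) < Real.exp (-1) := by
    have h1 := (Real.tendsto_pow_mul_exp_neg_atTop_nhds_zero M).comp
      (tendsto_atTop_add_const_right _ (1 : ℝ) (tendsto_natCast_atTop_atTop (R := ℝ)))
    exact h1.eventually (gt_mem_nhds (Real.exp_pos _))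
  obtain ⟨r₀, hr₀⟩ := eventually_atTop.1 (e1.and (e2.and (e3.and (eventually_ge_atTop 4))))
  refine ⟨r₀, fun r hr s hs => ?_⟩
  obtain ⟨a1, a2, a3, a4⟩ := hr₀ r hr
  have hr1 : (1 : ℝ) ≤ r := by exact_mod_cast (by omega : 1 ≤ r)
  have hrg : 4 * r ≤ r ^ g := by
    calc 4 * r ≤ r * r := Nat.mul_le_mul_right r a4
      _ = r ^ 2 := (pow_two r).symm
      _ ≤ r ^ g := Nat.pow_le_pow_right (by omega) (by omega)
  refine ⟨by omega, ?_⟩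
  have hs2 : (r : ℝ) ^ g / 2 ≤ ((s - 2 * r : ℕ) : ℝ) := by
    have : r ^ g ≤ 2 * (s - 2 * r) := by omega
    rw [div_le_iff₀ two_pos, mul_comm]
    exact_mod_cast this
  have hφ1 : φ (c₀ * (s - 2 * r : ℕ)) ≤ Real.exp (-(δ' * (r : ℝ) ^ (q + 2))) := by
    have h1 : c₀ / 2 * (r : ℝ) ^ g ≤ c₀ * (s - 2 * r : ℕ) := by
      calc _ = c₀ * ((r : ℝ) ^ g / 2) := by ring
        _ ≤ _ := by gcongr
    have h2 : t₀ ≤ c₀ / 2 * (r : ℝ) ^ g := by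
      refine a1.trans ?_
      gcongr
      exact le_self_pow₀ hr1 (by omega)
    refine (hφ.antitone (Set.mem_Ici.2 (by positivity)) (Set.mem_Ici.2 (by positivity)) h1).trans
      ((ht₀ _ h2).trans (Real.exp_le_exp.2 (neg_le_neg ?_)))
    rw [Real.mul_rpow (by positivity) (by positivity), hδ', mul_assoc]
    gcongr
    rw [← Real.rpow_natCast, ← Real.rpow_natCast, ← Real.rpow_mul (by positivity)]
    exact Real.rpow_le_rpow_of_exponent_le hr1 hgb
  have hexp : Q * ((r : ℝ) + 1) ^ q - δ' * (r : ℝ) ^ (q + 2) ≤ -r := by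
    have h1 : ((r : ℝ) + 1) ^ q ≤ 2 ^ q * (r : ℝ) ^ q := by
      rw [← mul_pow]; gcongr; linarith
    have hrq : (1 : ℝ) ≤ (r : ℝ) ^ q := one_le_pow₀ hr1
    have h2 : Q * ((r : ℝ) + 1) ^ q ≤ Q * 2 ^ q * (r : ℝ) ^ q := by
      rw [mul_assoc]; gcongr
    have h3 : δ' * (r : ℝ) ^ (q + 2) = (δ' * r) * ((r : ℝ) ^ q * r) := by ring
    have h4 : (Q * 2 ^ q + 1) * ((r : ℝ) ^ q * r) ≤ (δ' * r) * ((r : ℝ) ^ q * r) := by gcongr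
    have h5 : Q * 2 ^ q * (r : ℝ) ^ q ≤ Q * 2 ^ q * ((r : ℝ) ^ q * r) := by
      gcongr
      exact le_mul_of_one_le_right (by positivity) hr1
    have h6 : (r : ℝ) ≤ (r : ℝ) ^ q * r := le_mul_of_one_le_left (by positivity) hrq
    rw [h3]
    linarith
  calc _ ≤ Real.exp (Q * ((r : ℝ) + 1) ^ q) * Real.exp (-(δ' * (r : ℝ) ^ (q + 2))) := by gcongr
    _ = Real.exp (Q * ((r : ℝ) + 1) ^ q - δ' * (r : ℝ) ^ (q + 2)) := by
        rw [← Real.exp_add, sub_eq_add_neg]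
    _ ≤ Real.exp (-r) := Real.exp_le_exp.2 hexp
    _ ≤ _ := by
        rw [le_div_iff₀ (by positivity), mul_comm]
        have h1 : Real.exp (-((r : ℝ) + 1)) = Real.exp (-r) * Real.exp (-1) := by
          rw [← Real.exp_add]; ring_nf
        rw [h1, ← mul_assoc] at a3
        exact (lt_of_mul_lt_mul_right (by linarith) (Real.exp_pos (-1)).le).le

end FieldClusters

/-! ### Truncation of quasi-local scores. -/

section QuasiLocalClusters

variable {V : Type*} [AddGroup V] {S : Finset V}
variable {Ω : Type*} [MeasurableSpace Ω] {Pr : Measure Ω} {P : Ω → Set V}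

/-- The truncated score at `x`, centred at the mean of the score itself. -/
noncomputable def truncField (S : Finset V) (Pr : Measure Ω) (P : Ω → Set V)
    (ξ : V → Set V → ℝ) (n : ℕ∞) (r : ℕ) (x : V) (μ : Set V) : ℝ :=
  truncScore S ξ r x (μ ∩ window S n) - ∫ ω', ξ x (P ω' ∩ window S n) ∂Pr

theorem exists_uniform_bound {J : Type*} [Fintype J] {p : J → ℝ → Prop}
    (hmono : ∀ j a b, a ≤ b → p j a → p j b) (h : ∀ j, ∃ K, p j K) :
    ∃ K : ℝ, 0 ≤ K ∧ ∀ j, p j K := by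
  choose K hK using h
  refine ⟨∑ j, |K j|, Finset.sum_nonneg fun _ _ => abs_nonneg _, fun j => hmono j _ _ ?_ (hK j)⟩
  exact (le_abs_self _).trans
    (Finset.single_le_sum (f := fun j => |K j|) (fun _ _ => abs_nonneg _) (Finset.mem_univ j))

theorem QuasiLocal.hasMoments_truncField [IsProbabilityMeasure Pr] (hS : IsCayleyGenerating S)
    (hP : Measurable P) {ξ : V → Set V → ℝ} (h : QuasiLocal S Pr P ξ) {n : ℕ∞} (hn : 1 ≤ n) {x : V}
    (hx : x ∈ window S n) (r : ℕ) :
    HasMoments Pr fun ω => truncField S Pr P ξ n r x (P ω) := by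
  have hm := (dependsOnly_truncScore hS h.score r x (window S n)).measurable hP
  refine HasMoments.sub_const ⟨hm, fun p => ?_⟩ _
  refine ((h.hasMoments hP hn hx).integrable_pow p).mono' (hm.abs.pow_const p).aestronglyMeasurable
    (ae_of_all _ fun ω => ?_)
  rw [Real.norm_of_nonneg (by positivity)]
  exact pow_le_pow_left₀ (abs_nonneg _) (abs_truncScore_le_abs _ _ _) p

/-- Both fields use the same centring, so they agree unless some radius of stabilisation exceeds
`r`, and both are dominated by `|ξ| + const`, whose moments are bounded uniformly. The moment bound
`K` is chosen before the order `M` of the error. -/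
theorem QuasiLocal.truncation_error [IsProbabilityMeasure Pr] (hS : IsCayleyGenerating S)
    (hP : Measurable P) {J : Type*} [Fintype J] {Ξ : J → V → Set V → ℝ}
    (h : ∀ j, QuasiLocal S Pr P (Ξ j)) (m : ℕ) : ∃ K : ℝ, 0 ≤ K ∧ ∀ M : ℕ, ∃ C : ℝ, 0 ≤ C ∧
      ∀ n : ℕ∞, 1 ≤ n → ∀ z : Fin (m + 1) → V, (∀ i, z i ∈ window S n) →
      ∀ τ : Fin (m + 1) → J, ∀ r : ℕ, ∀ A : Finset (Fin (m + 1)),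
        |∫ ω, ∏ i ∈ A, scoreField S Pr P (Ξ (τ i)) n (z i) ω ∂Pr| ≤ K ∧
        |∫ ω, ∏ i ∈ A, truncField S Pr P (Ξ (τ i)) n r (z i) (P ω) ∂Pr| ≤ K ∧
        |∫ ω, ∏ i ∈ A, scoreField S Pr P (Ξ (τ i)) n (z i) ω ∂Pr -
          ∫ ω, ∏ i ∈ A, truncField S Pr P (Ξ (τ i)) n r (z i) (P ω) ∂Pr| ≤
            C / ((r : ℝ) + 1) ^ M := by
  have hmom : ∀ p : ℕ, ∃ K : ℝ, 0 ≤ K ∧ ∀ j, ∀ n : ℕ∞, 1 ≤ n → ∀ x ∈ window S n,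
      ∫ ω, |Ξ j x (P ω ∩ window S n)| ^ p ∂Pr ≤ K := fun p =>
    exists_uniform_bound (fun j a b hab ha n hn x hx => (ha n hn x hx).trans hab) fun j => by
      obtain ⟨K, hK⟩ := (h j).moments p
      exact ⟨K, fun n hn x hx => (hK n hn x hx).2⟩
  choose K hK0 hK using hmom
  -- the dominating variables
  set Z : ℕ∞ → V → J → Ω → ℝ := fun n x j ω => |Ξ j x (P ω ∩ window S n)| + K 1 with hZ
  have hZ0 : ∀ n x j ω, 0 ≤ Z n x j ω := fun n x j ω => by have := hK0 1; positivity
  have hZm : ∀ n : ℕ∞, 1 ≤ n → ∀ x ∈ window S n, ∀ j, HasMoments Pr (Z n x j) :=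
    fun n hn x hx j => ((h j).hasMoments hP hn hx).abs.add (HasMoments.const _)
  set K' : ℕ → ℝ := fun p => 2 ^ p * (K p + K 1 ^ p) with hK'
  have hK'0 : ∀ p, 0 ≤ K' p := fun p => by
    have := hK0 p; have := hK0 1; simp only [hK']; positivity
  have hZp : ∀ p, ∀ n : ℕ∞, 1 ≤ n → ∀ x ∈ window S n, ∀ j, ∫ ω, Z n x j ω ^ p ∂Pr ≤ K' p := by
    intro p n hn x hx j
    have hm := ((h j).hasMoments hP hn hx).integrable_pow p
    calc _ ≤ ∫ ω, 2 ^ p * (|Ξ j x (P ω ∩ window S n)| ^ p + K 1 ^ p) ∂Pr := by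
          refine integral_mono ((hZm n hn x hx j).pow p).integrable
            ((hm.add (integrable_const _)).const_mul _) fun ω => ?_
          have := abs_add_pow_le |Ξ j x (P ω ∩ window S n)| (K 1) p
          rw [abs_abs, abs_of_nonneg (hK0 1), abs_of_nonneg (hZ0 n x j ω)] at this
          exact this
      _ = 2 ^ p * ((∫ ω, |Ξ j x (P ω ∩ window S n)| ^ p ∂Pr) + K 1 ^ p) := by
          rw [integral_const_mul, integral_add hm (integrable_const _)]
          simp
      _ ≤ _ := by simp only [hK']; gcongr; exact hK p j n hn x hx
  have hmean : ∀ n : ℕ∞, 1 ≤ n → ∀ x ∈ window S n, ∀ j,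
      |∫ ω', Ξ j x (P ω' ∩ window S n) ∂Pr| ≤ K 1 := by
    intro n hn x hx j
    have := hK 1 j n hn x hx
    simp only [pow_one] at this
    exact abs_integral_le_integral_abs.trans this
  have hYZ : ∀ n : ℕ∞, 1 ≤ n → ∀ x ∈ window S n, ∀ j ω,
      |scoreField S Pr P (Ξ j) n x ω| ≤ Z n x j ω := fun n hn x hx j ω =>
    (abs_sub _ _).trans (add_le_add le_rfl (hmean n hn x hx j))
  have hfZ : ∀ n : ℕ∞, 1 ≤ n → ∀ x ∈ window S n, ∀ j r ω,
      |truncField S Pr P (Ξ j) n r x (P ω)| ≤ Z n x j ω := fun n hn x hx j r ω =>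
    (abs_sub _ _).trans (add_le_add (abs_truncScore_le_abs _ _ _) (hmean n hn x hx j))
  have hYm : ∀ n : ℕ∞, 1 ≤ n → ∀ x ∈ window S n, ∀ j,
      HasMoments Pr (scoreField S Pr P (Ξ j) n x) := fun n hn x hx j =>
    ((h j).hasMoments hP hn hx).sub_const _
  have hfm : ∀ n : ℕ∞, 1 ≤ n → ∀ x ∈ window S n, ∀ j r,
      HasMoments Pr fun ω => truncField S Pr P (Ξ j) n r x (P ω) := fun n hn x hx j r =>
    (h j).hasMoments_truncField hS hP hn hx r
  have hcard : ∀ A : Finset (Fin (m + 1)), A.card ≤ m + 1 := fun A =>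
    (Finset.card_le_univ _).trans (by simp)
  have hprod : ∀ n : ℕ∞, 1 ≤ n → ∀ z : Fin (m + 1) → V, (∀ i, z i ∈ window S n) →
      ∀ (τ : Fin (m + 1) → J) (A : Finset (Fin (m + 1))) (g : Fin (m + 1) → Ω → ℝ),
        (∀ i, HasMoments Pr (g i)) → (∀ i ω, |g i ω| ≤ Z n (z i) (τ i) ω) →
        |∫ ω, ∏ i ∈ A, g i ω ∂Pr| ≤ 1 + (m + 1 : ℕ) * K' (m + 1) := by
    intro n hn z hz τ A g hg hgZ
    refine abs_integral_le_integral_abs.trans (le_trans ?_ (integral_prod_le (A := A)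
      (fun i => hZm n hn (z i) (hz i) (τ i)) (fun i => hZ0 n (z i) (τ i)) (hcard A)
      (fun i => hZp _ n hn (z i) (hz i) (τ i)) (hK'0 _)))
    refine integral_mono (HasMoments.finset_prod fun i _ => hg i).integrable.abs
      (HasMoments.finset_prod fun i _ => hZm n hn (z i) (hz i) (τ i)).integrable fun ω => ?_
    rw [Finset.abs_prod]
    exact Finset.prod_le_prod (fun i _ => abs_nonneg _) fun i _ => hgZ i ω
  refine ⟨1 + (m + 1 : ℕ) * K' (m + 1), by have := hK'0 (m + 1); positivity, fun M => ?_⟩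
  -- The tail is used to order `2M`: with `η = (r+1)^(-M)` both `η K₂` and the probability of the
  -- bad event divided by `η` are of order `(r+1)^(-M)`.
  obtain ⟨T, hT0, hT⟩ : ∃ T : ℝ, 0 ≤ T ∧ ∀ j, ∀ n : ℕ∞, 1 ≤ n → ∀ x ∈ window S n, ∀ r : ℕ,
      Pr.real {ω | ¬ stabRadius S (Ξ j) x (P ω ∩ window S n) ≤ r} ≤
        T / ((r : ℝ) + 1) ^ (2 * M) :=
    exists_uniform_bound (fun j a b hab ha n hn x hx r => (ha n hn x hx r).trans (by gcongr))
      fun j => (h j).tail (2 * M)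
  set K₂ := 1 + (m + 1 : ℕ) * K' (2 * (m + 1)) with hK₂
  have hK₂0 : 0 ≤ K₂ := by have := hK'0 (2 * (m + 1)); positivity
  refine ⟨2 * (K₂ + (m + 1) * T), by positivity, fun n hn z hz τ r A => ⟨?_, ?_, ?_⟩⟩
  · exact hprod n hn z hz τ A (fun i => scoreField S Pr P (Ξ (τ i)) n (z i))
      (fun i => hYm n hn (z i) (hz i) (τ i)) fun i => hYZ n hn (z i) (hz i) (τ i)
  · exact hprod n hn z hz τ A (fun i ω => truncField S Pr P (Ξ (τ i)) n r (z i) (P ω))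
      (fun i => hfm n hn (z i) (hz i) (τ i) r) fun i => hfZ n hn (z i) (hz i) (τ i) r
  · set E : Set Ω := ⋃ i ∈ (Finset.univ : Finset (Fin (m + 1))),
      {ω | ¬ stabRadius S (Ξ (τ i)) (z i) (P ω ∩ window S n) ≤ r} with hE
    have hEm : MeasurableSet E := by
      refine Finset.measurableSet_biUnion _ fun i _ => ?_
      have := (dependsOnly_stabRadius_le (ξ := Ξ (τ i)) hS r (z i) (window S n)).measurable hP
      exact (measurableSet_setOfPred.2 this).compl
    have hEp : Pr.real E ≤ (m + 1) * (T / ((r : ℝ) + 1) ^ (2 * M)) := by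
      refine (measureReal_biUnion_finset_le _ _).trans
        ((Finset.sum_le_sum fun i _ => hT (τ i) n hn (z i) (hz i) r).trans (le_of_eq ?_))
      simp
    have hYf : ∀ ω, ω ∉ E → ∀ i, scoreField S Pr P (Ξ (τ i)) n (z i) ω =
        truncField S Pr P (Ξ (τ i)) n r (z i) (P ω) := by
      intro ω hω i
      simp only [hE, Set.mem_iUnion, Finset.mem_univ, Set.mem_ofPred_eq, exists_prop, true_and,
        not_exists, not_not] at hω
      rw [scoreField, truncField, truncScore, if_pos (hω i)]
    have hsq : ∫ ω, ∏ i ∈ A, Z n (z i) (τ i) ω ^ 2 ∂Pr ≤ K₂ := by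
      refine integral_prod_le (Z := fun i ω => Z n (z i) (τ i) ω ^ 2)
        (fun i => (hZm n hn (z i) (hz i) (τ i)).pow 2) (fun i ω => sq_nonneg _) (hcard A)
        (fun i => ?_) (hK'0 _)
      simp only [← pow_mul]
      exact hZp _ n hn (z i) (hz i) (τ i)
    have hr : (0 : ℝ) < (r : ℝ) + 1 := by positivity
    refine (abs_integral_prod_sub_le (fun i => hYm n hn (z i) (hz i) (τ i))
      (fun i => hfm n hn (z i) (hz i) (τ i) r) (fun i => hZm n hn (z i) (hz i) (τ i))
      (fun i => hYZ n hn (z i) (hz i) (τ i)) (fun i => hfZ n hn (z i) (hz i) (τ i) r) hEm hYf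
      hsq (η := 1 / ((r : ℝ) + 1) ^ M) (by positivity)).trans ?_
    calc 2 * (1 / ((r : ℝ) + 1) ^ M * K₂ + Pr.real E / (1 / ((r : ℝ) + 1) ^ M))
        ≤ 2 * (1 / ((r : ℝ) + 1) ^ M * K₂ +
          (m + 1) * (T / ((r : ℝ) + 1) ^ (2 * M)) / (1 / ((r : ℝ) + 1) ^ M)) := by gcongr
      _ = _ := by
        rw [two_mul M, pow_add]
        field_simp

/-- From `k ≤ exp k` and `a < 1`, `k^(ak) ≤ exp (k²)`. This crude bound is enough, as the decay of
`φ` will beat the exponential of any fixed power of `r`. -/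
theorem exists_bound_of_isBigO_rpow {C : ℕ → ℝ} {a : ℝ} (ha0 : 0 ≤ a) (ha : a < 1)
    (h : C =O[atTop] fun k : ℕ => (k : ℝ) ^ (a * k)) :
    ∃ K : ℝ, 0 ≤ K ∧ ∀ k : ℕ, |C k| ≤ K * Real.exp ((k : ℝ) ^ 2) := by
  obtain ⟨c, hc, hb⟩ := h.exists_pos
  obtain ⟨N, hN⟩ := eventually_atTop.1 hb.bound
  have hs : 0 ≤ ∑ k ∈ Finset.range N, |C k| := Finset.sum_nonneg fun _ _ => abs_nonneg _
  refine ⟨c + ∑ k ∈ Finset.range N, |C k|, by positivity, fun k => ?_⟩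
  have h1 : 1 ≤ Real.exp ((k : ℝ) ^ 2) := Real.one_le_exp (sq_nonneg _)
  rcases lt_or_ge k N with hk | hk
  · have h2 : |C k| ≤ ∑ k ∈ Finset.range N, |C k| :=
      Finset.single_le_sum (f := fun k => |C k|) (fun _ _ => abs_nonneg _) (Finset.mem_range.2 hk)
    nlinarith
  · have h2 := hN k hk
    rw [Real.norm_eq_abs, Real.norm_of_nonneg (by positivity)] at h2
    have h3 : (k : ℝ) ^ (a * k) ≤ Real.exp ((k : ℝ) ^ 2) := by
      have hk0 : (0 : ℝ) ≤ k := k.cast_nonneg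
      calc (k : ℝ) ^ (a * k) ≤ Real.exp k ^ (a * k) :=
            Real.rpow_le_rpow hk0 (by linarith [Real.add_one_le_exp (k : ℝ)]) (by positivity)
        _ = Real.exp (k * (a * k)) := by rw [← Real.exp_mul]
        _ ≤ _ := Real.exp_le_exp.2 (by nlinarith [mul_nonneg hk0 hk0])
    nlinarith

/-- At most `N = (m+1) w_r` spins are involved, polynomially many in `r`. So `4^N`, the sum of the
`|C k|` and the sup norms given by the growth condition are all at most exponentials of powers of `r
+ 1`. The exponent `2d + κ₀` accommodates both `N²` and the growth of the scores. -/
theorem ClustersWith.abs_cov_trunc_le [IsProbabilityMeasure Pr] (hS : IsCayleyGenerating S)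
    (hG : PolynomialGrowth S) {C c : ℕ → ℝ} {φ : ℝ → ℝ} (hcl : ClustersWith S Pr P C c φ)
    {c₀ : ℝ} (hc₀ : 0 < c₀) (hc : ∀ k, c₀ ≤ c k) {a : ℝ} (ha0 : 0 ≤ a) (ha : a < 1)
    (hC : C =O[atTop] fun k : ℕ => (k : ℝ) ^ (a * k)) {J : Type*} [Fintype J]
    {Ξ : J → V → Set V → ℝ} (h : ∀ j, QuasiLocal S Pr P (Ξ j)) (m : ℕ) :
    ∃ Q Q' : ℝ, ∃ q : ℕ, 0 ≤ Q ∧ 0 ≤ Q' ∧ ∀ n : ℕ∞, 1 ≤ n → ∀ z : Fin (m + 1) → V,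
      (∀ i, z i ∈ window S n) → ∀ τ : Fin (m + 1) → J, ∀ r : ℕ, 0 < r →
      ∀ A B : Finset (Fin (m + 1)), Disjoint A B →
      ∀ s : ℕ, (∀ i ∈ A, ∀ j ∈ B, s ≤ cdist S (z i) (z j)) → 2 * r < s →
        |∫ ω, ∏ i ∈ A ∪ B, truncField S Pr P (Ξ (τ i)) n r (z i) (P ω) ∂Pr -
          (∫ ω, ∏ i ∈ A, truncField S Pr P (Ξ (τ i)) n r (z i) (P ω) ∂Pr) *
            ∫ ω, ∏ i ∈ B, truncField S Pr P (Ξ (τ i)) n r (z i) (P ω) ∂Pr| ≤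
          Q * (Real.exp (Q' * ((r : ℝ) + 1) ^ q) * φ (c₀ * (s - 2 * r : ℕ))) := by
  obtain ⟨d, Cw, hCw, hw⟩ := hG.exists_nat
  obtain ⟨Kc, hKc0, hKc⟩ := exists_bound_of_isBigO_rpow ha0 ha hC
  choose D c₁ κ hD hc₁ hgr using fun j => (h j).growth
  obtain ⟨K, hK0, hK⟩ : ∃ K : ℝ, 0 ≤ K ∧ ∀ j, ∀ n : ℕ∞, 1 ≤ n → ∀ x ∈ window S n,
      ∫ ω, |Ξ j x (P ω ∩ window S n)| ^ 1 ∂Pr ≤ K :=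
    exists_uniform_bound (fun j a b hab ha n hn x hx => (ha n hn x hx).trans hab) fun j => by
      obtain ⟨K, hK⟩ := (h j).moments 1
      exact ⟨K, fun n hn x hx => (hK n hn x hx).2⟩
  set D₀ := ∑ j, D j
  set c₂ := ∑ j, c₁ j
  set κ₀ := Finset.univ.sup κ
  have hD₀ : 0 ≤ D₀ := Finset.sum_nonneg fun j _ => hD j
  have hc₂ : 0 ≤ c₂ := Finset.sum_nonneg fun j _ => hc₁ j
  set L : ℝ := 1 + D₀ + K
  have hL1 : 1 ≤ L := by simp only [L]; linarith
  set N₁ : ℝ := (m + 1) * Cw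
  have hN₁ : 0 ≤ N₁ := by positivity
  refine ⟨L ^ (m + 1) * Kc, 3 * N₁ + N₁ ^ 2 + (m + 1) * c₂, 2 * d + κ₀, by positivity,
    by positivity, fun n hn z hz τ r hr A B hAB s hs hrs => ?_⟩
  have hr1 : (1 : ℝ) ≤ (r : ℝ) + 1 := by linarith [r.cast_nonneg (α := ℝ)]
  set x := c₂ * ((r : ℝ) + 1) ^ κ₀
  have hx0 : 0 ≤ x := by positivity
  have hfL : ∀ i μ, |truncField S Pr P (Ξ (τ i)) n r (z i) μ| ≤ L * Real.exp x := by
    intro i μ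
    have h1 : |truncScore S (Ξ (τ i)) r (z i) (μ ∩ window S n)| ≤ D₀ * Real.exp x := by
      refine abs_truncScore_le hS (h (τ i)).score (fun μ => (hgr (τ i) r hr μ).trans ?_) _ _
      have e1 : D (τ i) ≤ D₀ := Finset.single_le_sum (fun j _ => hD j) (Finset.mem_univ _)
      have e2 : c₁ (τ i) ≤ c₂ := Finset.single_le_sum (fun j _ => hc₁ j) (Finset.mem_univ _)
      have e3 : (r : ℝ) ^ κ (τ i) ≤ ((r : ℝ) + 1) ^ κ₀ :=
        (pow_le_pow_left₀ (by positivity) (by linarith) _).trans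
          (pow_le_pow_right₀ hr1 (Finset.le_sup (Finset.mem_univ _)))
      have e4 := hc₁ (τ i)
      simp only [x]
      gcongr
    have h2 : |∫ ω', Ξ (τ i) (z i) (P ω' ∩ window S n) ∂Pr| ≤ K := by
      have := hK (τ i) n hn (z i) (hz i)
      simp only [pow_one] at this
      exact abs_integral_le_integral_abs.trans this
    have h3 : 1 ≤ Real.exp x := Real.one_le_exp hx0
    refine (abs_sub _ _).trans ?_
    simp only [L]
    nlinarith
  have hL' : 1 ≤ L * Real.exp x := by
    have h3 : 1 ≤ Real.exp x := Real.one_le_exp hx0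
    nlinarith
  have hdep : ∀ i, DependsOnly (truncField S Pr P (Ξ (τ i)) n r (z i)) (cball S (z i) r) := by
    intro i μ μ' hμ
    exact congrArg (· - ∫ ω', Ξ (τ i) (z i) (P ω' ∩ window S n) ∂Pr)
      (dependsOnly_truncScore hS (h (τ i)).score r (z i) (window S n) μ μ' hμ)
  have hcardAB : A.card + B.card ≤ m + 1 := by
    rw [← Finset.card_union_of_disjoint hAB]
    exact (Finset.card_le_univ _).trans (by simp)
  set N := (m + 1) * (windowFinset S r).card
  have key := hcl.abs_cov_prod_le hS hL' hdep hfL hAB hcardAB (le_refl N) hc₀ (fun k _ => hc k) hs hrs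
  refine key.trans ?_
  have hφ0 : 0 ≤ φ (c₀ * (s - 2 * r : ℕ)) := hcl.fastDecreasing.nonneg (by positivity)
  rw [← mul_assoc]
  refine mul_le_mul_of_nonneg_right ?_ hφ0
  set y : ℝ := N₁ * ((r : ℝ) + 1) ^ d with hy
  have hNy : (N : ℝ) ≤ y := by
    simp only [N, hy, N₁, Nat.cast_mul, mul_assoc]
    push_cast
    gcongr
    exact hw r
  have hN0 : (0 : ℝ) ≤ N := N.cast_nonneg
  have hy0 : 0 ≤ y := hN0.trans hNy
  have h4 : (4 : ℝ) ^ N ≤ Real.exp (2 * y) := by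
    have : (4 : ℝ) ≤ Real.exp 2 := by
      have h1 := Real.exp_one_gt_d9
      have h2 : Real.exp 2 = Real.exp 1 * Real.exp 1 := by rw [← Real.exp_add]; norm_num
      rw [h2]; nlinarith
    calc (4 : ℝ) ^ N ≤ Real.exp 2 ^ N := by gcongr
      _ = Real.exp (N * 2) := by rw [← Real.exp_nat_mul]
      _ ≤ _ := Real.exp_le_exp.2 (by linarith)
  have hsum : ∑ k ∈ Finset.range (N + 1), |C k| ≤ Real.exp y * (Kc * Real.exp (y ^ 2)) := by
    calc _ ≤ ∑ k ∈ Finset.range (N + 1), Kc * Real.exp (y ^ 2) := by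
          refine Finset.sum_le_sum fun k hk => (hKc k).trans ?_
          have hkN : (k : ℝ) ≤ y :=
            le_trans (by exact_mod_cast Nat.lt_succ_iff.1 (Finset.mem_range.1 hk)) hNy
          gcongr
      _ = (N + 1) * (Kc * Real.exp (y ^ 2)) := by simp
      _ ≤ _ := by
          gcongr
          linarith [Real.add_one_le_exp y]
  have hexp : 2 * y + ((m + 1 : ℕ) : ℝ) * x + (y + y ^ 2) ≤
      (3 * N₁ + N₁ ^ 2 + (m + 1) * c₂) * ((r : ℝ) + 1) ^ (2 * d + κ₀) := by
    have e1 : ((r : ℝ) + 1) ^ d ≤ ((r : ℝ) + 1) ^ (2 * d + κ₀) := pow_le_pow_right₀ hr1 (by omega)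
    have e2 : (((r : ℝ) + 1) ^ d) ^ 2 ≤ ((r : ℝ) + 1) ^ (2 * d + κ₀) := by
      rw [← pow_mul]; exact pow_le_pow_right₀ hr1 (by omega)
    have e3 : ((r : ℝ) + 1) ^ κ₀ ≤ ((r : ℝ) + 1) ^ (2 * d + κ₀) := pow_le_pow_right₀ hr1 (by omega)
    have e4 := mul_le_mul_of_nonneg_left e1 (by positivity : 0 ≤ 3 * N₁)
    have e5 := mul_le_mul_of_nonneg_left e2 (by positivity : 0 ≤ N₁ ^ 2)
    have e6 := mul_le_mul_of_nonneg_left e3 (by positivity : 0 ≤ (m + 1) * c₂)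
    simp only [hy, x, mul_pow]
    push_cast
    linarith
  calc 4 ^ N * (L * Real.exp x) ^ (m + 1) * ∑ k ∈ Finset.range (N + 1), |C k|
      ≤ Real.exp (2 * y) * (L * Real.exp x) ^ (m + 1) *
        (Real.exp y * (Kc * Real.exp (y ^ 2))) := by gcongr
    _ = L ^ (m + 1) * Kc * Real.exp (2 * y + ((m + 1 : ℕ) : ℝ) * x + (y + y ^ 2)) := by
        rw [Real.exp_add, Real.exp_add, Real.exp_add, Real.exp_nat_mul, mul_pow]
        ring
    _ ≤ _ := by gcongr

/-- Truncate at the integer `g`-th root `r` of the separation `s`. The truncation error and the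
correlation of the truncated scores are both `O((r+1)^(-gM))`, hence `O((s+1)^(-M))` because `s + 1
≤ (r+1)^g`. -/
theorem fieldClusters_of_quasiLocal [IsProbabilityMeasure Pr] (hS : IsCayleyGenerating S)
    (hG : PolynomialGrowth S) (hP : ExpClustering S Pr P) {J : Type*} [Fintype J]
    {Ξ : J → V → Set V → ℝ} (h : ∀ j, QuasiLocal S Pr P (Ξ j)) : FieldClusters S Pr P Ξ := by
  intro m hm
  obtain ⟨C, c, φ, hcl, ⟨c₀, hc₀, hc⟩, ⟨a, ha0, ha, hC⟩, ⟨b, hb, hφ⟩⟩ := hP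
  obtain ⟨D, hD⟩ := hG.summable hS
  obtain ⟨Q, Q', q, hQ, hQ', hloc⟩ := hcl.abs_cov_trunc_le hS hG hc₀ hc ha0 ha hC h m
  obtain ⟨K, hK0, htr⟩ := QuasiLocal.truncation_error hS hcl.isSpinModel.measurable h m
  obtain ⟨g, hg, hroot⟩ := hφ.exists_root hcl.fastDecreasing hb hc₀ hQ' q
  -- The `m`-th root of `(s+1)^(-M)` is then `(s+1)^(-D)`, which is summable over the group.
  set M := D * m
  obtain ⟨r₀, hr₀⟩ := hroot (g * M)
  obtain ⟨T, hT0, hT⟩ := htr (g * M)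
  set r₁ := r₀ + 1
  set Q₁ : ℝ := Q + T * (1 + 2 * K)
  -- Absorbs the separations with `r < r₁`, where only the trivial bound `K + K * K` is available
  -- and `s + 1 ≤ r₁ ^ g`.
  set Q₂ : ℝ := (K + K * K) * ((r₁ : ℝ) ^ g) ^ M
  refine ⟨Q₁ + Q₂, fun s => 1 / ((s : ℝ) + 1) ^ M, by positivity, ?_, fun s => by positivity, ?_, ?_,
    ?_⟩
  · intro s s' hss
    dsimp only
    gcongr
  · intro s
    rw [div_le_one (by positivity)]
    exact one_le_pow₀ (by linarith [s.cast_nonneg (α := ℝ)])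
  · refine Summable.of_nonneg_of_le (fun x => by positivity) (fun x => ?_)
      (hD.mul_left (((m : ℝ) + 1) ^ D))
    set l := cdist S 0 x
    have hl : l + 1 ≤ (l / (m + 1) + 1) * (m + 1) :=
      (Nat.div_lt_iff_lt_mul m.succ_pos).1 (Nat.lt_succ_self _)
    have hl' : ((l : ℝ) + 1) ≤ (((l / (m + 1) : ℕ) : ℝ) + 1) * (m + 1) := by exact_mod_cast hl
    set y : ℝ := ((l / (m + 1) : ℕ) : ℝ) + 1
    have hy : 0 < y := by positivity
    have e1 : (1 / y ^ M) ^ (1 / (m : ℝ)) = 1 / y ^ D := by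
      rw [Real.div_rpow zero_le_one (by positivity), Real.one_rpow, pow_mul,
        ← Real.rpow_natCast (y ^ D) m, ← Real.rpow_mul (by positivity),
        mul_one_div_cancel (by positivity), Real.rpow_one]
    rw [e1, Real.rpow_neg (by positivity), Real.rpow_natCast, ← div_eq_mul_inv,
      div_le_div_iff₀ (by positivity) (by positivity), one_mul, ← mul_pow, mul_comm]
    gcongr
  · intro n hn z hz τ A B hAB s hs
    obtain ⟨r, hr1, hr2⟩ := exists_pow_le_lt hg s
    have hs1 : ((s : ℝ) + 1) ≤ ((r : ℝ) + 1) ^ g := by exact_mod_cast hr2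
    have hY : ∀ D, _ := fun D => (hT n hn z hz τ r D).1
    have hf : ∀ D, _ := fun D => (hT n hn z hz τ r D).2.1
    have hd : ∀ D, _ := fun D => (hT n hn z hz τ r D).2.2
    set y := fun D : Finset (Fin (m + 1)) =>
      ∫ ω, ∏ i ∈ D, scoreField S Pr P (Ξ (τ i)) n (z i) ω ∂Pr
    set f := fun D : Finset (Fin (m + 1)) =>
      ∫ ω, ∏ i ∈ D, truncField S Pr P (Ξ (τ i)) n r (z i) (P ω) ∂Pr
    change |y (A ∪ B) - y A * y B| ≤ _
    have hQ₁0 : 0 ≤ Q₁ := by positivity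
    have hQ₂0 : 0 ≤ Q₂ := by positivity
    rcases lt_or_ge r r₁ with hr | hr
    · have e1 : |y (A ∪ B) - y A * y B| ≤ K + K * K := by
        refine (abs_sub _ _).trans (add_le_add (hY _) ?_)
        rw [abs_mul]
        exact mul_le_mul (hY A) (hY B) (abs_nonneg _) hK0
      have e2 : K + K * K ≤ Q₂ * (1 / ((s : ℝ) + 1) ^ M) := by
        rw [mul_one_div, le_div_iff₀ (by positivity)]
        simp only [Q₂]
        gcongr
        refine hs1.trans ?_
        gcongr
        exact_mod_cast hr
      refine e1.trans (e2.trans ?_)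
      gcongr
      linarith
    · obtain ⟨h2r, hexp⟩ := hr₀ r (by omega) s hr1
      have hl := hloc n hn z hz τ r (by omega) A B hAB s hs h2r
      change |f (A ∪ B) - f A * f B| ≤ _ at hl
      set e : ℝ := 1 / ((r : ℝ) + 1) ^ (g * M)
      have he : e ≤ 1 / ((s : ℝ) + 1) ^ M := by
        simp only [e, pow_mul]
        gcongr
      have hd' : ∀ D, |y D - f D| ≤ T * e := fun D => by
        simp only [e, mul_one_div]; exact hd D
      have hTe : 0 ≤ T * e := by positivity
      -- Replace scores by truncated scores one factor at a time. The uniform bound `K` controls the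
      -- factor that is kept.
      have e1 : y (A ∪ B) - y A * y B = (y (A ∪ B) - f (A ∪ B)) + (f (A ∪ B) - f A * f B) -
          (y A * (y B - f B) + (y A - f A) * f B) := by ring
      have e2 : |y A * (y B - f B)| ≤ K * (T * e) := by
        rw [abs_mul]; exact mul_le_mul (hY A) (hd' B) (abs_nonneg _) hK0
      have e3 : |(y A - f A) * f B| ≤ T * e * K := by
        rw [abs_mul]; exact mul_le_mul (hd' A) (hf B) (abs_nonneg _) hTe
      have e4 : |f (A ∪ B) - f A * f B| ≤ Q * e := hl.trans (by gcongr)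
      have e5 : |y (A ∪ B) - y A * y B| ≤ Q₁ * e := by
        rw [e1]
        refine (abs_sub _ _).trans ?_
        have h1 := abs_add_le (y (A ∪ B) - f (A ∪ B)) (f (A ∪ B) - f A * f B)
        have h2 := abs_add_le (y A * (y B - f B)) ((y A - f A) * f B)
        have h3 := hd' (A ∪ B)
        simp only [Q₁]
        linarith
      refine e5.trans ?_
      calc Q₁ * e ≤ Q₁ * (1 / ((s : ℝ) + 1) ^ M) := by gcongr
        _ ≤ _ := by gcongr; linarith

end QuasiLocalClusters

/-! ### Covariances of the centred scores -/

section Covariances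

variable {V : Type*} [AddGroup V] {S : Finset V}
variable {Ω : Type*} [MeasurableSpace Ω] {Pr : Measure Ω} {P : Ω → Set V}

omit [AddGroup V] in
theorem DependsOnly.exists_bound {f : Set V → ℝ} {A : Finset V} (hf : DependsOnly f A) :
    ∃ b : ℝ, ∀ μ, |f μ| ≤ b := by
  classical
  refine ⟨∑ T ∈ A.powerset, |f T|, fun μ => ?_⟩
  have h : f μ = f (A.filter (· ∈ μ) : Finset V) := by
    refine hf _ _ ?_
    ext x
    simp only [Set.mem_inter_iff, Finset.coe_filter, Set.mem_ofPred_eq, Finset.mem_coe]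
    tauto
  rw [h]
  exact Finset.single_le_sum (f := fun T : Finset V => |f T|) (fun _ _ => abs_nonneg _)
    (Finset.mem_powerset.2 (Finset.filter_subset _ _))

/-- In a finite window the score is a function of finitely many spins and hence bounded. This needs
no moment condition and includes `n = 0`. -/
theorem hasMoments_score_window [IsFiniteMeasure Pr] (hP : Measurable P) {ξ : V → Set V → ℝ}
    (hξ : IsScoreFunction ξ) (n : ℕ) (x : V) :
    HasMoments Pr fun ω => ξ x (P ω ∩ window S n) := by
  have hdep : DependsOnly (fun μ => ξ x (μ ∩ window S n)) (windowFinset S n) := by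
    intro μ μ' h
    rw [coe_windowFinset] at h
    simp only [h]
  obtain ⟨b, hb⟩ := hdep.exists_bound
  exact HasMoments.of_bounded (measurable_score_window hP hξ x _) fun ω => hb (P ω)

theorem integral_scoreField [IsProbabilityMeasure Pr] {ξ : V → Set V → ℝ} {n : ℕ∞} {x : V}
    (h : HasMoments Pr fun ω => ξ x (P ω ∩ window S n)) :
    ∫ ω, scoreField S Pr P ξ n x ω ∂Pr = 0 := by
  simp only [scoreField]
  rw [integral_sub h.integrable (integrable_const _)]
  simp

theorem QuasiLocal.hasMoments_scoreField [IsProbabilityMeasure Pr] (hP : Measurable P)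
    {ξ : V → Set V → ℝ} (h : QuasiLocal S Pr P ξ) {n : ℕ∞} (hn : 1 ≤ n) {x : V}
    (hx : x ∈ window S n) : HasMoments Pr (scoreField S Pr P ξ n x) :=
  (h.hasMoments hP hn hx).sub_const _

/-- Clustering of two single points: the product of the means vanishes by centring, so the
covariance itself is small. The bound is kept at half the distance, where the summability of the
rate is known. -/
theorem FieldClusters.abs_integral_mul_le {J : Type*} [IsProbabilityMeasure Pr]
    {Ξ : J → V → Set V → ℝ} (h : FieldClusters S Pr P Ξ) (hP : Measurable P)
    (hq : ∀ j, QuasiLocal S Pr P (Ξ j)) :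
    ∃ g : ℕ → ℝ, (∀ s, 0 ≤ g s) ∧ (Summable fun x : V => g (cdist S 0 x)) ∧
      ∀ n : ℕ∞, 1 ≤ n → ∀ x ∈ window S n, ∀ y ∈ window S n, ∀ i j,
        |∫ ω, scoreField S Pr P (Ξ i) n x ω * scoreField S Pr P (Ξ j) n y ω ∂Pr| ≤
          g (cdist S x y) := by
  obtain ⟨Q, ψ, hQ, hψ, hψ0, -, hsum, hcl⟩ := h 1 one_pos
  refine ⟨fun s => Q * ψ (s / (1 + 1)), fun s => mul_nonneg hQ (hψ0 _), ?_, ?_⟩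
  · simpa using hsum.mul_left Q
  · intro n hn x hx y hy i j
    have h1 := hcl n hn ![x, y] (by intro a; fin_cases a <;> assumption) ![i, j] {0} {1}
      (by simp) (cdist S x y) (by simp)
    have h2 : ∫ ω, scoreField S Pr P (Ξ j) n y ω ∂Pr = 0 :=
      integral_scoreField ((hq j).hasMoments hP hn hy)
    simp only [show ({0} ∪ {1} : Finset (Fin (1 + 1))) = {0, 1} from rfl,
      Finset.prod_pair (zero_ne_one : (0 : Fin (1 + 1)) ≠ 1), Finset.prod_singleton,
      Matrix.cons_val_zero, Matrix.cons_val_one, h2, mul_zero, sub_zero] at h1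
    exact h1.trans (mul_le_mul_of_nonneg_left (hψ (Nat.div_le_self _ _)) hQ)

theorem integral_add_const_mul_add_const [IsProbabilityMeasure Pr] {u v : Ω → ℝ}
    (hu : HasMoments Pr u) (hv : HasMoments Pr v) (c d : ℝ) :
    ∫ ω, (u ω + c) * (v ω + d) ∂Pr - (∫ ω, u ω + c ∂Pr) * ∫ ω, v ω + d ∂Pr =
      ∫ ω, u ω * v ω ∂Pr - (∫ ω, u ω ∂Pr) * ∫ ω, v ω ∂Pr := by
  have h1 : ∀ ω, (u ω + c) * (v ω + d) = (u ω * v ω + d * u ω) + (c * v ω + c * d) :=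
    fun ω => by ring
  simp only [h1]
  have h2 : Integrable (fun ω => u ω * v ω + d * u ω) Pr :=
    ((hu.mul hv).add (hu.const_mul d)).integrable
  have h3 : Integrable (fun ω => c * v ω + c * d) Pr :=
    ((hv.const_mul c).add (HasMoments.const _)).integrable
  rw [integral_add h2 h3, integral_add (hu.mul hv).integrable (hu.const_mul d).integrable,
    integral_add (hv.const_mul c).integrable (integrable_const _),
    integral_add hu.integrable (integrable_const _),
    integral_add hv.integrable (integrable_const _), integral_const_mul, integral_const_mul]
  simp only [integral_const, probReal_univ, one_smul]
  ring

/-- Deep inside a window the covariances are close to those in infinite volume. -/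
theorem QuasiLocal.abs_cov_sub_cov_top_le [IsProbabilityMeasure Pr] (hS : IsCayleyGenerating S)
    (hP : Measurable P) {ξ : V → Set V → ℝ} (h : QuasiLocal S Pr P ξ) :
    ∃ C : ℝ, 0 ≤ C ∧ ∀ n : ℕ∞, 1 ≤ n → ∀ x y : V, ∀ r : ℕ,
      (cball S x r : Set V) ⊆ window S n → (cball S y r : Set V) ⊆ window S n →
        |∫ ω, scoreField S Pr P ξ n x ω * scoreField S Pr P ξ n y ω ∂Pr -
          ∫ ω, scoreField S Pr P ξ ⊤ x ω * scoreField S Pr P ξ ⊤ y ω ∂Pr| ≤ C / ((r : ℝ) + 1) := by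
  obtain ⟨K, -, hK⟩ := QuasiLocal.truncation_error hS hP (J := Unit) (fun _ => h) 1
  obtain ⟨C, hC0, hC⟩ := hK 1
  refine ⟨2 * C + 2 * C ^ 2, by positivity, fun n hn x y r hx hy => ?_⟩
  have hself : ∀ x : V, x ∈ cball S x r := fun x => by
    rw [mem_cball hS, (cdist_eq_zero_iff hS).2 rfl]; exact Nat.zero_le r
  set δ := C / ((r : ℝ) + 1) with hδ
  have hδ0 : 0 ≤ δ := by positivity
  -- The score has mean zero, so the mean of its truncation is at most the truncation error `δ`. Up
  -- to `δ + δ²` the covariance of the scores is thus that of the truncated ones.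
  have key : ∀ n : ℕ∞, 1 ≤ n → x ∈ window S n → y ∈ window S n →
      |∫ ω, scoreField S Pr P ξ n x ω * scoreField S Pr P ξ n y ω ∂Pr -
        ∫ ω, truncField S Pr P ξ n r x (P ω) * truncField S Pr P ξ n r y (P ω) ∂Pr| ≤ δ ∧
      |(∫ ω, truncField S Pr P ξ n r x (P ω) ∂Pr) * ∫ ω, truncField S Pr P ξ n r y (P ω) ∂Pr| ≤
        δ * δ := by
    intro n hn hx hy
    have hz : ∀ i, ![x, y] i ∈ window S n := by intro a; fin_cases a <;> assumption
    have h0 := fun A => (hC n hn ![x, y] hz (fun _ => ()) r A).2.2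
    simp only [pow_one] at h0
    have h1 := h0 {0, 1}
    have h2 := h0 {0}
    have h3 := h0 {1}
    simp only [Finset.prod_pair (zero_ne_one : (0 : Fin (1 + 1)) ≠ 1), Finset.prod_singleton,
      Matrix.cons_val_zero, Matrix.cons_val_one] at h1 h2 h3
    rw [integral_scoreField (h.hasMoments hP hn hx), zero_sub, abs_neg] at h2
    rw [integral_scoreField (h.hasMoments hP hn hy), zero_sub, abs_neg] at h3
    refine ⟨h1, ?_⟩
    rw [abs_mul]
    exact mul_le_mul h2 h3 (abs_nonneg _) hδ0
  have hxn := hx (hself x)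
  have hyn := hy (hself y)
  have htop : ∀ x : V, x ∈ window S ⊤ := fun x => by rw [window_top]; trivial
  obtain ⟨a1, a2⟩ := key n hn hxn hyn
  obtain ⟨b1, b2⟩ := key ⊤ le_top (htop x) (htop y)
  -- If the `r`-ball lies in the window, the truncated scores in `W_n` and in `V` coincide before
  -- centring. They differ by a constant, which does not affect covariances.
  have hshift : ∀ x : V, (cball S x r : Set V) ⊆ window S n → ∃ c : ℝ, ∀ ω,
      truncField S Pr P ξ ⊤ r x (P ω) = truncField S Pr P ξ n r x (P ω) + c := by
    intro x hx
    refine ⟨∫ ω', ξ x (P ω' ∩ window S n) ∂Pr - ∫ ω', ξ x (P ω' ∩ window S ⊤) ∂Pr, fun ω => ?_⟩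
    have h1 : truncScore S ξ r x (P ω ∩ window S ⊤) = truncScore S ξ r x (P ω ∩ window S n) := by
      have := dependsOnly_truncScore hS h.score r x Set.univ (P ω) (P ω ∩ window S n)
        (by rw [Set.inter_assoc, Set.inter_eq_self_of_subset_right hx])
      simpa [window_top] using this
    simp only [truncField, h1]
    ring
  obtain ⟨c, hc⟩ := hshift x hx
  obtain ⟨d, hd⟩ := hshift y hy
  have h5 := integral_add_const_mul_add_const (h.hasMoments_truncField hS hP hn hxn r)
    (h.hasMoments_truncField hS hP hn hyn r) c d
  simp only [← hc, ← hd] at h5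
  have hδ2 : δ * δ ≤ C ^ 2 / ((r : ℝ) + 1) := by
    rw [hδ, div_mul_div_comm, ← pow_two]
    refine div_le_div_of_nonneg_left (by positivity) (by positivity) ?_
    nlinarith [(Nat.cast_nonneg r : (0 : ℝ) ≤ r)]
  rw [add_div, mul_div_assoc, mul_div_assoc, ← hδ]
  rw [abs_le] at *
  constructor <;> linarith [a1.1, a1.2, a2.1, a2.2, b1.1, b1.2, b2.1, b2.2]

/-- The covariances in infinite volume are invariant under translations. -/
theorem IsSpinModel.integral_scoreField_mul (hP : IsSpinModel Pr P) {ξ ξ' : V → Set V → ℝ}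
    (hξ : IsScoreFunction ξ) (hξ' : IsScoreFunction ξ') (a x y : V) :
    ∫ ω, scoreField S Pr P ξ ⊤ (a + x) ω * scoreField S Pr P ξ' ⊤ (a + y) ω ∂Pr =
      ∫ ω, scoreField S Pr P ξ ⊤ x ω * scoreField S Pr P ξ' ⊤ y ω ∂Pr := by
  have hmean : ∀ {ξ : V → Set V → ℝ}, IsScoreFunction ξ → ∀ x,
      ∫ ω, ξ (a + x) (P ω) ∂Pr = ∫ ω, ξ x (P ω) ∂Pr := by
    intro ξ hξ x
    have := ((hP.stationary a).comp (hξ.measurable (a + x))).integral_eq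
    simpa only [Function.comp_def, hξ.translation] using this.symm
  simp only [scoreField, window_top, Set.inter_univ, hmean hξ, hmean hξ']
  set c := ∫ ω, ξ x (P ω) ∂Pr
  set d := ∫ ω, ξ' y (P ω) ∂Pr
  have := ((hP.stationary a).comp (((hξ.measurable (a + x)).sub_const c).mul
    ((hξ'.measurable (a + y)).sub_const d))).integral_eq
  simpa only [Function.comp_def, Pi.mul_apply, hξ.translation, hξ'.translation] using this.symm

end Covariances

/-! ### The central limit theorem for one score function -/

section CentralLimit

variable {V : Type*} [AddGroup V] {S : Finset V}

theorem sum_le_tsum_cdist (hS : IsCayleyGenerating S) {g : ℕ → ℝ} (hg : ∀ s, 0 ≤ g s)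
    (hsum : Summable fun x : V => g (cdist S 0 x)) (W : Finset V) (v : V) :
    ∑ y ∈ W, g (cdist S v y) ≤ ∑' x : V, g (cdist S 0 x) := by
  have h1 : ∀ y, g (cdist S v y) = (fun x : V => g (cdist S 0 x)) (Equiv.addLeft (-v) y) := by
    intro y
    rw [cdist_eq_neg_add hS v y]; rfl
  have h2 := (Equiv.addLeft (-v)).summable_iff.2 hsum
  simp only [h1]
  calc _ ≤ ∑' y, (fun x : V => g (cdist S 0 x)) (Equiv.addLeft (-v) y) :=
        h2.sum_le_tsum _ fun y _ => hg _
    _ = _ := (Equiv.addLeft (-v)).tsum_eq fun x : V => g (cdist S 0 x)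

/-- Averages of a kernel over large windows converge to the sum of the limiting kernel. -/
theorem tendsto_avg_sum_sum [Infinite V] (hS : IsCayleyGenerating S) (hV : VanishingBoundary S)
    {γ : ℕ → V → V → ℝ} {γ₀ : V → ℝ} {g : ℕ → ℝ} {C : ℝ}
    (hsum : Summable fun x : V => g (cdist S 0 x))
    (hg : ∀ n, 0 < n → ∀ x ∈ windowFinset S n, ∀ y ∈ windowFinset S n, |γ n x y| ≤ g (cdist S x y))
    (hγ₀ : ∀ z, |γ₀ z| ≤ g (cdist S 0 z)) (hC : 0 ≤ C)
    (hdeep : ∀ n, 0 < n → ∀ x z r, cball S x r ⊆ windowFinset S n →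
      cball S (x + z) r ⊆ windowFinset S n → |γ n x (x + z) - γ₀ z| ≤ C / ((r : ℝ) + 1)) :
    Tendsto (fun n => (∑ x ∈ windowFinset S n, ∑ y ∈ windowFinset S n, γ n x y) /
      (windowFinset S n).card) atTop (𝓝 (∑' z, γ₀ z)) := by
  classical
  -- Substitute `y = x + z` and extend by zero, so that the sum over `z` runs over the whole group
  -- and can be dominated by `g`.
  set c : ℕ → V → V → ℝ := fun n x z => if x + z ∈ windowFinset S n then γ n x (x + z) else 0
    with hc
  have hw : ∀ n, (0 : ℝ) < (windowFinset S n).card := fun n => by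
    exact_mod_cast card_windowFinset_pos hS n
  have hg0 : ∀ z : V, 0 ≤ g (cdist S 0 z) := fun z => (abs_nonneg _).trans (hγ₀ z)
  have hcg : ∀ n, 0 < n → ∀ x ∈ windowFinset S n, ∀ z, |c n x z| ≤ g (cdist S 0 z) := by
    intro n hn x hx z
    simp only [hc]
    split_ifs with h
    · refine (hg n hn x hx _ h).trans (le_of_eq ?_)
      rw [cdist_eq_neg_add hS x]; simp
    · simpa using hg0 z
  have hsumc : ∀ n x, Summable (c n x) ∧ ∑' z, c n x z = ∑ y ∈ windowFinset S n, γ n x y := by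
    intro n x
    have h1 : HasSum ((windowFinset S n : Set V).indicator (γ n x))
        (∑ y ∈ windowFinset S n, γ n x y) :=
      hasSum_subtype_iff_indicator.1 ((windowFinset S n).hasSum (γ n x))
    have h3 : c n x = (windowFinset S n : Set V).indicator (γ n x) ∘ Equiv.addLeft x := by
      ext z
      simp only [hc, Function.comp_apply, Equiv.coe_addLeft, Set.indicator_apply, Finset.mem_coe]
    have h2 : HasSum (c n x) (∑ y ∈ windowFinset S n, γ n x y) := by
      rw [h3]; exact (Equiv.addLeft x).hasSum_iff.2 h1
    exact ⟨h2.summable, h2.tsum_eq⟩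
  have hrew : ∀ n, (∑ x ∈ windowFinset S n, ∑ y ∈ windowFinset S n, γ n x y) /
      (windowFinset S n).card = ∑' z, (∑ x ∈ windowFinset S n, c n x z) /
        (windowFinset S n).card := by
    intro n
    rw [tsum_div_const, Summable.tsum_finsetSum fun x _ => (hsumc n x).1]
    simp only [(hsumc n _).2]
  simp only [hrew]
  refine tendsto_tsum_of_dominated_convergence (bound := fun z => g (cdist S 0 z)) hsum ?_ ?_
  · intro z
    rw [Metric.tendsto_atTop]
    intro ε hε
    obtain ⟨r, hr⟩ := exists_nat_gt (2 * C / ε)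
    have hr' : C / ((r : ℝ) + 1) < ε / 2 := by
      rw [div_lt_iff₀ hε] at hr
      rw [div_lt_iff₀ (by positivity)]
      nlinarith
    have hlim : Tendsto (fun n => 2 * g (cdist S 0 z) *
        (((shallow S n (r + cdist S 0 z)).card : ℝ) / (windowFinset S n).card)) atTop (𝓝 0) := by
      simpa using (hV (r + cdist S 0 z)).const_mul (2 * g (cdist S 0 z))
    obtain ⟨N, hN⟩ := eventually_atTop.1 ((tendsto_order.1 hlim).2 (ε / 2) (by positivity))
    refine ⟨max N 1, fun n hn => ?_⟩
    have hn1 : 0 < n := lt_of_lt_of_le one_pos ((le_max_right _ _).trans hn)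
    have hnN := hN n ((le_max_left _ _).trans hn)
    -- For deep `x` both `r`-balls lie in `W_n` and the kernel is close to its limit. For shallow
    -- `x` the bound `2 g` is used, and their proportion tends to zero. The radius `r + |z|` about
    -- `x` covers the `r`-ball about `x + z`.
    have hpt : ∀ x ∈ windowFinset S n, |c n x z - γ₀ z| ≤ C / ((r : ℝ) + 1) +
        if x ∈ shallow S n (r + cdist S 0 z) then 2 * g (cdist S 0 z) else 0 := by
      intro x hx
      split_ifs with h
      · have h1 := hcg n hn1 x hx z
        have h2 := hγ₀ z
        have h3 : 0 ≤ C / ((r : ℝ) + 1) := by positivity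
        refine (abs_sub _ _).trans ?_
        linarith
      · have h1 : cball S x (r + cdist S 0 z) ⊆ windowFinset S n := by
          by_contra hcon
          exact h (Finset.mem_filter.2 ⟨hx, hcon⟩)
        have hxz : cdist S x (x + z) = cdist S 0 z := by rw [cdist_eq_neg_add hS x]; simp
        have h2 : x + z ∈ windowFinset S n :=
          h1 ((mem_cball hS).2 (by omega))
        have h3 : cball S x r ⊆ windowFinset S n := fun y hy =>
          h1 ((mem_cball hS).2 (((mem_cball hS).1 hy).trans (Nat.le_add_right _ _)))
        have h4 : cball S (x + z) r ⊆ windowFinset S n := fun y hy => by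
          refine h1 ((mem_cball hS).2 ?_)
          have := (mem_cball hS).1 hy
          have := cdist_triangle hS x (x + z) y
          omega
        simpa only [hc, if_pos h2, add_zero] using hdeep n hn1 x z r h3 h4
    have h5 : (∑ x ∈ windowFinset S n, c n x z) / (windowFinset S n).card - γ₀ z =
        (∑ x ∈ windowFinset S n, (c n x z - γ₀ z)) / (windowFinset S n).card := by
      rw [Finset.sum_sub_distrib, Finset.sum_const, nsmul_eq_mul, sub_div,
        mul_div_cancel_left₀ _ (hw n).ne']
    rw [Real.dist_eq, h5, abs_div, abs_of_pos (hw n)]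
    have hsub : shallow S n (r + cdist S 0 z) ⊆ windowFinset S n := Finset.filter_subset _ _
    calc _ ≤ (∑ x ∈ windowFinset S n, (C / ((r : ℝ) + 1) +
          if x ∈ shallow S n (r + cdist S 0 z) then 2 * g (cdist S 0 z) else 0)) /
            (windowFinset S n).card := by
          gcongr
          exact (Finset.abs_sum_le_sum_abs _ _).trans (Finset.sum_le_sum hpt)
      _ = C / ((r : ℝ) + 1) + 2 * g (cdist S 0 z) *
          (((shallow S n (r + cdist S 0 z)).card : ℝ) / (windowFinset S n).card) := by
          rw [Finset.sum_add_distrib, Finset.sum_const, Finset.sum_ite_mem,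
            Finset.inter_eq_right.2 hsub, Finset.sum_const, nsmul_eq_mul, nsmul_eq_mul, add_div,
            mul_div_cancel_left₀ _ (hw n).ne']
          ring
      _ < ε := by linarith
  · filter_upwards [eventually_gt_atTop 0] with n hn z
    rw [Real.norm_eq_abs, abs_div, abs_of_pos (hw n), div_le_iff₀ (hw n)]
    calc _ ≤ ∑ x ∈ windowFinset S n, g (cdist S 0 z) :=
          (Finset.abs_sum_le_sum_abs _ _).trans (Finset.sum_le_sum fun x hx => hcg n hn x hx z)
      _ = _ := by rw [Finset.sum_const, nsmul_eq_mul, mul_comm]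

variable {Ω : Type*} [MeasurableSpace Ω] {Pr : Measure Ω} {P : Ω → Set V}

/-- The centred total mass, divided by the square root of the volume. -/
noncomputable def scaledSum (S : Finset V) (Pr : Measure Ω) (P : Ω → Set V) (ξ : V → Set V → ℝ)
    (n : ℕ) (ω : Ω) : ℝ :=
  (∑ x ∈ windowFinset S n, scoreField S Pr P ξ n x ω) / √(windowFinset S n).card

theorem hasMoments_scoreField_natCast [IsProbabilityMeasure Pr] (hP : Measurable P)
    {ξ : V → Set V → ℝ} (hξ : IsScoreFunction ξ) (n : ℕ) (x : V) :
    HasMoments Pr (scoreField S Pr P ξ n x) :=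
  (hasMoments_score_window hP hξ n x).sub_const _

theorem hasMoments_scaledSum [IsProbabilityMeasure Pr] (hP : Measurable P) {ξ : V → Set V → ℝ}
    (hξ : IsScoreFunction ξ) (n : ℕ) : HasMoments Pr (scaledSum S Pr P ξ n) := by
  have h := (HasMoments.finset_sum (A := windowFinset S n) fun x _ =>
    hasMoments_scoreField_natCast (S := S) (Pr := Pr) hP hξ n x).const_mul
      (√(windowFinset S n).card)⁻¹
  have h2 : scaledSum S Pr P ξ n = fun ω => (√(windowFinset S n).card)⁻¹ *
      ∑ x ∈ windowFinset S n, scoreField S Pr P ξ n x ω := by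
    ext ω; rw [scaledSum, div_eq_inv_mul]
  rw [h2]; exact h

theorem tendsto_integral_scaledSum_sq [Infinite V] [IsProbabilityMeasure Pr]
    (hS : IsCayleyGenerating S)
    (hV : VanishingBoundary S) (hP : IsSpinModel Pr P) {ξ : V → Set V → ℝ}
    (hq : QuasiLocal S Pr P ξ) (hcl : FieldClusters S Pr P fun _ : Unit => ξ) :
    Tendsto (fun n => ∫ ω, scaledSum S Pr P ξ n ω ^ 2 ∂Pr) atTop
      (𝓝 (∑' z, ∫ ω, scoreField S Pr P ξ ⊤ 0 ω * scoreField S Pr P ξ ⊤ z ω ∂Pr)) := by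
  obtain ⟨g, hg0, hgsum, hg⟩ := hcl.abs_integral_mul_le hP.measurable fun _ => hq
  obtain ⟨C, hC0, hC⟩ := hq.abs_cov_sub_cov_top_le hS hP.measurable
  have htop : ∀ x : V, x ∈ window S ⊤ := fun x => by rw [window_top]; trivial
  have hlim := tendsto_avg_sum_sum hS hV
    (γ := fun n x y => ∫ ω, scoreField S Pr P ξ n x ω * scoreField S Pr P ξ n y ω ∂Pr)
    (γ₀ := fun z => ∫ ω, scoreField S Pr P ξ ⊤ 0 ω * scoreField S Pr P ξ ⊤ z ω ∂Pr)
    hgsum (fun n hn x hx y hy => hg n (by exact_mod_cast hn) x (by rwa [← coe_windowFinset]) y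
      (by rwa [← coe_windowFinset]) () ())
    (fun z => hg ⊤ le_top 0 (htop 0) z (htop z) () ()) hC0 ?_
  · refine hlim.congr fun n => ?_
    have h1 : ∀ ω, scaledSum S Pr P ξ n ω ^ 2 = (∑ x ∈ windowFinset S n, ∑ y ∈ windowFinset S n,
        scoreField S Pr P ξ n x ω * scoreField S Pr P ξ n y ω) / (windowFinset S n).card := by
      intro ω
      rw [scaledSum, div_pow, Real.sq_sqrt (Nat.cast_nonneg _), sq, Finset.sum_mul_sum]
    have h2 : ∀ x y, HasMoments Pr fun ω =>
        scoreField S Pr P ξ n x ω * scoreField S Pr P ξ n y ω := fun x y =>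
      (hasMoments_scoreField_natCast hP.measurable hq.score n x).mul
        (hasMoments_scoreField_natCast hP.measurable hq.score n y)
    simp only [h1]
    rw [integral_div, integral_finsetSum _ fun x _ =>
      (HasMoments.finset_sum fun y _ => h2 x y).integrable]
    simp only [integral_finsetSum _ fun y _ => (h2 _ y).integrable]
  · intro n hn x z r hx hy
    have h3 := hP.integral_scoreField_mul (S := S) hq.score hq.score x 0 z
    rw [add_zero] at h3
    rw [← h3]
    refine hC n (by exact_mod_cast hn) x (x + z) r ?_ ?_ <;>
    · rw [← coe_windowFinset]; exact_mod_cast ‹_›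

theorem tendsto_integral_cexp_scaledSum [Infinite V] [IsProbabilityMeasure Pr]
    (hS : IsCayleyGenerating S)
    (hV : VanishingBoundary S) (hP : IsSpinModel Pr P) {ξ : V → Set V → ℝ}
    (hq : QuasiLocal S Pr P ξ) (hcl : FieldClusters S Pr P fun _ : Unit => ξ) {v : ℝ}
    (hv : v = ∑' z, ∫ ω, scoreField S Pr P ξ ⊤ 0 ω * scoreField S Pr P ξ ⊤ z ω ∂Pr) :
    Tendsto (fun n => ∫ ω, Complex.exp (scaledSum S Pr P ξ n ω * Complex.I) ∂Pr) atTop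
      (𝓝 (Complex.exp (-v / 2))) := by
  have hm := fun n x => hasMoments_scoreField_natCast (S := S) (Pr := Pr) hP.measurable hq.score n x
  have hm0 : ∀ (n : ℕ) (x : V), ∫ ω, scoreField S Pr P ξ n x ω ∂Pr = 0 := fun n x =>
    integral_scoreField (hasMoments_score_window hP.measurable hq.score n x)
  refine tendsto_integral_cexp_of_moments (fun n => hasMoments_scaledSum hP.measurable hq.score n)
    (tendsto_gaussianMoment (u := fun n => √(windowFinset S n).card)
      (Real.tendsto_sqrt_atTop.comp (tendsto_card_windowFinset hS))
      (Eventually.of_forall fun n => by simp) (Eventually.of_forall fun n => ?_)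
      (hv ▸ tendsto_integral_scaledSum_sq hS hV hP hq hcl) fun m hmpos => ?_)
  · simp only [pow_one, scaledSum]
    rw [integral_div, integral_finsetSum _ fun x _ => (hm n x).integrable]
    simp [hm0]
  · obtain ⟨Q, ψ, hQ, hψ, hψ0, hψ1, hsum, hcluster⟩ := hcl m hmpos
    obtain ⟨K, hK0, hK⟩ :=
      QuasiLocal.truncation_error hS hP.measurable (J := Unit) (fun _ => hq) m
    obtain ⟨C, -, hC⟩ := hK 0
    -- The constant does not depend on `n`: moments and clustering are uniform in the window, and
    -- sums over `W_n` are bounded by the sum over the group. `K + 1` serves as a moment bound that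
    -- is at least one.
    refine ⟨2 ^ m * (cumulantSplitBound (K + 1) m * Q *
      (1 + ∑' x : V, ψ (cdist S 0 x / (m + 1)) ^ (1 / (m : ℝ))) ^ m), ?_⟩
    filter_upwards [eventually_gt_atTop 0] with n hn
    have hn1 : (1 : ℕ∞) ≤ n := by exact_mod_cast hn
    have hmem : ∀ {z : Fin (m + 1) → V}, (∀ i, z i ∈ windowFinset S n) →
        ∀ i, z i ∈ window S n := fun hz i => by
      rw [← coe_windowFinset]; exact hz i
    refine ClusteringMoments.abs_moment_recursion_le (Y := scoreField S Pr P ξ n) hS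
      ⟨fun z hz A => ((hC n hn1 z (hmem hz) (fun _ => ()) 0 A).1).trans (by linarith),
        fun z hz A B hAB s hs => hcluster n hn1 z (hmem hz) (fun _ => ()) A B hAB s hs⟩
      (by linarith) hQ hψ hψ0 hψ1 ⟨0, zero_mem_windowFinset hS n⟩
      (fun v => sum_le_tsum_cdist hS (g := fun s => ψ (s / (m + 1)) ^ (1 / (m : ℝ)))
        (fun s => Real.rpow_nonneg (hψ0 _) _) hsum _ v)
      (fun x _ => hm n x) (fun x _ => hm0 n x) fun j => rfl

end CentralLimit

/-! ### The multivariate central limit theorem -/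

section Multivariate

variable {V : Type*} [AddGroup V] {S : Finset V}
variable {Ω : Type*} [MeasurableSpace Ω] {Pr : Measure Ω} {P : Ω → Set V}
variable {k : ℕ} {ξ : Fin k → V → Set V → ℝ}

theorem BoundedLocal.zero (hS : IsCayleyGenerating S) :
    BoundedLocal S (0 : V → Set V → ℝ) :=
  IsLocal.boundedLocal hS ⟨fun _ => measurable_const, fun _ _ _ => rfl, fun _ _ _ => rfl⟩
    ⟨1, one_pos, fun _ => 0, fun _ => rfl⟩

theorem BoundedLocal.linearCombination (hS : IsCayleyGenerating S)
    (h : ∀ i, BoundedLocal S (ξ i)) (t : Fin k → ℝ) : BoundedLocal S (∑ i, t i • ξ i) :=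
  Finset.sum_induction _ (BoundedLocal S) (fun _ _ h h' => h.add hS h') (BoundedLocal.zero hS)
    fun i _ => (h i).smul hS (t i)

theorem QuasiLocal.linearCombination [IsProbabilityMeasure Pr] (hS : IsCayleyGenerating S)
    (hP : Measurable P) (h : ∀ i, QuasiLocal S Pr P (ξ i)) (t : Fin k → ℝ) :
    QuasiLocal S Pr P (∑ i, t i • ξ i) :=
  Finset.sum_induction _ (QuasiLocal S Pr P) (fun _ _ h h' => h.add hS hP h')
    ((BoundedLocal.zero hS).quasiLocal hP) fun i _ => (h i).smul hS (t i)

theorem scoreField_linearCombination {n : ℕ∞} {x : V}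
    (h : ∀ i, Integrable (fun ω => ξ i x (P ω ∩ window S n)) Pr) (t : Fin k → ℝ) (ω : Ω) :
    scoreField S Pr P (∑ i, t i • ξ i) n x ω = ∑ i, t i * scoreField S Pr P (ξ i) n x ω := by
  simp only [scoreField, Finset.sum_apply, Pi.smul_apply, smul_eq_mul]
  rw [integral_finsetSum _ fun i _ => (h i).const_mul (t i), ← Finset.sum_sub_distrib]
  simp only [integral_const_mul, mul_sub]

theorem scaledSum_linearCombination [IsProbabilityMeasure Pr] (hP : Measurable P)
    (hξ : ∀ i, IsScoreFunction (ξ i)) (t : Fin k → ℝ) (n : ℕ) (ω : Ω) :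
    scaledSum S Pr P (∑ i, t i • ξ i) n ω = ∑ i, t i * scaledSum S Pr P (ξ i) n ω := by
  simp only [scaledSum, scoreField_linearCombination
    fun i => (hasMoments_score_window hP (hξ i) n _).integrable]
  rw [Finset.sum_comm, Finset.sum_div]
  simp only [← Finset.mul_sum, mul_div_assoc]

theorem totalMass_eq_sum {ξ : V → Set V → ℝ} (hξ : IsScoreFunction ξ) (n : ℕ) (μ : Set V) :
    totalMass S ξ n μ = ∑ x ∈ windowFinset S n, ξ x (μ ∩ window S n) := by
  classical
  rw [totalMass, Finset.sum_filter]
  refine Finset.sum_congr rfl fun x _ => ?_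
  split_ifs with h
  · rfl
  · exact (hξ.eq_zero _ _ fun h' => h h'.1).symm

theorem scaledMass_apply [IsProbabilityMeasure Pr] (hP : Measurable P)
    (hξ : ∀ i, IsScoreFunction (ξ i)) (n : ℕ) (ω : Ω) (i : Fin k) :
    scaledMass S Pr P ξ n ω i = scaledSum S Pr P (ξ i) n ω := by
  simp only [scaledMass, scaledSum, scoreField, totalMass_eq_sum (hξ i), ncard_window,
    Finset.sum_sub_distrib]
  rw [integral_finsetSum _ fun x _ => (hasMoments_score_window hP (hξ i) n x).integrable]

theorem covariance_eq_integral_scoreField (η η' : V → Set V → ℝ) (x y : V) :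
    covariance (fun ω => η x (P ω)) (fun ω => η' y (P ω)) Pr =
      ∫ ω, scoreField S Pr P η ⊤ x ω * scoreField S Pr P η' ⊤ y ω ∂Pr := by
  simp only [covariance, scoreField, window_top, Set.inter_univ]

/-- Reindex by `z ↦ -z` and translate by `z`, which carries the pair `(0, -z)` to `(z, 0)`. -/
theorem limitCov_isSymm (hP : IsSpinModel Pr P)
    (hξ : ∀ i, IsScoreFunction (ξ i)) (i j : Fin k) :
    limitCov Pr P ξ i j = limitCov Pr P ξ j i := by
  simp only [limitCov, Matrix.of_apply]
  rw [← (Equiv.neg V).tsum_eq]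
  refine tsum_congr fun z => ?_
  -- The window of infinite radius is the whole group for any `S`, so the empty set serves.
  simp only [Equiv.neg_apply, covariance_eq_integral_scoreField (S := ∅)]
  rw [← hP.integral_scoreField_mul (hξ i) (hξ j) z 0 (-z)]
  simp only [add_zero, add_neg_cancel, mul_comm]

theorem dotProduct_limitCov_mulVec [IsProbabilityMeasure Pr] (hP : Measurable P)
    (hq : ∀ i, QuasiLocal S Pr P (ξ i))
    (hsum : ∀ i j, Summable fun z : V =>
      covariance (fun ω => ξ i 0 (P ω)) (fun ω => ξ j z (P ω)) Pr) (t : Fin k → ℝ) :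
    t ⬝ᵥ (limitCov Pr P ξ).mulVec t = ∑' z, ∫ ω, scoreField S Pr P (∑ i, t i • ξ i) ⊤ 0 ω *
      scoreField S Pr P (∑ i, t i • ξ i) ⊤ z ω ∂Pr := by
  have htop : ∀ x : V, x ∈ window S ⊤ := fun x => by rw [window_top]; trivial
  have hm : ∀ i x, HasMoments Pr (scoreField S Pr P (ξ i) ⊤ x) := fun i x =>
    (hq i).hasMoments_scoreField hP le_top (htop x)
  have h1 : ∀ z, ∫ ω, scoreField S Pr P (∑ i, t i • ξ i) ⊤ 0 ω *
      scoreField S Pr P (∑ i, t i • ξ i) ⊤ z ω ∂Pr = ∑ i, ∑ j, t i * t j *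
        covariance (fun ω => ξ i 0 (P ω)) (fun ω => ξ j z (P ω)) Pr := by
    intro z
    have h2 : ∀ ω, scoreField S Pr P (∑ i, t i • ξ i) ⊤ 0 ω *
        scoreField S Pr P (∑ i, t i • ξ i) ⊤ z ω = ∑ i, ∑ j, t i * t j *
          (scoreField S Pr P (ξ i) ⊤ 0 ω * scoreField S Pr P (ξ j) ⊤ z ω) := by
      intro ω
      rw [scoreField_linearCombination fun i => ((hq i).hasMoments hP le_top (htop 0)).integrable,
        scoreField_linearCombination fun i => ((hq i).hasMoments hP le_top (htop z)).integrable,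
        Finset.sum_mul_sum]
      exact Finset.sum_congr rfl fun i _ => Finset.sum_congr rfl fun j _ => by ring
    have h3 : ∀ i j, HasMoments Pr fun ω => t i * t j *
        (scoreField S Pr P (ξ i) ⊤ 0 ω * scoreField S Pr P (ξ j) ⊤ z ω) := fun i j =>
      ((hm i 0).mul (hm j z)).const_mul _
    simp only [h2]
    rw [integral_finsetSum _ fun i _ => (HasMoments.finset_sum fun j _ => h3 i j).integrable]
    refine Finset.sum_congr rfl fun i _ => ?_
    rw [integral_finsetSum _ fun j _ => (h3 i j).integrable]
    exact Finset.sum_congr rfl fun j _ => by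
      rw [integral_const_mul, covariance_eq_integral_scoreField (S := S)]
  simp only [h1]
  rw [Summable.tsum_finsetSum fun i _ => summable_sum fun j _ => (hsum i j).mul_left _]
  simp only [dotProduct, Matrix.mulVec, limitCov, Matrix.of_apply, Finset.mul_sum]
  refine Finset.sum_congr rfl fun i _ => ?_
  rw [Summable.tsum_finsetSum fun j _ => (hsum i j).mul_left _]
  refine Finset.sum_congr rfl fun j _ => ?_
  rw [tsum_mul_left]
  ring

/-- The characteristic function of the vector at `t` is that of the scalar score `∑ i, t i • ξ i` at
`1`, and the quadratic form of `limitCov` at `t` is its limiting variance. Clustering of the family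
`ξ` serves the mixed covariances. -/
theorem multivariate_clt [Infinite V] [IsProbabilityMeasure Pr] (hS : IsCayleyGenerating S)
    (hV : VanishingBoundary S) (hP : IsSpinModel Pr P) (hq : ∀ i, QuasiLocal S Pr P (ξ i))
    (hcl : FieldClusters S Pr P ξ)
    (hlin : ∀ t : Fin k → ℝ, FieldClusters S Pr P fun _ : Unit => ∑ i, t i • ξ i) :
    (∀ i z, MemLp (fun ω => ξ i z (P ω)) 2 Pr) ∧
    (∀ i (n : ℕ), Integrable (fun ω => totalMass S (ξ i) n (P ω)) Pr) ∧
    (∀ i j, Summable fun z : V =>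
      covariance (fun ω => ξ i 0 (P ω)) (fun ω => ξ j z (P ω)) Pr) ∧
    (limitCov Pr P ξ).PosSemidef ∧
    TendstoInDistribution (fun n => scaledMass S Pr P ξ n) atTop
      (id : EuclideanSpace ℝ (Fin k) → EuclideanSpace ℝ (Fin k))
      (fun _ => Pr) (multivariateGaussian 0 (limitCov Pr P ξ)) := by
  have hξ : ∀ i, IsScoreFunction (ξ i) := fun i => (hq i).score
  have htop : ∀ x : V, x ∈ window S ⊤ := fun x => by rw [window_top]; trivial
  have hsum : ∀ i j, Summable fun z : V =>
      covariance (fun ω => ξ i 0 (P ω)) (fun ω => ξ j z (P ω)) Pr := by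
    intro i j
    obtain ⟨g, -, hgs, hg⟩ := hcl.abs_integral_mul_le hP.measurable hq
    refine Summable.of_norm_bounded hgs fun z => ?_
    rw [Real.norm_eq_abs, covariance_eq_integral_scoreField (S := S)]
    exact hg ⊤ le_top 0 (htop 0) z (htop z) i j
  have hquad := dotProduct_limitCov_mulVec hP.measurable hq hsum
  have hql := QuasiLocal.linearCombination hS hP.measurable hq
  have hpsd : (limitCov Pr P ξ).PosSemidef := by
    refine Matrix.PosSemidef.of_dotProduct_mulVec_nonneg
      (Matrix.IsHermitian.ext fun i j => limitCov_isSymm hP hξ j i) fun t => ?_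
    rw [star_trivial, hquad t]
    -- The quadratic form is a limit of second moments, hence non-negative.
    exact ge_of_tendsto' (tendsto_integral_scaledSum_sq hS hV hP (hql t) (hlin t))
      fun n => integral_nonneg fun ω => sq_nonneg _
  refine ⟨fun i z => ?_, fun i n => ?_, hsum, hpsd, ?_⟩
  · have := ((hq i).hasMoments hP.measurable le_top (htop z)).memLp_two
    simpa only [window_top, Set.inter_univ] using this
  · simp only [totalMass_eq_sum (hξ i)]
    exact (HasMoments.finset_sum fun x _ =>
      hasMoments_score_window hP.measurable (hξ i) n x).integrable
  · have hmeas : ∀ n, Measurable (scaledMass S Pr P ξ n) := by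
      intro n
      have h1 : scaledMass S Pr P ξ n = fun ω => WithLp.toLp 2 fun i =>
          scaledSum S Pr P (ξ i) n ω := by
        ext ω i
        exact scaledMass_apply hP.measurable hξ n ω i
      rw [h1]
      exact (WithLp.measurable_toLp 2 _).comp (measurable_pi_iff.2 fun i =>
        (hasMoments_scaledSum hP.measurable (hξ i) n).measurable)
    refine ⟨fun n => (hmeas n).aemeasurable, aemeasurable_id, ?_⟩
    refine ProbabilityMeasure.tendsto_of_tendsto_charFun fun t => ?_
    have hlim := tendsto_integral_cexp_scaledSum hS hV hP (hql t) (hlin t) (hquad t)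
    simp only [ProbabilityMeasure.coe_mk, Measure.map_id]
    rw [charFun_multivariateGaussian hpsd, inner_zero_right, Complex.ofReal_zero, zero_mul,
      zero_sub, ← neg_div]
    refine hlim.congr fun n => ?_
    rw [charFun_apply, integral_map (hmeas n).aemeasurable (by fun_prop)]
    refine integral_congr_ae (ae_of_all _ fun ω => ?_)
    have h2 : inner ℝ (scaledMass S Pr P ξ n ω) t =
        scaledSum S Pr P (∑ i, t i • ξ i) n ω := by
      rw [scaledSum_linearCombination hP.measurable hξ, PiLp.inner_apply]
      refine Finset.sum_congr rfl fun i _ => ?_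
      rw [← scaledMass_apply hP.measurable hξ]
      rfl
    simp only [h2]

end Multivariate

end SpinCLT

/-- The two cases differ only in why boundaries are negligible and why the scores cluster. -/
theorem mainTheorem2 {V : Type*} [AddGroup V] [Infinite V]
    (S : Finset V) (hS : IsCayleyGenerating S)
    {Ω : Type*} [MeasurableSpace Ω] (Pr : Measure Ω) [IsProbabilityMeasure Pr]
    (P : Ω → Set V) {k : ℕ} (ξ : Fin k → V → Set V → ℝ) (hξ : ∀ i, IsScoreFunction (ξ i))
    (h : (BAmenable S ∧ SummablyClustering S Pr P ∧ ∀ i, IsLocal S (ξ i)) ∨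
      (PolynomialGrowth S ∧ ExpClustering S Pr P ∧
        ∀ i, ExpQuasiLocal S Pr P (ξ i) ∧ ExpGrowth S (ξ i) ∧
          ∀ p : ℝ, 1 ≤ p → MomentCondition S Pr P (ξ i) p)) :
    -- the covariances and means in the statement are well defined
    (∀ i z, MemLp (fun ω => ξ i z (P ω)) 2 Pr) ∧
    (∀ i (n : ℕ), Integrable (fun ω => totalMass S (ξ i) n (P ω)) Pr) ∧
    -- the series defining the covariance matrix converge absolutely
    (∀ i j, Summable fun z : V =>
      covariance (fun ω => ξ i 0 (P ω)) (fun ω => ξ j z (P ω)) Pr) ∧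
    -- and they define a covariance matrix
    (limitCov Pr P ξ).PosSemidef ∧
    -- convergence in distribution
    TendstoInDistribution (fun n => scaledMass S Pr P ξ n) atTop
      (id : EuclideanSpace ℝ (Fin k) → EuclideanSpace ℝ (Fin k))
      (fun _ => Pr) (multivariateGaussian 0 (limitCov Pr P ξ)) := by
  rcases h with ⟨hA, hP, hloc⟩ | ⟨hG, hP, hqloc⟩
  · have hb : ∀ i, BoundedLocal S (ξ i) := fun i => (hloc i).boundedLocal hS (hξ i)
    have hspin : IsSpinModel Pr P := by
      obtain ⟨C, c, φ, hcl, -⟩ := hP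
      exact hcl.isSpinModel
    exact multivariate_clt hS (hA.vanishingBoundary hS) hspin
      (fun i => (hb i).quasiLocal hspin.measurable) (fieldClusters_of_boundedLocal hS hP hb)
      fun t => fieldClusters_of_boundedLocal hS hP fun _ => BoundedLocal.linearCombination hS hb t
  · have hspin : IsSpinModel Pr P := by
      obtain ⟨C, c, φ, hcl, -⟩ := hP
      exact hcl.isSpinModel
    have hq : ∀ i, QuasiLocal S Pr P (ξ i) := fun i =>
      quasiLocal_of_exp hspin.measurable (hξ i) (hqloc i).1 (hqloc i).2.1 (hqloc i).2.2
    exact multivariate_clt hS (hG.vanishingBoundary hS) hspin hq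
      (fieldClusters_of_quasiLocal hS hG hP hq) fun t => fieldClusters_of_quasiLocal hS hG hP
        fun _ => QuasiLocal.linearCombination hS hspin.measurable hq t
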